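/- Let $M,N$ be smooth (Hausdorff, second countable, finite-dimensional) manifolds, let $\pi:E\to M$ and $F\to N$ be smooth real vector bundles of finite rank, and let $\mathcal M=\Pi E=(M,\Gamma_{\Lambda E^*})$ and $\mathcal N=\Pi F=(N,\Gamma_{\Lambda F^*})$ be the associated supermanifolds, with sheaves of superfunctions $\mathcal O_{\mathcal M},\mathcal O_{\mathcal N}$ and sheaves of superderivations $\mathcal T_{\mathcal M},\mathcal T_{\mathcal N}$. A connection on $\mathcal M$ is an even morphism of sheaves $\nabla:\mathcal T_{\mathcal M}\otimes_{\mathbb R}\mathcal T_{\mathcal M}\to\mathcal T_{\mathcal M}$ that is $\mathcal O_{\mathcal M}$-linear in the first argument and satisfies $\nabla_X(fY)=X(f)Y+(-1)^{|X||f|}f\nabla_XY$ for homogeneous $X,f$. *Reduced connection.* Let $pr$ be the projection of $\mathcal O_{\mathcal M}$ onto $\mathcal F=\Gamma_{\mathbb R\oplus E^*}$, and let $\psi$ be the isomorphism $s_{\bar 0}+s_{\bar 1}\mapsto\big(e\mapsto s_{\bar 0}(\pi e)+s_{\bar 1}(\pi e)(e)\big)$ from $\mathcal F$ to the smooth functions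 on $E$ that are affine linear on the fibres. Let $\mathcal L_{\bar 0}\subset\mathcal T_{\mathcal M}$ be the even superderivations preserving $\mathcal F$; for $X\in\mathcal L_{\bar 0}(U)$ let $\Psi(X)$ be the smooth vector field on $\pi^{-1}(U)\subset E$ with $\Psi(X)(\psi f)=\psi(Xf)$ for all local sections $f$ of $\mathcal F$. A connection $\nabla^{TE}$ on the manifold $E$ is said to be induced by $\nabla$ if it is smooth and $$\big(\nabla^{TE}_{\Psi(X)}\Psi(Y)\big)(\psi f)=\psi\big(pr((\nabla_XY)f)\big)$$ for all open $U\subset M$, all $X,Y\in\mathcal L_{\bar 0}(U)$ and all local sections $f$ of $\mathcal F$ over open subsets of $U$. *Induced bundle map.* Let $\Phi:\mathcal M\to\mathcal N$ be a diffeomorphism of supermanifolds, i.e. a diffeomorphism $\varphi:M\to N$ with an isomorphism $\Phi^*:\mathcal O_{\mathcal N}\to\varphi_*\mathcal O_{\mathcal M}$ of sheaves of superalgebras, and let $\Phi_*X=(\Phi^*)^{-1}\circ X\circ\Phi^*$ for $X\in\varphi_*\mathcal T_{\mathcal M}$. A fibrewise linear map $\hat\Phi:E\to F$ over $\varphi$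 is said to be induced by $\Phi$ if for every open $W\subset N$, every smooth section $s$ of $E$ over $\varphi^{-1}(W)$, with $\iota_s$ the odd superderivation given by contraction with $s$, every local section $f=f_{\bar 0}+f_{\bar 1}$ of $\Gamma_{\mathbb R\oplus F^*}$ over an open subset of $W$ and every $x$ with $\varphi(x)$ in this subset, the component of degree $0$ of $(\Phi_*\iota_s)(f)$ at $\varphi(x)$ equals $f_{\bar 1}(\varphi(x))\big(\hat\Phi(s(x))\big)$. **Lemma 3.12.** Let $\nabla^{\mathcal M},\nabla^{\mathcal N}$ be connections on $\mathcal M,\mathcal N$ and let $\Phi:(\mathcal M,\nabla^{\mathcal M})\to(\mathcal N,\nabla^{\mathcal N})$ be a diffeomorphism of supermanifolds with connection, i.e. a diffeomorphism of supermanifolds such that $\Phi_*(\nabla^{\mathcal M}_XY)=\nabla^{\mathcal N}_{\Phi_*X}\Phi_*Y$ for all open $W\subset N$ and all $X,Y\in\mathcal T_{\mathcal M}(\varphi^{-1}(W))$. Then $\nabla^{\mathcal M}$ and $\nabla^{\mathcal N}$ induce connections on the manifolds $E$ and $F$; there is exactly one fibrewise linear map $\hat\Phi:E\to F$ over $\varphi$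 induced by $\Phi$, and it is a diffeomorphism (so an isomorphism of smooth vector bundles). Moreover, for all connections $\nabla^{TE}$ and $\nabla^{TF}$ induced by $\nabla^{\mathcal M}$ and $\nabla^{\mathcal N}$, the map $\hat\Phi:(E,\nabla^{TE})\to(F,\nabla^{TF})$ is a diffeomorphism of manifolds with connection: $\hat\Phi_*(\nabla^{TE}_XY)=\nabla^{TF}_{\hat\Phi_*X}\hat\Phi_*Y$ for all smooth vector fields $X,Y$ on open subsets of $E$. -/

import Mathlib

open Set Bundle TopologicalSpace
open scoped Manifold ContDiff Topology

noncomputable section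

namespace SuperGeom

/-! ### The exterior algebra of a dual vector space -/

/-- The exterior algebra `Λ V*`. -/
abbrev LDual (V : Type*) [AddCommGroup V] [Module ℝ V] : Type _ :=
  ExteriorAlgebra ℝ (Module.Dual ℝ V)

section Algebra

variable {V V' : Type*} [AddCommGroup V] [Module ℝ V] [AddCommGroup V'] [Module ℝ V']

/-- The component of exterior degree `0` of an element of `Λ V*`. -/
def body : LDual V →ₐ[ℝ] ℝ := ExteriorAlgebra.algebraMapInv

/-- The component of exterior degree `1` of an element of `Λ V*`. -/
def linPart : LDual V →ₗ[ℝ] Module.Dual ℝ V := ExteriorAlgebra.ιInv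

/-- The elements of `Λ V*` of parity `a` (spanned by the exterior powers whose degree has
parity `a`). -/
def parityPart (V : Type*) [AddCommGroup V] [Module ℝ V] (a : ZMod 2) :
    Submodule ℝ (LDual V) :=
  CliffordAlgebra.evenOdd (0 : QuadraticForm ℝ (Module.Dual ℝ V)) a

/-- The sign `(-1)^(ab)`. -/
def sgn (a b : ZMod 2) : ℝ := if a = 1 ∧ b = 1 then -1 else 1

lemma sgn_add_left (a c b : ZMod 2) : sgn (c + a) b = sgn a b * sgn c b := by
  revert a b c
  have h : ∀ a c b : ZMod 2, (if c + a = 1 ∧ b = 1 then (-1 : ℤ) else 1) =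
      (if a = 1 ∧ b = 1 then -1 else 1) * (if c = 1 ∧ b = 1 then -1 else 1) := by decide
  intro a c b
  have := h a c b
  unfold sgn
  exact_mod_cast this

lemma parityPart_mul {a b : ZMod 2} {u v : LDual V} (hu : u ∈ parityPart V a)
    (hv : v ∈ parityPart V b) : u * v ∈ parityPart V (a + b) :=
  CliffordAlgebra.evenOdd_mul_le _ a b (Submodule.mul_mem_mul hu hv)

lemma parityPart_comm {a b : ZMod 2} {u v : LDual V} (hu : u ∈ parityPart V a)
    (hv : v ∈ parityPart V b) : u * v = sgn a b • (v * u) := by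
  have h := CliffordAlgebra.map_mul_map_of_isOrtho_of_mem_evenOdd
    (QuadraticMap.Isometry.id (0 : QuadraticForm ℝ (Module.Dual ℝ V)))
    (QuadraticMap.Isometry.id (0 : QuadraticForm ℝ (Module.Dual ℝ V)))
    (by intro x y; simp [QuadraticMap.IsOrtho]) u v hu hv
  rw [CliffordAlgebra.map_id] at h
  simp only [AlgHom.id_apply] at h
  rw [h]
  unfold sgn
  have h2 : ∀ a : ZMod 2, a = 0 ∨ a = 1 := by decide
  rcases h2 a with rfl | rfl <;> rcases h2 b with rfl | rfl <;> simp

/-- The projection of `Λ V*` to its part of parity `a`. -/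
def parityProj (a : ZMod 2) : LDual V →ₗ[ℝ] LDual V :=
  (1 / 2 : ℝ) • (LinearMap.id + sgn a 1 • CliffordAlgebra.involute.toLinearMap)

lemma parityProj_mem (a : ZMod 2) (u : LDual V) : parityProj a u ∈ parityPart V a := by
  have h2 : ∀ a : ZMod 2, a = 0 ∨ a = 1 := by decide
  have hu : u ∈ parityPart V 0 ⊔ parityPart V 1 := by
    have := (CliffordAlgebra.evenOdd_isCompl
      (Q := (0 : QuadraticForm ℝ (Module.Dual ℝ V)))).sup_eq_top
    unfold parityPart; rw [this]; trivial
  obtain ⟨v, hv, w, hw, rfl⟩ := Submodule.mem_sup.1 hu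
  have h0 := CliffordAlgebra.involute_eq_of_mem_even hv
  have h1 := CliffordAlgebra.involute_eq_of_mem_odd hw
  have e : parityProj a (v + w) = if a = 0 then v else w := by
    rcases h2 a with rfl | rfl <;>
    · simp [parityProj, sgn, h0, h1]
      module
  rw [e]
  rcases h2 a with rfl | rfl
  · simpa using hv
  · simpa using hw

lemma parityProj_add (u : LDual V) : parityProj 0 u + parityProj 1 u = u := by
  simp [parityProj, sgn]; module

lemma parityProj_map (g : Module.Dual ℝ V →ₗ[ℝ] Module.Dual ℝ V') (a : ZMod 2) (u : LDual V) :
    ExteriorAlgebra.map g (parityProj a u) = parityProj a (ExteriorAlgebra.map g u) := by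
  have h : (ExteriorAlgebra.map g).comp
        (CliffordAlgebra.involute (Q := (0 : QuadraticForm ℝ (Module.Dual ℝ V)))) =
      (CliffordAlgebra.involute (Q := (0 : QuadraticForm ℝ (Module.Dual ℝ V')))).comp
        (ExteriorAlgebra.map g) := by
    apply ExteriorAlgebra.hom_ext
    ext m
    simp [ExteriorAlgebra.ι, CliffordAlgebra.involute_ι]
  have h' := DFunLike.congr_fun h u
  simp only [AlgHom.comp_apply] at h'
  simp [parityProj, h']

end Algebra

/-! ### Superfunctions on `ΠE` -/

section SuperFunctions

variable (A : Type*) [NormedAddCommGroup A] [NormedSpace ℝ A]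
  (V : Type*) [NormedAddCommGroup V] [NormedSpace ℝ V]
  {M : Type*} [TopologicalSpace M] [ChartedSpace A M]
  (E : M → Type*) [∀ x, AddCommGroup (E x)] [∀ x, Module ℝ (E x)]
  [∀ x, TopologicalSpace (E x)] [TopologicalSpace (TotalSpace V E)]
  [FiberBundle V E] [VectorBundle ℝ V E]

variable {V E} in
/-- The expression of an element of `Λ E_x*` in a local trivialization of `E`. -/
def localRep (e : Trivialization V (π V E)) [e.IsLinear ℝ] (x : M) :
    LDual (E x) →ₐ[ℝ] LDual V :=
  ExteriorAlgebra.map (((e.symmL ℝ x : V →L[ℝ] E x) : V →ₗ[ℝ] E x).dualMap)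

/-- Smoothness of a section of `Λ E*` over `U`: in every local trivialization of `E`, all the
coefficients (i.e. all the linear functionals of the local expression) are smooth. -/
def IsSmooth (U : Opens M) (w : ∀ x : U, LDual (E x)) : Prop :=
  ∀ (e : Trivialization V (π V E)) [MemTrivializationAtlas e] (l : Module.Dual ℝ (LDual V)),
    ∃ g : M → ℝ, ContMDiffOn 𝓘(ℝ, A) 𝓘(ℝ, ℝ) ∞ g (U ∩ e.baseSet) ∧
      ∀ x : U, (x : M) ∈ e.baseSet → g x = l (localRep e x (w x))

variable [FiniteDimensional ℝ V]

/-- The smooth sections of `Λ E*` over `U`, as a subalgebra of all sections. -/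
def smoothSections (U : Opens M) : Subalgebra ℝ (∀ x : U, LDual (E x)) where
  carrier := {w | IsSmooth A V E U w}
  mul_mem' := by
    intro a b ha hb e _ l
    let B := (Module.finBasis ℝ (Module.Dual ℝ V)).ExteriorAlgebra
    choose ga hga ha' using fun i => ha e (B.coord i)
    choose gb hgb hb' using fun i => hb e (B.coord i)
    refine ⟨fun x => ∑ i, ∑ j, ga i x * gb j x * l (B i * B j), ?_, ?_⟩
    · apply contMDiffOn_finsetSum
      intro i _
      apply contMDiffOn_finsetSum
      intro j _
      exact ((hga i).mul (hgb j)).mul contMDiffOn_const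
    · intro x hx
      have h1 := B.sum_repr (localRep e x (a x))
      have h2 := B.sum_repr (localRep e x (b x))
      simp only [Pi.mul_apply, map_mul]
      conv_rhs => rw [← h1, ← h2]
      simp only [Finset.sum_mul, Finset.mul_sum, map_sum, smul_mul_smul_comm, map_smul,
        smul_eq_mul, ha' _ x hx, hb' _ x hx, Module.Basis.coord_apply]
      rw [Finset.sum_comm]
  add_mem' := by
    intro a b ha hb e _ l
    obtain ⟨g, hg, h⟩ := ha e l
    obtain ⟨g', hg', h'⟩ := hb e l
    exact ⟨fun x => g x + g' x, hg.add hg', fun x hx => by simp [h x hx, h' x hx]⟩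
  algebraMap_mem' := by
    intro r e _ l
    refine ⟨fun _ => l (algebraMap ℝ _ r), contMDiffOn_const, fun x _ => ?_⟩
    simp [localRep, Pi.algebraMap_apply]

/-- The algebra `𝒪(U) = Γ(U, Λ E*)` of superfunctions over `U`. -/
def SuperFun (U : Opens M) : Type _ := smoothSections A V E U

instance (U : Opens M) : Ring (SuperFun A V E U) :=
  inferInstanceAs (Ring (smoothSections A V E U))

instance (U : Opens M) : Algebra ℝ (SuperFun A V E U) :=
  inferInstanceAs (Algebra ℝ (smoothSections A V E U))

variable {A V E}

/-- The value of a superfunction, i.e. of a section of `Λ E*`, at a point. -/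
def SuperFun.val {U : Opens M} (f : SuperFun A V E U) (x : U) : LDual (E x) :=
  (show smoothSections A V E U from f).1 x

lemma SuperFun.ext {U : Opens M} {f g : SuperFun A V E U} (h : ∀ x, f.val x = g.val x) :
    f = g := Subtype.ext (funext h)

lemma SuperFun.smooth {U : Opens M} (f : SuperFun A V E U) : IsSmooth A V E U f.val :=
  (show smoothSections A V E U from f).2

/-- Restriction of superfunctions to a smaller open set. -/
def res {U U' : Opens M} (h : U' ≤ U) : SuperFun A V E U →ₐ[ℝ] SuperFun A V E U' where
  toFun f := ⟨fun x => f.val ⟨x, h x.2⟩, fun e _ l => by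
    obtain ⟨g, hg, hh⟩ := f.smooth e l
    exact ⟨g, hg.mono (inter_subset_inter_left _ h), fun x hx => hh ⟨x, h x.2⟩ hx⟩⟩
  map_one' := rfl
  map_mul' _ _ := rfl
  map_zero' := rfl
  map_add' _ _ := rfl
  commutes' _ := rfl

/-- `f` is homogeneous of parity `a`. -/
def HasParity {U : Opens M} (a : ZMod 2) (f : SuperFun A V E U) : Prop :=
  ∀ x : U, f.val x ∈ parityPart (E x) a

/-- `f` belongs to `𝓕(U) = Γ(U, ℝ ⊕ E*)`: it has components in exterior degrees `0` and `1`
only. -/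
def IsAffine {U : Opens M} (f : SuperFun A V E U) : Prop :=
  ∀ x : U, ∃ (c : ℝ) (η : Module.Dual ℝ (E x)), f.val x = algebraMap ℝ _ c + ExteriorAlgebra.ι ℝ η

open Classical in
/-- The map `ψ ∘ pr`: project a superfunction `f` over `U` to its part `f₀ + f₁` in exterior
degrees `0` and `1`, and regard this as the fibrewise affine function
`e ↦ f₀(π e) + f₁(π e)(e)` on `π⁻¹ U` (extended by zero to the total space of `E`). On `𝓕(U)`,
this is the isomorphism `ψ` to the smooth fibrewise affine functions. -/
def psi {U : Opens M} (f : SuperFun A V E U) (p : TotalSpace V E) : ℝ :=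
  if h : p.proj ∈ U then body (f.val ⟨p.proj, h⟩) + linPart (f.val ⟨p.proj, h⟩) p.2 else 0

/-- The component of parity `a` of a superfunction. -/
def comp {U : Opens M} (a : ZMod 2) (f : SuperFun A V E U) : SuperFun A V E U :=
  ⟨fun x => parityProj a (f.val x), fun e _ l => by
    obtain ⟨g, hg, h⟩ := f.smooth e (l ∘ₗ parityProj a)
    refine ⟨g, hg, fun x hx => ?_⟩
    rw [h x hx]
    simp only [localRep, LinearMap.comp_apply, parityProj_map]⟩

lemma comp_hasParity {U : Opens M} (a : ZMod 2) (f : SuperFun A V E U) :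
    HasParity a (comp a f) := fun x => parityProj_mem a (f.val x)

lemma comp_add_comp {U : Opens M} (f : SuperFun A V E U) : comp 0 f + comp 1 f = f := by
  apply SuperFun.ext
  intro x
  exact parityProj_add (f.val x)

lemma HasParity.mul {U : Opens M} {a b : ZMod 2} {f g : SuperFun A V E U}
    (hf : HasParity a f) (hg : HasParity b g) : HasParity (a + b) (f * g) :=
  fun x => parityPart_mul (hf x) (hg x)

lemma HasParity.comm {U : Opens M} {a b : ZMod 2} {f g : SuperFun A V E U}
    (hf : HasParity a f) (hg : HasParity b g) : f * g = sgn a b • (g * f) := by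
  apply SuperFun.ext
  intro x
  exact parityPart_comm (hf x) (hg x)

lemma HasParity.res {U U' : Opens M} (h : U' ≤ U) {a : ZMod 2} {f : SuperFun A V E U}
    (hf : HasParity a f) : HasParity a (res h f) := fun x => hf ⟨x, h x.2⟩

/-! ### Super vector fields -/

variable (A V E)

/-- Families of real-linear endomorphisms of the spaces `𝒪(W)`, `W ⊆ U` open. -/
abbrev PreEnd (U : Opens M) : Type _ :=
  ∀ W : {W : Opens M // W ≤ U}, Module.End ℝ (SuperFun A V E W.1)

/-- The superderivations of parity `a` of the sheaf `𝒪|_U`. -/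
def SuperDer (U : Opens M) (a : ZMod 2) : Submodule ℝ (PreEnd A V E U) where
  carrier := {X |
    (∀ (W W' : {W : Opens M // W ≤ U}) (h : W'.1 ≤ W.1) (f : SuperFun A V E W.1),
      X W' (res h f) = res h (X W f)) ∧
    (∀ (W : {W : Opens M // W ≤ U}) (b : ZMod 2) (f : SuperFun A V E W.1),
      HasParity b f → HasParity (a + b) (X W f)) ∧
    (∀ (W : {W : Opens M // W ≤ U}) (b : ZMod 2) (f g : SuperFun A V E W.1),
      HasParity b f → X W (f * g) = X W f * g + sgn a b • (f * X W g))}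
  add_mem' := by
    rintro X Y ⟨h1, h2, h3⟩ ⟨k1, k2, k3⟩
    refine ⟨fun W W' h f => ?_, fun W b f hf => ?_, fun W b f g hf => ?_⟩
    · simp [h1 W W' h f, k1 W W' h f]
    · exact fun x => Submodule.add_mem (parityPart (E x) (a + b)) (h2 W b f hf x) (k2 W b f hf x)
    · simp only [Pi.add_apply, LinearMap.add_apply, h3 W b f g hf, k3 W b f g hf, add_mul,
        mul_add, smul_add]
      abel
  zero_mem' := by
    refine ⟨fun W W' h f => ?_, fun W b f _ x => ?_, fun W b f g _ => ?_⟩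
    · simp
    · exact Submodule.zero_mem (parityPart (E x) (a + b))
    · simp
  smul_mem' := by
    rintro c X ⟨h1, h2, h3⟩
    refine ⟨fun W W' h f => ?_, fun W b f hf x => ?_, fun W b f g hf => ?_⟩
    · simp [h1 W W' h f]
    · exact Submodule.smul_mem (parityPart (E x) (a + b)) c (h2 W b f hf x)
    · simp only [Pi.smul_apply, LinearMap.smul_apply, h3 W b f g hf, smul_add, smul_mul_assoc,
        mul_smul_comm, smul_comm c]

/-- The space `𝒯(U)` of super vector fields over `U`: sums of an even and an odd
superderivation of `𝒪|_U`. -/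
def SuperVF (U : Opens M) : Submodule ℝ (PreEnd A V E U) :=
  SuperDer A V E U 0 ⊔ SuperDer A V E U 1

variable {A V E}

lemma superDer_le (U : Opens M) (a : ZMod 2) : SuperDer A V E U a ≤ SuperVF A V E U := by
  have h2 : ∀ a : ZMod 2, a = 0 ∨ a = 1 := by decide
  rcases h2 a with rfl | rfl
  · exact le_sup_left
  · exact le_sup_right

/-- The action of a super vector field over `U` on superfunctions over `W ⊆ U`. -/
def act {U : Opens M} (X : SuperVF A V E U) {W : Opens M} (h : W ≤ U)
    (f : SuperFun A V E W) : SuperFun A V E W :=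
  X.1 ⟨W, h⟩ f

/-- A super vector field is homogeneous of parity `a`. -/
def VFParity {U : Opens M} (a : ZMod 2) (X : SuperVF A V E U) : Prop :=
  X.1 ∈ SuperDer A V E U a

/-- Restriction of super vector fields to a smaller open set. -/
def resVF {U U' : Opens M} (h : U' ≤ U) (X : SuperVF A V E U) : SuperVF A V E U' :=
  ⟨fun W => X.1 ⟨W.1, W.2.trans h⟩, by
    have key : ∀ (a : ZMod 2) (Y : PreEnd A V E U), Y ∈ SuperDer A V E U a →
        (fun W : {W : Opens M // W ≤ U'} => Y ⟨W.1, W.2.trans h⟩) ∈ SuperDer A V E U' a := by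
      rintro a Y ⟨h1, h2, h3⟩
      exact ⟨fun W W' => h1 ⟨W.1, W.2.trans h⟩ ⟨W'.1, W'.2.trans h⟩,
        fun W => h2 ⟨W.1, W.2.trans h⟩, fun W => h3 ⟨W.1, W.2.trans h⟩⟩
    obtain ⟨Y, hY, Z, hZ, e⟩ := Submodule.mem_sup.1 X.2
    rw [← e]
    exact add_mem (superDer_le U' 0 (key 0 Y hY)) (superDer_le U' 1 (key 1 Z hZ))⟩

lemma mul_mem_superDer {U : Opens M} {c a : ZMod 2} {f : SuperFun A V E U} {X : PreEnd A V E U}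
    (hf : HasParity c f) (hX : X ∈ SuperDer A V E U a) :
    (fun W => LinearMap.mulLeft ℝ (res W.2 f) ∘ₗ X W : PreEnd A V E U) ∈
      SuperDer A V E U (c + a) := by
  obtain ⟨h1, h2, h3⟩ := hX
  refine ⟨fun W W' h g => ?_, fun W b g hg => ?_, fun W b g k hg => ?_⟩
  · simp only [LinearMap.comp_apply, LinearMap.mulLeft_apply, h1 W W' h g, map_mul]
    rfl
  · rw [add_assoc]
    exact (hf.res W.2).mul (h2 W b g hg)
  · have hc := (hf.res W.2).comm hg
    simp only [LinearMap.comp_apply, LinearMap.mulLeft_apply, h3 W b g k hg, mul_add,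
      mul_smul_comm, ← mul_assoc, hc, sgn_add_left, smul_mul_assoc, smul_smul]

/-- Multiplication `f X` of a super vector field by a superfunction. -/
def mulVF {U : Opens M} (f : SuperFun A V E U) (X : SuperVF A V E U) : SuperVF A V E U :=
  ⟨fun W => LinearMap.mulLeft ℝ (res W.2 f) ∘ₗ X.1 W, by
    obtain ⟨Y, hY, Z, hZ, e⟩ := Submodule.mem_sup.1 X.2
    have e2 : (fun W => LinearMap.mulLeft ℝ (res W.2 f) ∘ₗ X.1 W : PreEnd A V E U) =
        (fun W => LinearMap.mulLeft ℝ (res W.2 (comp 0 f)) ∘ₗ Y W : PreEnd A V E U) +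
        (fun W => LinearMap.mulLeft ℝ (res W.2 (comp 0 f)) ∘ₗ Z W : PreEnd A V E U) +
        (fun W => LinearMap.mulLeft ℝ (res W.2 (comp 1 f)) ∘ₗ Y W : PreEnd A V E U) +
        (fun W => LinearMap.mulLeft ℝ (res W.2 (comp 1 f)) ∘ₗ Z W : PreEnd A V E U) := by
      funext W
      ext1 g
      rw [← e]
      conv_lhs => rw [← comp_add_comp f]
      simp only [LinearMap.comp_apply, LinearMap.mulLeft_apply, Pi.add_apply,
        LinearMap.add_apply, map_add, add_mul]
      abel
    rw [e2]
    exact add_mem (add_mem (add_mem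
      (superDer_le U _ (mul_mem_superDer (comp_hasParity 0 f) hY))
      (superDer_le U _ (mul_mem_superDer (comp_hasParity 0 f) hZ)))
      (superDer_le U _ (mul_mem_superDer (comp_hasParity 1 f) hY)))
      (superDer_le U _ (mul_mem_superDer (comp_hasParity 1 f) hZ))⟩

/-- Membership in `𝓛₀(U)`: even super vector fields preserving the sheaf `𝓕`. -/
def InL0 {U : Opens M} (X : SuperVF A V E U) : Prop :=
  VFParity 0 X ∧ ∀ (W : Opens M) (h : W ≤ U) (f : SuperFun A V E W),
    IsAffine f → IsAffine (act X h f)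

/-- `X` is the odd super vector field over `U` given by contraction with the section `s` of `E`:
it kills functions on the base and maps a section `η` of `E*` to the function `η(s)`. -/
def IsContraction {U : Opens M} (s : ∀ x, E x) (X : SuperVF A V E U) : Prop :=
  VFParity 1 X ∧ ∀ (W : Opens M) (h : W ≤ U) (f : SuperFun A V E W), IsAffine f →
    ∀ x : W, (act X h f).val x = algebraMap ℝ _ (linPart (f.val x) (s x))

/-! ### Connections on `ΠE` -/

variable (A V E) in
/-- A connection on the supermanifold `ΠE`: an even morphism of sheaves
`∇ : 𝒯 ⊗_ℝ 𝒯 → 𝒯`, `𝒪`-linear in the first argument and satisfying the graded Leibniz rule in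
the second argument. -/
structure SuperConnection where
  /-- `nabla U X Y` is `∇_X Y`. -/
  nabla : ∀ U : Opens M, SuperVF A V E U →ₗ[ℝ] SuperVF A V E U →ₗ[ℝ] SuperVF A V E U
  nabla_res : ∀ (U U' : Opens M) (h : U' ≤ U) (X Y : SuperVF A V E U),
    nabla U' (resVF h X) (resVF h Y) = resVF h (nabla U X Y)
  even : ∀ (U : Opens M) (a b : ZMod 2) (X Y : SuperVF A V E U),
    VFParity a X → VFParity b Y → VFParity (a + b) (nabla U X Y)
  linear_left : ∀ (U : Opens M) (f : SuperFun A V E U) (X Y : SuperVF A V E U),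
    nabla U (mulVF f X) Y = mulVF f (nabla U X Y)
  leibniz : ∀ (U : Opens M) (a b : ZMod 2) (f : SuperFun A V E U) (X Y : SuperVF A V E U),
    VFParity a X → HasParity b f →
      nabla U X (mulVF f Y) =
        mulVF (act X le_rfl f) Y + sgn a b • mulVF f (nabla U X Y)

/-! ### The reduced connection on the total space of `E` -/

variable (A V E) in
/-- Vector fields on the manifold `E` (the total space of the bundle), not necessarily smooth. -/
abbrev TotalVF : Type _ := ∀ p : TotalSpace V E, TangentSpace (𝓘(ℝ, A).prod 𝓘(ℝ, V)) p

/-- Smoothness of a vector field on the manifold `E` over a set `S`. -/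
def SmoothVFOn [IsManifold 𝓘(ℝ, A) ∞ M] [ContMDiffVectorBundle ∞ V E 𝓘(ℝ, A)]
    (X : TotalVF A V E) (S : Set (TotalSpace V E)) : Prop :=
  ContMDiffOn (𝓘(ℝ, A).prod 𝓘(ℝ, V)) (𝓘(ℝ, A).prod 𝓘(ℝ, V)).tangent ∞
    (fun p => (⟨p, X p⟩ : TangentBundle (𝓘(ℝ, A).prod 𝓘(ℝ, V)) (TotalSpace V E))) S

/-- `X'` is (over `π⁻¹ U`) the vector field `Ψ(X)` on the manifold `E` obtained from `X` by
conjugation with `ψ`: it is smooth and `X'(ψ f) = ψ(X f)` for all local sections `f` of `𝓕`. -/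
def IsPsi [IsManifold 𝓘(ℝ, A) ∞ M] [ContMDiffVectorBundle ∞ V E 𝓘(ℝ, A)] {U : Opens M}
    (X : SuperVF A V E U) (X' : TotalVF A V E) : Prop :=
  SmoothVFOn X' {p | p.proj ∈ U} ∧
    ∀ (W : Opens M) (h : W ≤ U) (f : SuperFun A V E W), IsAffine f →
      ∀ p : TotalSpace V E, p.proj ∈ W →
        mvfderiv (𝓘(ℝ, A).prod 𝓘(ℝ, V)) (psi f) p (X' p) = psi (act X h f) p

variable (A V E) in
/-- Connections on (the tangent bundle of) the manifold `E`. -/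
abbrev TotalConnection [IsManifold 𝓘(ℝ, A) ∞ M] [ContMDiffVectorBundle ∞ V E 𝓘(ℝ, A)] : Type _ :=
  CovariantDerivative (𝓘(ℝ, A).prod 𝓘(ℝ, V)) (A × V)
    (fun p : TotalSpace V E => TangentSpace (𝓘(ℝ, A).prod 𝓘(ℝ, V)) p)

/-- `D` is the connection `∇^{TE}` on the manifold `E` induced by the connection `∇` on the
supermanifold `ΠE`: the smooth connection on `E` which extends the operation
`∇' : 𝓛₀' × 𝓛₀' → 𝓛₀'` obtained from `p ∘ ∇ : 𝓛₀ × 𝓛₀ → 𝓛₀` via `Ψ`. Here `p(Z) = pr ∘ Z` on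
`𝓕`, so `∇'_{Ψ X} (Ψ Y) = Ψ (p (∇_X Y))` means that this vector field sends `ψ(f)` to
`ψ(pr((∇_X Y) f))` for all local sections `f` of `𝓕`. -/
def IsReduction [IsManifold 𝓘(ℝ, A) ∞ M] [ContMDiffVectorBundle ∞ V E 𝓘(ℝ, A)]
    (C : SuperConnection A V E) (D : TotalConnection A V E) : Prop :=
  CovariantDerivative.ContMDiffCovariantDerivative D ∞ ∧
    ∀ (U : Opens M) (X Y : SuperVF A V E U) (X' Y' : TotalVF A V E),
      InL0 X → InL0 Y → IsPsi X X' → IsPsi Y Y' →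
      ∀ (W : Opens M) (h : W ≤ U) (f : SuperFun A V E W), IsAffine f →
        ∀ p : TotalSpace V E, p.proj ∈ W →
          mvfderiv (𝓘(ℝ, A).prod 𝓘(ℝ, V)) (psi f) p (D Y' p (X' p)) =
            psi (act (C.nabla U X Y) h f) p

end SuperFunctions

/-! ### Diffeomorphisms -/

section Diffeo

variable (A : Type*) [NormedAddCommGroup A] [NormedSpace ℝ A]
  (V : Type*) [NormedAddCommGroup V] [NormedSpace ℝ V] [FiniteDimensional ℝ V]
  {M : Type*} [TopologicalSpace M] [ChartedSpace A M]
  (E : M → Type*) [∀ x, AddCommGroup (E x)] [∀ x, Module ℝ (E x)]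
  [∀ x, TopologicalSpace (E x)] [TopologicalSpace (TotalSpace V E)]
  [FiberBundle V E] [VectorBundle ℝ V E]
  (B : Type*) [NormedAddCommGroup B] [NormedSpace ℝ B]
  (V' : Type*) [NormedAddCommGroup V'] [NormedSpace ℝ V'] [FiniteDimensional ℝ V']
  {N : Type*} [TopologicalSpace N] [ChartedSpace B N]
  (F : N → Type*) [∀ x, AddCommGroup (F x)] [∀ x, Module ℝ (F x)]
  [∀ x, TopologicalSpace (F x)] [TopologicalSpace (TotalSpace V' F)]
  [FiberBundle V' F] [VectorBundle ℝ V' F]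

/-- The preimage of an open set under a diffeomorphism. -/
def preim {A B M N : Type*} [NormedAddCommGroup A] [NormedSpace ℝ A] [TopologicalSpace M]
    [ChartedSpace A M] [NormedAddCommGroup B] [NormedSpace ℝ B] [TopologicalSpace N]
    [ChartedSpace B N] (φ : Diffeomorph 𝓘(ℝ, A) 𝓘(ℝ, B) M N ∞) (W : Opens N) : Opens M :=
  ⟨φ ⁻¹' W, W.2.preimage φ.continuous⟩

lemma preim_mono {A B M N : Type*} [NormedAddCommGroup A] [NormedSpace ℝ A]
    [TopologicalSpace M]
    [ChartedSpace A M] [NormedAddCommGroup B] [NormedSpace ℝ B] [TopologicalSpace N]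
    [ChartedSpace B N] (φ : Diffeomorph 𝓘(ℝ, A) 𝓘(ℝ, B) M N ∞) {W W' : Opens N} (h : W' ≤ W) :
    preim φ W' ≤ preim φ W := fun _ hx => h hx

/-- A diffeomorphism `Φ : ΠE → ΠF` of supermanifolds: a diffeomorphism `φ : M → N` together with
an isomorphism `Φ^* : 𝒪_{ΠF} → φ_* 𝒪_{ΠE}` of sheaves of superalgebras. -/
structure SuperDiffeo where
  /-- The underlying map `φ`. -/
  base : Diffeomorph 𝓘(ℝ, A) 𝓘(ℝ, B) M N ∞
  /-- The pullback `Φ^*` of superfunctions. -/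
  pull : ∀ W : Opens N, SuperFun B V' F W ≃ₐ[ℝ] SuperFun A V E (preim base W)
  pull_res : ∀ (W W' : Opens N) (h : W' ≤ W) (f : SuperFun B V' F W),
    pull W' (res h f) = res (preim_mono base h) (pull W f)
  pull_parity : ∀ (W : Opens N) (a : ZMod 2) (f : SuperFun B V' F W),
    HasParity a (pull W f) ↔ HasParity a f

variable {A V E B V' F}

/-- Conjugation `(Φ^*)⁻¹ ∘ Y ∘ Φ^*`. -/
def SuperDiffeo.conj (Φ : SuperDiffeo A V E B V' F) {W : Opens N}
    (Y : PreEnd A V E (preim Φ.base W)) : PreEnd B V' F W := fun W' =>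
  (Φ.pull W'.1).symm.toLinearMap ∘ₗ
    (Y ⟨preim Φ.base W'.1, preim_mono Φ.base W'.2⟩ ∘ₗ (Φ.pull W'.1).toLinearMap)

lemma SuperDiffeo.pull_conj (Φ : SuperDiffeo A V E B V' F) {W : Opens N}
    (Y : PreEnd A V E (preim Φ.base W)) (W' : {W' : Opens N // W' ≤ W})
    (f : SuperFun B V' F W'.1) :
    Φ.pull W'.1 (Φ.conj Y W' f) =
      Y ⟨preim Φ.base W'.1, preim_mono Φ.base W'.2⟩ (Φ.pull W'.1 f) :=
  (Φ.pull W'.1).apply_symm_apply _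

lemma SuperDiffeo.conj_mem (Φ : SuperDiffeo A V E B V' F) {W : Opens N} {a : ZMod 2}
    {Y : PreEnd A V E (preim Φ.base W)} (hY : Y ∈ SuperDer A V E (preim Φ.base W) a) :
    Φ.conj Y ∈ SuperDer B V' F W a := by
  obtain ⟨h1, h2, h3⟩ := hY
  refine ⟨fun W₁ W₂ h f => ?_, fun W₁ b f hf => ?_, fun W₁ b f g hf => ?_⟩
  · apply (Φ.pull W₂.1).injective
    rw [Φ.pull_conj, Φ.pull_res, Φ.pull_res, Φ.pull_conj]
    exact h1 ⟨preim Φ.base W₁.1, preim_mono Φ.base W₁.2⟩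
      ⟨preim Φ.base W₂.1, preim_mono Φ.base W₂.2⟩ (preim_mono Φ.base h) _
  · rw [← Φ.pull_parity, Φ.pull_conj]
    exact h2 _ b _ ((Φ.pull_parity _ _ _).2 hf)
  · apply (Φ.pull W₁.1).injective
    rw [Φ.pull_conj, map_mul (Φ.pull W₁.1) f g, map_add, map_smul, map_mul (Φ.pull W₁.1),
      map_mul (Φ.pull W₁.1), Φ.pull_conj, Φ.pull_conj]
    exact h3 _ b _ _ ((Φ.pull_parity _ _ _).2 hf)

/-- The pushforward `Φ_* X = (Φ^*)⁻¹ ∘ X ∘ Φ^*` of super vector fields. -/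
def SuperDiffeo.push (Φ : SuperDiffeo A V E B V' F) {W : Opens N}
    (X : SuperVF A V E (preim Φ.base W)) : SuperVF B V' F W :=
  ⟨Φ.conj X.1, by
    obtain ⟨Y, hY, Z, hZ, e⟩ := Submodule.mem_sup.1 X.2
    have e2 : Φ.conj X.1 = Φ.conj Y + Φ.conj Z := by
      rw [← e]
      funext W'
      ext1 f
      apply (Φ.pull W'.1).injective
      rw [Pi.add_apply, LinearMap.add_apply, map_add, Φ.pull_conj, Φ.pull_conj, Φ.pull_conj,
        Pi.add_apply, LinearMap.add_apply]
    rw [e2]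
    exact add_mem (superDer_le W 0 (Φ.conj_mem hY)) (superDer_le W 1 (Φ.conj_mem hZ))⟩

/-- `Φ : (ΠE, ∇) → (ΠF, ∇')` is a diffeomorphism of supermanifolds with connection:
`Φ_* (∇_X Y) = ∇'_{Φ_* X} (Φ_* Y)`. -/
def SuperDiffeo.PreservesConnection (Φ : SuperDiffeo A V E B V' F)
    (C : SuperConnection A V E) (C' : SuperConnection B V' F) : Prop :=
  ∀ (W : Opens N) (X Y : SuperVF A V E (preim Φ.base W)),
    Φ.push (C.nabla _ X Y) = C'.nabla W (Φ.push X) (Φ.push Y)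

/-- The fibrewise linear map `L : E → F` over `φ` is the bundle map `Φ̂ = p ∘ Φ_*` induced by `Φ`,
with smooth local sections `s` of `E` identified with the contractions `X = ι_s`, and similarly
for `F`: on sections of `ℝ ⊕ F*`, the component of `Φ_* X` of exterior degree `-1` is the
contraction with the section `L s` of `F`. -/
def SuperDiffeo.IsInduced (Φ : SuperDiffeo A V E B V' F)
    (L : ∀ x : M, E x →ₗ[ℝ] F (Φ.base x)) : Prop :=
  ∀ (W : Opens N) (s : ∀ x, E x) (X : SuperVF A V E (preim Φ.base W)),
    ContMDiffOn 𝓘(ℝ, A) (𝓘(ℝ, A).prod 𝓘(ℝ, V)) ∞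
      (fun x => (⟨x, s x⟩ : TotalSpace V E)) (preim Φ.base W) →
    IsContraction s X →
    ∀ (W' : Opens N) (h : W' ≤ W) (f : SuperFun B V' F W'), IsAffine f →
      ∀ (x : M) (hx : Φ.base x ∈ W'),
        body ((act (Φ.push X) h f).val ⟨Φ.base x, hx⟩) =
          linPart (f.val ⟨Φ.base x, hx⟩) (L x (s x))

/-- `Ψ : (E, D) → (F, D')` is a diffeomorphism of manifolds with connection:
`Ψ_* (D_X Y) = D'_{Ψ_* X} (Ψ_* Y)` for smooth vector fields `X`, `Y` on open sets. Here `Ψ_*` is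
the pullback of vector fields along `Ψ⁻¹`. -/
def IsConnectionDiffeo [IsManifold 𝓘(ℝ, A) ∞ M] [ContMDiffVectorBundle ∞ V E 𝓘(ℝ, A)]
    [IsManifold 𝓘(ℝ, B) ∞ N] [ContMDiffVectorBundle ∞ V' F 𝓘(ℝ, B)]
    (Ψ : Diffeomorph (𝓘(ℝ, A).prod 𝓘(ℝ, V)) (𝓘(ℝ, B).prod 𝓘(ℝ, V'))
      (TotalSpace V E) (TotalSpace V' F) ∞)
    (D : TotalConnection A V E) (D' : TotalConnection B V' F) : Prop :=
  let push : TotalVF A V E → TotalVF B V' F :=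
    VectorField.mpullback (𝓘(ℝ, B).prod 𝓘(ℝ, V')) (𝓘(ℝ, A).prod 𝓘(ℝ, V)) Ψ.symm
  ∀ (O : Opens (TotalSpace V E)) (X Y : TotalVF A V E), SmoothVFOn X O → SmoothVFOn Y O →
    ∀ q : TotalSpace V' F, Ψ.symm q ∈ O →
      push (fun p => D Y p (X p)) q = D' (push Y) q (push X q)

end Diffeo

end SuperGeom

end

/-! Let J be the ideal of superfunctions generated by the odd ones. Its square consists of the
elements of exterior degree at least two, so 𝓕 is a copy of 𝒪/J², and `psi` reads a class in 𝒪/J² as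
a fibrewise affine function on the total space. Even superderivations and pullbacks Φ^* preserve
parity, hence J and J², so they act on 𝒪/J² even when they do not preserve the subspace 𝓕. Two
consequences carry the proof. For even X the relation defining Ψ(X), demanded only on 𝓕, holds for
all superfunctions (`IsPsi.mvfderiv_psi`). For every superfunction f one has ψ(f) ∘ Φ̂ = ψ(Φ^* f)
(`psi_totalMap`). Together they give Φ̂_* Ψ(X) = Ψ(Φ_* X) (`IsPsi.push`), although Φ_* need not map
𝓛₀ to 𝓛₀.

Existence of the induced connection is a coordinate computation. Take local coordinates z = (xⁱ, θᵃ)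
on the supermanifold. By Hadamard's lemma a superderivation is determined by its values on them
(`der_eq_zero`), so X = Σ X(z^γ) ∂_γ. The functions ψ(z^γ) = (xⁱ, yᵃ) are coordinates on the total
space. Expanding ∇_X Y for even X, Y and applying ψ gives a coordinate formula for a connection on
the total space. Its Christoffel symbols are ψ(Γ), the body of Γ, or zero, according to whether
none, one or both of the lower indices are odd; two odd coefficients multiply into J² and are lost
(`psi_act_nabla`, `locConn_reduction`).

Uniqueness: ∂_{xⁱ} and θᵃ∂_{θᵃ} lie in 𝓛₀, and their images under Ψ are ∂_{xⁱ} and yᵃ∂_{yᵃ}. These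
span the tangent spaces wherever no yᵃ vanishes, which is a dense set, so by the Leibniz rule and
continuity the reduction identity determines a smooth connection (`eqOn_of_reduction`). This glues
the local connections and shows that there is only one induced connection. It also proves
compatibility with Φ: the pullback along Φ̂ of the connection induced on F satisfies the reduction
identity of the connection on ΠE, hence is the induced one (`pullCov_eq_inducedConn`).

The map Φ̂ is the transpose of the degree-one part of Φ^*. It is forced by testing contractions on
the odd coordinates, it is smooth because its fibre coordinates are ψ(Φ^* θᵃ), and its inverse comes
from the inverse of Φ. -/

set_option linter.unusedSectionVars false

noncomputable section

namespace SuperGeom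

/-! ### Exterior algebra: components of degree zero and one, parity, contraction -/

section ExteriorFacts

variable {V V' : Type*} [AddCommGroup V] [Module ℝ V] [AddCommGroup V'] [Module ℝ V']

/-- Truncation to degrees at most one is an algebra homomorphism to the trivial square-zero
extension, and `ιInv` is its second component. This is the Leibniz rule in 𝒪/J². -/
lemma ιInv_mul {K : Type*} [AddCommGroup K] [Module ℝ K] (u v : ExteriorAlgebra ℝ K) :
    ExteriorAlgebra.ιInv (u * v) = ExteriorAlgebra.algebraMapInv u • ExteriorAlgebra.ιInv v +
      ExteriorAlgebra.algebraMapInv v • ExteriorAlgebra.ιInv u := by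
  -- The same opposite action enters the definition of `ιInv`, which is why `hl` below holds by
  -- `rfl`.
  let _ : Module ℝᵐᵒᵖ K := Module.compHom _ ((RingHom.id ℝ).fromOpposite mul_comm)
  have : IsCentralScalar ℝ K := ⟨fun r m => rfl⟩
  have hf : (TrivSqZeroExt.fstHom ℝ ℝ K).comp
      ExteriorAlgebra.toTrivSqZeroExt = ExteriorAlgebra.algebraMapInv (R := ℝ) (M := K) := by
    apply ExteriorAlgebra.hom_ext
    ext m
    simp [ExteriorAlgebra.algebraMapInv]
  have hf' : ∀ u : ExteriorAlgebra ℝ K, (ExteriorAlgebra.toTrivSqZeroExt u).fst =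
      ExteriorAlgebra.algebraMapInv u := fun u => DFunLike.congr_fun hf u
  have hl : ∀ u : ExteriorAlgebra ℝ K, ExteriorAlgebra.ιInv u =
      (ExteriorAlgebra.toTrivSqZeroExt u).snd := fun u => rfl
  rw [hl, map_mul, TrivSqZeroExt.snd_mul, hf', hf', ← hl, ← hl]
  rfl

/-- The product rule for `1 * 1` says that `ιInv 1` equals twice itself, hence vanishes; the rest is
linearity. -/
lemma ιInv_algebraMap {K : Type*} [AddCommGroup K] [Module ℝ K] (c : ℝ) :
    ExteriorAlgebra.ιInv (algebraMap ℝ (ExteriorAlgebra ℝ K) c) = 0 := by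
  have h := ιInv_mul (K := K) 1 1
  simp only [mul_one, map_one, one_smul, left_eq_add] at h
  rw [Algebra.algebraMap_eq_smul_one, map_smul, h, smul_zero]

lemma zmod_two_cases (a : ZMod 2) : a = 0 ∨ a = 1 := by revert a; decide

lemma mem_parityPart_iff {a : ZMod 2} {u : LDual V} :
    u ∈ parityPart V a ↔ parityProj a u = u := by
  refine ⟨fun h => ?_, fun h => h ▸ parityProj_mem a u⟩
  rcases zmod_two_cases a with rfl | rfl
  · have h0 := CliffordAlgebra.involute_eq_of_mem_even h
    simp [parityProj, sgn, h0]; module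
  · have h0 := CliffordAlgebra.involute_eq_of_mem_odd h
    simp [parityProj, sgn, h0]; module

lemma involute_of_mem {a : ZMod 2} {u : LDual V} (h : u ∈ parityPart V a) :
    CliffordAlgebra.involute u = sgn a 1 • u := by
  rcases zmod_two_cases a with rfl | rfl
  · have h0 := CliffordAlgebra.involute_eq_of_mem_even h
    simp [sgn, h0]
  · have h0 := CliffordAlgebra.involute_eq_of_mem_odd h
    simp [sgn, h0]

/-- Together with `involute_of_mem` this makes parity an eigenvalue condition for the grade
involution, so that parity claims become equations that can be checked on generators. -/
lemma mem_parityPart_of_involute {a : ZMod 2} {u : LDual V}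
    (h : CliffordAlgebra.involute u = sgn a 1 • u) : u ∈ parityPart V a := by
  rw [mem_parityPart_iff]
  rcases zmod_two_cases a with rfl | rfl <;> simp [parityProj, h, sgn] <;> module

@[simp] lemma body_ι (η : Module.Dual ℝ V) : body (ExteriorAlgebra.ι ℝ η) = 0 := by
  simp [body, ExteriorAlgebra.algebraMapInv]

@[simp] lemma linPart_ι (η : Module.Dual ℝ V) : linPart (ExteriorAlgebra.ι ℝ η) = η :=
  ExteriorAlgebra.ι_leftInverse η

@[simp] lemma linPart_algebraMap (c : ℝ) : linPart (algebraMap ℝ (LDual V) c) = 0 :=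
  ιInv_algebraMap c

@[simp] lemma linPart_one : linPart (1 : LDual V) = 0 := by
  simpa using linPart_algebraMap (V := V) 1

lemma linPart_mul (u v : LDual V) :
    linPart (u * v) = body u • linPart v + body v • linPart u :=
  ιInv_mul u v

lemma body_involute (u : LDual V) : body (CliffordAlgebra.involute u) = body u := by
  have h : (body : LDual V →ₐ[ℝ] ℝ).comp
      (CliffordAlgebra.involute (Q := (0 : QuadraticForm ℝ (Module.Dual ℝ V)))) = body := by
    apply ExteriorAlgebra.hom_ext
    ext m
    have : body (CliffordAlgebra.ι (0 : QuadraticForm ℝ (Module.Dual ℝ V)) m) = 0 := body_ι m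
    simp [ExteriorAlgebra.ι, CliffordAlgebra.involute_ι, this]
  exact DFunLike.congr_fun h u

lemma linPart_involute (u : LDual V) : linPart (CliffordAlgebra.involute u) = - linPart u := by
  induction u using ExteriorAlgebra.induction with
  | algebraMap r => simp
  | ι x =>
    have : linPart (CliffordAlgebra.ι (0 : QuadraticForm ℝ (Module.Dual ℝ V)) x) = x := linPart_ι x
    simp [ExteriorAlgebra.ι, CliffordAlgebra.involute_ι, this]
  | mul a b ha hb =>
    rw [map_mul, linPart_mul, linPart_mul, body_involute, body_involute, ha, hb]
    module
  | add a b ha hb => rw [map_add, map_add, map_add, ha, hb]; abel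

/-- The involution fixes the body and negates odd elements, so the body equals its own negative. The
vanishing of `linPart` on even elements has the mirror-image proof. -/
lemma body_of_odd {u : LDual V} (h : u ∈ parityPart V 1) : body u = 0 := by
  have h1 := body_involute u
  rw [involute_of_mem h] at h1
  simp [sgn] at h1
  linarith

lemma linPart_of_even {u : LDual V} (h : u ∈ parityPart V 0) : linPart u = 0 := by
  have h1 := linPart_involute u
  rw [involute_of_mem h] at h1
  simp [sgn] at h1
  ext v
  have h2 := LinearMap.congr_fun h1 v
  simp only [LinearMap.neg_apply] at h2
  simp only [LinearMap.zero_apply]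
  linarith

lemma algebraMap_mem_parityPart (c : ℝ) : algebraMap ℝ (LDual V) c ∈ parityPart V 0 := by
  apply mem_parityPart_of_involute
  simp [sgn]

lemma ι_mem_parityPart (η : Module.Dual ℝ V) : ExteriorAlgebra.ι ℝ η ∈ parityPart V 1 := by
  apply mem_parityPart_of_involute
  simp [sgn, ExteriorAlgebra.ι, CliffordAlgebra.involute_ι]

lemma body_map (g : Module.Dual ℝ V →ₗ[ℝ] Module.Dual ℝ V') (u : LDual V) :
    body (ExteriorAlgebra.map g u) = body u := by
  have h : (body : LDual V' →ₐ[ℝ] ℝ).comp (ExteriorAlgebra.map g) = body := by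
    apply ExteriorAlgebra.hom_ext
    ext m
    simp
  exact DFunLike.congr_fun h u

lemma linPart_map (g : Module.Dual ℝ V →ₗ[ℝ] Module.Dual ℝ V') (u : LDual V) :
    linPart (ExteriorAlgebra.map g u) = g (linPart u) := by
  induction u using ExteriorAlgebra.induction with
  | algebraMap r => simp
  | ι x => simp
  | mul a b ha hb => simp [map_mul, linPart_mul, body_map, ha, hb]
  | add a b ha hb => rw [map_add, map_add, map_add, map_add, ha, hb]

lemma map_mem_parityPart (g : Module.Dual ℝ V →ₗ[ℝ] Module.Dual ℝ V') {a : ZMod 2} {u : LDual V}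
    (h : u ∈ parityPart V a) : ExteriorAlgebra.map g u ∈ parityPart V' a := by
  rw [mem_parityPart_iff] at h ⊢
  rw [← parityProj_map, h]

/-- Contraction of an element of `Λ V*` with a vector. -/
def contr (v : V) : LDual V →ₗ[ℝ] LDual V :=
  CliffordAlgebra.contractLeft (Q := (0 : QuadraticForm ℝ (Module.Dual ℝ V)))
    (Module.Dual.eval ℝ V v)

@[simp] lemma contr_algebraMap (v : V) (c : ℝ) : contr v (algebraMap ℝ (LDual V) c) = 0 :=
  CliffordAlgebra.contractLeft_algebraMap _ _ _

@[simp] lemma contr_ι (v : V) (η : Module.Dual ℝ V) :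
    contr v (ExteriorAlgebra.ι ℝ η) = algebraMap ℝ _ (η v) :=
  CliffordAlgebra.contractLeft_ι _ _ _

lemma contr_ι_mul (v : V) (η : Module.Dual ℝ V) (u : LDual V) :
    contr v (ExteriorAlgebra.ι ℝ η * u) = η v • u - ExteriorAlgebra.ι ℝ η * contr v u :=
  CliffordAlgebra.contractLeft_ι_mul _ _ _

lemma contr_add_left (v w : V) : contr (v + w) = contr v + contr w := by
  simp [contr]

lemma contr_smul_left (c : ℝ) (v : V) : contr (c • v) = c • contr v := by
  simp [contr]

/-- Contraction is an antiderivation. Writing the sign with the grade involution allows a first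
factor that is not homogeneous. -/
lemma contr_mul (v : V) (u w : LDual V) :
    contr v (u * w) = contr v u * w + CliffordAlgebra.involute u * contr v w := by
  induction u using CliffordAlgebra.left_induction with
  | algebraMap r =>
    have : contr v (algebraMap ℝ (LDual V) r) = 0 := contr_algebraMap v r
    rw [this, zero_mul, zero_add, AlgHom.commutes, ← Algebra.smul_def, map_smul,
      Algebra.smul_def]
  | add x y hx hy => rw [add_mul, map_add, map_add, map_add, hx, hy]; noncomm_ring
  | ι_mul m η h =>
    have e : CliffordAlgebra.ι (0 : QuadraticForm ℝ (Module.Dual ℝ V)) η =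
      ExteriorAlgebra.ι ℝ η := rfl
    have e2 : CliffordAlgebra.involute (ExteriorAlgebra.ι ℝ η) = - ExteriorAlgebra.ι ℝ η :=
      CliffordAlgebra.involute_ι _
    rw [e, mul_assoc, contr_ι_mul, contr_ι_mul, h, map_mul, e2]
    simp only [sub_mul, mul_add, smul_mul_assoc, neg_mul, mul_assoc]
    abel

lemma contr_involute (v : V) (u : LDual V) :
    contr v (CliffordAlgebra.involute u) = - CliffordAlgebra.involute (contr v u) := by
  induction u using ExteriorAlgebra.induction with
  | algebraMap r => simp
  | ι η =>
    have e2 : CliffordAlgebra.involute (ExteriorAlgebra.ι ℝ η) = - ExteriorAlgebra.ι ℝ η :=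
      CliffordAlgebra.involute_ι _
    rw [e2, map_neg, contr_ι, AlgHom.commutes]
  | mul a b ha hb =>
    rw [map_mul, contr_mul, contr_mul, ha, hb, map_add, map_mul, map_mul]
    noncomm_ring
  | add a b ha hb => rw [map_add, map_add, map_add, map_add, ha, hb]; abel

lemma contr_mem {v : V} {a : ZMod 2} {u : LDual V} (h : u ∈ parityPart V a) :
    contr v u ∈ parityPart V (1 + a) := by
  apply mem_parityPart_of_involute
  have := contr_involute v u
  rw [involute_of_mem h, map_smul] at this
  rw [← neg_eq_iff_eq_neg] at this
  rw [← this]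
  rcases zmod_two_cases a with rfl | rfl <;> simp [sgn]

/-- The degree-zero part of a contraction sees only the degree-one part. This links the odd
coordinate derivations to derivatives of ψ(f) along the fibres. -/
lemma body_contr (v : V) (u : LDual V) : body (contr v u) = linPart u v := by
  induction u using ExteriorAlgebra.induction with
  | algebraMap r => simp
  | ι η => simp
  | mul a b ha hb =>
    rw [contr_mul, map_add, map_mul, map_mul, body_involute, ha, hb, linPart_mul]
    simp [mul_comm, add_comm]
  | add a b ha hb => simp [ha, hb]

lemma map_contr (g : Module.Dual ℝ V →ₗ[ℝ] Module.Dual ℝ V') (v : V) (v' : V')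
    (h : ∀ η, g η v' = η v) (u : LDual V) :
    ExteriorAlgebra.map g (contr v u) = contr v' (ExteriorAlgebra.map g u) := by
  induction u using CliffordAlgebra.left_induction with
  | algebraMap r =>
    have e : ∀ r, algebraMap ℝ (CliffordAlgebra (0 : QuadraticForm ℝ (Module.Dual ℝ V))) r =
      algebraMap ℝ (LDual V) r := fun _ => rfl
    rw [e, contr_algebraMap, map_zero, AlgHom.commutes, contr_algebraMap]
  | add x y hx hy => rw [map_add, map_add, map_add, map_add, hx, hy]
  | ι_mul m η hm =>
    have e : CliffordAlgebra.ι (0 : QuadraticForm ℝ (Module.Dual ℝ V)) η =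
      ExteriorAlgebra.ι ℝ η := rfl
    rw [e, contr_ι_mul, map_mul, ExteriorAlgebra.map_apply_ι, contr_ι_mul, map_sub, map_mul,
      hm, map_smul, ExteriorAlgebra.map_apply_ι, h]

end ExteriorFacts

/-! ### Smooth maps with values in the exterior algebra -/

section LSmooth

variable (A : Type*) [NormedAddCommGroup A] [NormedSpace ℝ A]
  {V : Type*} [NormedAddCommGroup V] [NormedSpace ℝ V]
  {V₂ : Type*} [NormedAddCommGroup V₂] [NormedSpace ℝ V₂]
  {M : Type*} [TopologicalSpace M] [ChartedSpace A M]

/-- Smoothness of a `Λ V*`-valued map: all its coefficients are smooth. -/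
def LSmoothOn (w : M → LDual V) (S : Set M) : Prop :=
  ∀ l : Module.Dual ℝ (LDual V), ContMDiffOn 𝓘(ℝ, A) 𝓘(ℝ, ℝ) ∞ (fun x => l (w x)) S

variable {A}

lemma LSmoothOn.mono {w : M → LDual V} {S T : Set M} (h : LSmoothOn A w S) (hT : T ⊆ S) :
    LSmoothOn A w T := fun l => (h l).mono hT

lemma LSmoothOn.congr {w w' : M → LDual V} {S : Set M} (h : LSmoothOn A w S)
    (h' : ∀ x ∈ S, w' x = w x) : LSmoothOn A w' S :=
  fun l => (h l).congr fun x hx => by rw [h' x hx]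

lemma LSmoothOn.const (u : LDual V) (S : Set M) : LSmoothOn A (fun _ => u) S :=
  fun _ => contMDiffOn_const

lemma LSmoothOn.add {w w' : M → LDual V} {S : Set M} (h : LSmoothOn A w S)
    (h' : LSmoothOn A w' S) : LSmoothOn A (fun x => w x + w' x) S :=
  fun l => ((h l).add (h' l)).congr fun x _ => by simp

lemma LSmoothOn.smul {g : M → ℝ} {w : M → LDual V} {S : Set M}
    (hg : ContMDiffOn 𝓘(ℝ, A) 𝓘(ℝ, ℝ) ∞ g S) (h : LSmoothOn A w S) :
    LSmoothOn A (fun x => g x • w x) S :=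
  fun l => (hg.mul (h l)).congr fun x _ => by simp

lemma LSmoothOn.linear {w : M → LDual V} {S : Set M} (h : LSmoothOn A w S)
    (T : LDual V →ₗ[ℝ] LDual V₂) : LSmoothOn A (fun x => T (w x)) S :=
  fun l => h (l ∘ₗ T)

lemma LSmoothOn.sum {ι : Type*} (s : Finset ι) {w : ι → M → LDual V} {S : Set M}
    (h : ∀ i ∈ s, LSmoothOn A (w i) S) : LSmoothOn A (fun x => ∑ i ∈ s, w i x) S := by
  intro l
  simp only [map_sum]
  exact contMDiffOn_finsetSum fun i hi => h i hi l

variable [FiniteDimensional ℝ V] [FiniteDimensional ℝ V₂]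

variable (V) in
/-- A basis of `Λ V*`. -/
def lbasis : Module.Basis (Finset (Fin (Module.finrank ℝ (Module.Dual ℝ V)))) ℝ (LDual V) :=
  (Module.finBasis ℝ (Module.Dual ℝ V)).ExteriorAlgebra

/-- A family of linear maps which is smooth pointwise maps smooth maps to smooth maps. -/
lemma LSmoothOn.apply {w : M → LDual V} {S : Set M} (h : LSmoothOn A w S)
    {T : M → LDual V →ₗ[ℝ] LDual V₂} (hT : ∀ u, LSmoothOn A (fun x => T x u) S) :
    LSmoothOn A (fun x => T x (w x)) S := by
  refine (LSmoothOn.sum Finset.univ (w := fun I x => (lbasis V).coord I (w x) • T x (lbasis V I))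
    fun I _ => LSmoothOn.smul (h _) (hT _)).congr fun x _ => ?_
  conv_lhs => rw [← (lbasis V).sum_repr (w x), map_sum]
  simp only [map_smul]
  rfl

lemma LSmoothOn.mul {w w' : M → LDual V} {S : Set M} (h : LSmoothOn A w S)
    (h' : LSmoothOn A w' S) : LSmoothOn A (fun x => w x * w' x) S :=
  h'.apply (T := fun x => LinearMap.mulLeft ℝ (w x))
    fun u => h.linear (LinearMap.mulRight ℝ u)

omit [FiniteDimensional ℝ V] in
-- Both sides of the claim are compatible with sums and products in `u`, so only covectors matter.
-- There the coefficients are matrix entries of `T x`.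
lemma LSmoothOn.map_dual {T : M → V →L[ℝ] V₂} {S : Set M}
    (hT : ContMDiffOn 𝓘(ℝ, A) 𝓘(ℝ, V →L[ℝ] V₂) ∞ T S)
    (hV : FiniteDimensional ℝ V) (u : LDual V₂) :
    LSmoothOn A (fun x => ExteriorAlgebra.map ((T x : V →ₗ[ℝ] V₂).dualMap) u) S := by
  induction u using ExteriorAlgebra.induction with
  | algebraMap r => simpa using! LSmoothOn.const _ _
  | ι η =>
    let b := Module.finBasis ℝ V
    refine (LSmoothOn.sum Finset.univ
      (w := fun i x => η (T x (b i)) • ExteriorAlgebra.ι ℝ (b.coord i))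
      fun i _ => LSmoothOn.smul ?_ (LSmoothOn.const _ _)).congr fun x _ => ?_
    · have : ContMDiff 𝓘(ℝ, V →L[ℝ] V₂) 𝓘(ℝ, ℝ) ∞
          (fun T : V →L[ℝ] V₂ => η (T (b i))) :=
        (((LinearMap.toContinuousLinearMap η).comp
          (ContinuousLinearMap.apply ℝ V₂ (b i))).contDiff).contMDiff
      exact this.comp_contMDiffOn hT
    · rw [ExteriorAlgebra.map_apply_ι]
      simp only [← map_smul, ← map_sum]
      congr 1
      refine b.ext fun j => ?_
      simp [Finsupp.single_apply]
  | mul a b ha hb => simpa only [map_mul] using ha.mul hb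
  | add a b ha hb => simpa only [map_add] using ha.add hb

lemma LSmoothOn.contr {t : M → V} {w : M → LDual V} {S : Set M}
    (ht : ContMDiffOn 𝓘(ℝ, A) 𝓘(ℝ, V) ∞ t S) (h : LSmoothOn A w S) :
    LSmoothOn A (fun x => contr (t x) (w x)) S := by
  refine h.apply fun u => ?_
  let b := Module.finBasis ℝ V
  refine (LSmoothOn.sum Finset.univ
    (w := fun i x => b.coord i (t x) • SuperGeom.contr (b i) u)
    fun i _ => LSmoothOn.smul ?_ (LSmoothOn.const _ _)).congr fun x _ => ?_
  · exact (LinearMap.toContinuousLinearMap (b.coord i)).contDiff.contMDiff.comp_contMDiffOn ht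
  · conv_lhs => rw [← b.sum_repr (t x)]
    let Cl : V →ₗ[ℝ] LDual V →ₗ[ℝ] LDual V :=
      { toFun := SuperGeom.contr, map_add' := contr_add_left, map_smul' := contr_smul_left }
    change Cl (∑ i, b.repr (t x) i • b i) u = _
    rw [map_sum, LinearMap.sum_apply]
    simp only [map_smul, LinearMap.smul_apply]
    rfl

end LSmooth

/-! ### Superfunctions in local trivializations -/

section Local

variable {A : Type*} [NormedAddCommGroup A] [NormedSpace ℝ A]
  {V : Type*} [NormedAddCommGroup V] [NormedSpace ℝ V] [FiniteDimensional ℝ V]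
  {M : Type*} [TopologicalSpace M] [ChartedSpace A M]
  {E : M → Type*} [∀ x, AddCommGroup (E x)] [∀ x, Module ℝ (E x)]
  [∀ x, TopologicalSpace (E x)] [TopologicalSpace (TotalSpace V E)]
  [FiberBundle V E] [VectorBundle ℝ V E]

open Classical in
/-- The value of a superfunction at an arbitrary point, zero outside of its domain. -/
def SuperFun.ext0 {U : Opens M} (f : SuperFun A V E U) (x : M) : LDual (E x) :=
  if h : x ∈ U then f.val ⟨x, h⟩ else 0

lemma SuperFun.ext0_of_mem {U : Opens M} (f : SuperFun A V E U) {x : M} (h : x ∈ U) :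
    f.ext0 x = f.val ⟨x, h⟩ := dif_pos h

lemma SuperFun.ext_ext0 {U : Opens M} {f g : SuperFun A V E U}
    (h : ∀ x ∈ U, f.ext0 x = g.ext0 x) : f = g := by
  apply SuperFun.ext
  rintro ⟨x, hx⟩
  rw [← f.ext0_of_mem hx, h x hx, g.ext0_of_mem hx]

@[simp] lemma ext0_res {U U' : Opens M} (h : U' ≤ U) (f : SuperFun A V E U) {x : M}
    (hx : x ∈ U') : (res h f).ext0 x = f.ext0 x := by
  rw [SuperFun.ext0_of_mem _ hx, SuperFun.ext0_of_mem _ (h hx)]; rfl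

lemma ext0_mul {U : Opens M} (f g : SuperFun A V E U) (x : M) :
    (f * g).ext0 x = f.ext0 x * g.ext0 x := by
  by_cases hx : x ∈ U
  · simp only [SuperFun.ext0_of_mem _ hx]; rfl
  · simp [SuperFun.ext0, hx]

lemma ext0_add {U : Opens M} (f g : SuperFun A V E U) (x : M) :
    (f + g).ext0 x = f.ext0 x + g.ext0 x := by
  by_cases hx : x ∈ U
  · simp only [SuperFun.ext0_of_mem _ hx]; rfl
  · simp [SuperFun.ext0, hx]

lemma ext0_smul {U : Opens M} (c : ℝ) (f : SuperFun A V E U) (x : M) :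
    (c • f).ext0 x = c • f.ext0 x := by
  by_cases hx : x ∈ U
  · simp only [SuperFun.ext0_of_mem _ hx]; rfl
  · simp [SuperFun.ext0, hx]

/-- Evaluation of superfunctions at a point, as a linear map. -/
def ev (U : Opens M) (x : M) : SuperFun A V E U →ₗ[ℝ] LDual (E x) where
  toFun f := f.ext0 x
  map_add' f g := ext0_add f g x
  map_smul' c f := ext0_smul c f x

lemma ext0_sum {U : Opens M} {ι : Type*} (s : Finset ι) (f : ι → SuperFun A V E U) (x : M) :
    (∑ i ∈ s, f i).ext0 x = ∑ i ∈ s, (f i).ext0 x := map_sum (ev U x) f s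

lemma hasParity_iff {U : Opens M} {a : ZMod 2} {f : SuperFun A V E U} :
    HasParity a f ↔ ∀ x ∈ U, f.ext0 x ∈ parityPart (E x) a :=
  ⟨fun h x hx => by rw [f.ext0_of_mem hx]; exact h ⟨x, hx⟩,
    fun h x => by rw [← f.ext0_of_mem x.2]; exact h x x.2⟩

/-- The expression of a superfunction in a local trivialization. -/
def loc (e : Trivialization V (π V E)) [e.IsLinear ℝ] {U : Opens M} (f : SuperFun A V E U)
    (x : M) : LDual V := localRep e x (f.ext0 x)

lemma loc_smooth (e : Trivialization V (π V E)) [MemTrivializationAtlas e] {U : Opens M}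
    (f : SuperFun A V E U) : LSmoothOn A (loc e f) (U ∩ e.baseSet) := by
  intro l
  obtain ⟨g, hg, h⟩ := f.smooth e l
  refine hg.congr fun x hx => ?_
  rw [loc, f.ext0_of_mem hx.1, h ⟨x, hx.1⟩ hx.2]

/-- The inverse of `localRep` over the base set of the trivialization. -/
def localInv (e : Trivialization V (π V E)) [e.IsLinear ℝ] (x : M) :
    LDual V →ₐ[ℝ] LDual (E x) :=
  ExteriorAlgebra.map (((e.continuousLinearMapAt ℝ x : E x →L[ℝ] V) : E x →ₗ[ℝ] V).dualMap)

lemma localRep_localInv (e : Trivialization V (π V E)) [e.IsLinear ℝ] {x : M}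
    (hx : x ∈ e.baseSet) (u : LDual V) : localRep e x (localInv e x u) = u := by
  rw [localRep, localInv, ← AlgHom.comp_apply, ExteriorAlgebra.map_comp_map]
  refine (congrArg (fun g => ExteriorAlgebra.map g u) (?_ : _ = LinearMap.id)).trans ?_
  · ext η v
    change η (e.continuousLinearMapAt ℝ x (e.symmL ℝ x v)) = η v
    rw [e.continuousLinearMapAt_symmL hx]
  · rw [ExteriorAlgebra.map_id]; rfl

lemma localInv_localRep (e : Trivialization V (π V E)) [e.IsLinear ℝ] {x : M}
    (hx : x ∈ e.baseSet) (u : LDual (E x)) : localInv e x (localRep e x u) = u := by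
  rw [localRep, localInv, ← AlgHom.comp_apply, ExteriorAlgebra.map_comp_map]
  refine (congrArg (fun g => ExteriorAlgebra.map g u) (?_ : _ = LinearMap.id)).trans ?_
  · ext η v
    change η (e.symmL ℝ x (e.continuousLinearMapAt ℝ x v)) = η v
    rw [e.symmL_continuousLinearMapAt hx]
  · rw [ExteriorAlgebra.map_id]; rfl

lemma localRep_injective (e : Trivialization V (π V E)) [e.IsLinear ℝ] {x : M}
    (hx : x ∈ e.baseSet) : Function.Injective (localRep e x) :=
  Function.LeftInverse.injective (localInv_localRep e hx)

lemma ext_loc (e : Trivialization V (π V E)) [e.IsLinear ℝ] {U : Opens M}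
    (hU : (U : Set M) ⊆ e.baseSet) {f g : SuperFun A V E U}
    (h : ∀ x ∈ U, loc e f x = loc e g x) : f = g :=
  SuperFun.ext_ext0 fun x hx => localRep_injective e (hU hx) (h x hx)

lemma loc_mul (e : Trivialization V (π V E)) [e.IsLinear ℝ] {U : Opens M}
    (f g : SuperFun A V E U) (x : M) : loc e (f * g) x = loc e f x * loc e g x := by
  simp [loc, ext0_mul]

lemma loc_add (e : Trivialization V (π V E)) [e.IsLinear ℝ] {U : Opens M}
    (f g : SuperFun A V E U) (x : M) : loc e (f + g) x = loc e f x + loc e g x := by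
  simp [loc, ext0_add]

lemma loc_smul (e : Trivialization V (π V E)) [e.IsLinear ℝ] {U : Opens M}
    (c : ℝ) (f : SuperFun A V E U) (x : M) : loc e (c • f) x = c • loc e f x := by
  simp [loc, ext0_smul]

lemma loc_res (e : Trivialization V (π V E)) [e.IsLinear ℝ] {U U' : Opens M} (h : U' ≤ U)
    (f : SuperFun A V E U) {x : M} (hx : x ∈ U') : loc e (res h f) x = loc e f x := by
  simp [loc, hx]

lemma loc_sum (e : Trivialization V (π V E)) [e.IsLinear ℝ] {U : Opens M} {ι : Type*}
    (s : Finset ι) (f : ι → SuperFun A V E U) (x : M) :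
    loc e (∑ i ∈ s, f i) x = ∑ i ∈ s, loc e (f i) x := by
  simp [loc, ext0_sum]

lemma body_loc (e : Trivialization V (π V E)) [e.IsLinear ℝ] {U : Opens M}
    (f : SuperFun A V E U) (x : M) : body (loc e f x) = body (f.ext0 x) := body_map _ _

lemma linPart_loc (e : Trivialization V (π V E)) [e.IsLinear ℝ] {U : Opens M}
    (f : SuperFun A V E U) {x : M} (hx : x ∈ e.baseSet) (y : E x) :
    linPart (loc e f x) (e.continuousLinearMapAt ℝ x y) = linPart (f.ext0 x) y := by
  rw [loc, localRep, linPart_map]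
  change linPart (f.ext0 x) (e.symmL ℝ x (e.continuousLinearMapAt ℝ x y)) = _
  rw [e.symmL_continuousLinearMapAt hx]

lemma loc_mem_parityPart (e : Trivialization V (π V E)) [e.IsLinear ℝ] {U : Opens M} {a : ZMod 2}
    {f : SuperFun A V E U} (hf : HasParity a f) {x : M} (hx : x ∈ U) :
    loc e f x ∈ parityPart V a := map_mem_parityPart _ (hasParity_iff.1 hf x hx)

lemma hasParity_of_loc (e : Trivialization V (π V E)) [e.IsLinear ℝ] {U : Opens M}
    (hU : (U : Set M) ⊆ e.baseSet) {a : ZMod 2} {f : SuperFun A V E U}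
    (h : ∀ x ∈ U, loc e f x ∈ parityPart V a) : HasParity a f := by
  rw [hasParity_iff]
  intro x hx
  rw [← localInv_localRep e (hU hx) (f.ext0 x)]
  exact map_mem_parityPart _ (h x hx)

/-- Construction of a superfunction from values at points. -/
def mkSuper (U : Opens M) (w : ∀ x, LDual (E x))
    (h : ∀ (e : Trivialization V (π V E)) [MemTrivializationAtlas e],
      LSmoothOn A (fun x => localRep e x (w x)) (U ∩ e.baseSet)) : SuperFun A V E U :=
  ⟨fun x => w x, fun e _ l => ⟨_, h e l, fun _ _ => rfl⟩⟩

lemma ext0_mkSuper {U : Opens M} {w : ∀ x, LDual (E x)} {h} {x : M} (hx : x ∈ U) :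
    (mkSuper (A := A) (V := V) U w h).ext0 x = w x := SuperFun.ext0_of_mem _ hx

/-- A smooth function, as a superfunction. -/
def fn (U : Opens M) (g : M → ℝ) (hg : ContMDiffOn 𝓘(ℝ, A) 𝓘(ℝ, ℝ) ∞ g U) :
    SuperFun A V E U :=
  mkSuper U (fun x => algebraMap ℝ _ (g x)) fun e _ => by
    refine (LSmoothOn.smul (hg.mono inter_subset_left) (LSmoothOn.const (1 : LDual V) _)).congr
      fun x _ => ?_
    rw [AlgHom.commutes, Algebra.algebraMap_eq_smul_one]

lemma ext0_fn {U : Opens M} {g : M → ℝ} {hg : ContMDiffOn 𝓘(ℝ, A) 𝓘(ℝ, ℝ) ∞ g U} {x : M}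
    (hx : x ∈ U) : (fn (V := V) (E := E) U g hg).ext0 x = algebraMap ℝ _ (g x) :=
  ext0_mkSuper hx

lemma loc_fn (e : Trivialization V (π V E)) [e.IsLinear ℝ] {U : Opens M} {g : M → ℝ}
    {hg : ContMDiffOn 𝓘(ℝ, A) 𝓘(ℝ, ℝ) ∞ g U} {x : M}
    (hx : x ∈ U) : loc e (fn (V := V) (E := E) U g hg) x = algebraMap ℝ _ (g x) := by
  rw [loc, ext0_fn hx, AlgHom.commutes]

lemma fn_hasParity {U : Opens M} {g : M → ℝ} (hg : ContMDiffOn 𝓘(ℝ, A) 𝓘(ℝ, ℝ) ∞ g U) :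
    HasParity 0 (fn (V := V) (E := E) U g hg) :=
  hasParity_iff.2 fun x hx => by rw [ext0_fn hx]; exact algebraMap_mem_parityPart _

/-- The body does not depend on the trivialization, so near each point it is a coefficient in
whatever trivialization is available there. -/
lemma body_smooth {U : Opens M} (f : SuperFun A V E U) :
    ContMDiffOn 𝓘(ℝ, A) 𝓘(ℝ, ℝ) ∞ (fun x => body (f.ext0 x)) U := by
  intro x hx
  have h := loc_smooth (trivializationAt V E x) f body.toLinearMap
  have hx' := FiberBundle.mem_baseSet_trivializationAt' (F := V) (E := E) x
  refine ((h x ⟨hx, hx'⟩).congr (fun y _ => ?_) ?_).mono_of_mem_nhdsWithin ?_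
  · exact (body_loc _ f y).symm
  · exact (body_loc _ f x).symm
  · exact Filter.inter_mem self_mem_nhdsWithin (mem_nhdsWithin_of_mem_nhds
      ((trivializationAt V E x).open_baseSet.mem_nhds hx'))

lemma coord_smooth (e : Trivialization V (π V E)) [MemTrivializationAtlas e] {U : Opens M}
    (hU : (U : Set M) ⊆ e.baseSet) (f : SuperFun A V E U) (l : Module.Dual ℝ (LDual V)) :
    ContMDiffOn 𝓘(ℝ, A) 𝓘(ℝ, ℝ) ∞ (fun x => l (loc e f x)) U :=
  (loc_smooth e f l).mono (subset_inter subset_rfl hU)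

variable [ContMDiffVectorBundle ∞ V E 𝓘(ℝ, A)]

/-- Makes one trivialization sufficient for constructing a superfunction: the others differ by the
exterior algebra map of the dual of a smooth transition map. -/
lemma LSmoothOn.change {e e' : Trivialization V (π V E)} [MemTrivializationAtlas e]
    [MemTrivializationAtlas e'] {w : M → LDual V} {S : Set M} (h : LSmoothOn A w S)
    (hS : S ⊆ e.baseSet) :
    LSmoothOn A (fun x => localRep e' x (localInv e x (w x))) (S ∩ e'.baseSet) := by
  -- Dualization reverses direction: passing from `e` to `e'` on Λ V* uses the coordinate change
  -- from `e'` to `e` on V.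
  have hT := (contMDiffOn_coordChangeL (IB := 𝓘(ℝ, A)) (n := ∞) e' e).mono
    (show S ∩ e'.baseSet ⊆ e'.baseSet ∩ e.baseSet from fun x hx => ⟨hx.2, hS hx.1⟩)
  refine ((h.mono inter_subset_left).apply (T := fun x => (ExteriorAlgebra.map
    (((e'.coordChangeL ℝ e x : V →L[ℝ] V) : V →ₗ[ℝ] V).dualMap)).toLinearMap)
      fun u => LSmoothOn.map_dual hT inferInstance u).congr fun x hx => ?_
  rw [localRep, localInv, ← AlgHom.comp_apply, ExteriorAlgebra.map_comp_map]
  change _ = ExteriorAlgebra.map _ (w x)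
  congr 2
  ext η v
  have hx2 : x ∈ e.baseSet := hS hx.1
  simp [e'.coordChangeL_apply e ⟨hx.2, hx2⟩, e'.symmL_apply hx.2,
    e.continuousLinearMapAt_apply_of_mem (R := ℝ) hx2]

/-- Construction of a superfunction from its expression in a local trivialization. -/
def mkIn (e : Trivialization V (π V E)) [MemTrivializationAtlas e] (U : Opens M)
    (hU : (U : Set M) ⊆ e.baseSet) (w : M → LDual V) (hw : LSmoothOn A w U) :
    SuperFun A V E U :=
  mkSuper U (fun x => localInv e x (w x)) fun _ _ => hw.change hU

lemma loc_mkIn (e : Trivialization V (π V E)) [MemTrivializationAtlas e] {U : Opens M}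
    (hU : (U : Set M) ⊆ e.baseSet) {w : M → LDual V} (hw : LSmoothOn A w U) {x : M}
    (hx : x ∈ U) : loc e (mkIn e U hU w hw) x = w x := by
  rw [loc, mkIn, ext0_mkSuper hx, localRep_localInv e (hU hx)]

/-- The superfunction with constant expression in a local trivialization. -/
def cst (e : Trivialization V (π V E)) [MemTrivializationAtlas e] (U : Opens M)
    (hU : (U : Set M) ⊆ e.baseSet) (u : LDual V) : SuperFun A V E U :=
  mkIn e U hU (fun _ => u) (LSmoothOn.const u _)

lemma loc_cst (e : Trivialization V (π V E)) [MemTrivializationAtlas e] {U : Opens M}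
    (hU : (U : Set M) ⊆ e.baseSet) {u : LDual V} {x : M}
    (hx : x ∈ U) : loc e (cst (A := A) e U hU u) x = u := loc_mkIn e hU _ hx

/-- Splits superfunctions into two kinds of generators, functions on the base and forms with
constant coefficients. Derivations and pullbacks are later examined on each kind separately. -/
lemma eq_sum_fn_mul_cst (e : Trivialization V (π V E)) [MemTrivializationAtlas e] {U : Opens M}
    (hU : (U : Set M) ⊆ e.baseSet) (f : SuperFun A V E U) :
    f = ∑ I, fn U _ (coord_smooth e hU f ((lbasis V).coord I)) * cst e U hU (lbasis V I) := by
  refine ext_loc e hU fun x hx => ?_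
  rw [loc_sum]
  simp only [loc_mul, loc_fn e hx, loc_cst e hU hx, ← Algebra.smul_def]
  exact ((lbasis V).sum_repr (loc e f x)).symm

end Local

/-! ### Hadamard's lemma -/

section Hadamard

variable {A : Type*} [NormedAddCommGroup A] [NormedSpace ℝ A] [FiniteDimensional ℝ A]

open MeasureTheory in
-- Differentiation under the integral sign; the dominating constant comes from compactness of the
-- closed unit ball around `y` times [0, 1], available in finite dimension.
lemma hasFDerivAt_intervalIntegral_of_contDiff {φ : A × ℝ → ℝ} (hφ : ContDiff ℝ ∞ φ) (y : A) :
    HasFDerivAt (fun y => ∫ t in (0 : ℝ)..1, φ (y, t))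
      (∫ t in (0 : ℝ)..1, (fderiv ℝ φ (y, t)).comp (ContinuousLinearMap.inl ℝ A ℝ)) y := by
  have hd : Continuous (fun p : A × ℝ => (fderiv ℝ φ p).comp (ContinuousLinearMap.inl ℝ A ℝ)) :=
    (hφ.continuous_fderiv (by simp)).clm_comp continuous_const
  obtain ⟨C, hC⟩ := ((isCompact_closedBall y 1).prod (isCompact_Icc (a := (0 : ℝ))
    (b := 1))).exists_bound_of_continuousOn hd.continuousOn
  refine intervalIntegral.hasFDerivAt_integral_of_dominated_of_fderiv_le
    (F := fun y t => φ (y, t))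
    (F' := fun y t => (fderiv ℝ φ (y, t)).comp (ContinuousLinearMap.inl ℝ A ℝ))
    (bound := fun _ => C)
    (Metric.closedBall_mem_nhds y one_pos) (Filter.Eventually.of_forall fun z => ?_)
    ?_ ?_ ?_ ?_ ?_
  · exact (hφ.continuous.comp (by fun_prop : Continuous fun t : ℝ => (z, t))).aestronglyMeasurable
  · exact (hφ.continuous.comp (by fun_prop : Continuous fun t : ℝ => (y, t))).intervalIntegrable _ _
  · exact (hd.comp (by fun_prop : Continuous fun t : ℝ => (y, t))).aestronglyMeasurable
  · refine Filter.Eventually.of_forall fun t ht z hz => hC (z, t) ⟨hz, ?_⟩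
    rw [uIoc_of_le zero_le_one] at ht
    exact ⟨ht.1.le, ht.2⟩
  · exact intervalIntegrable_const
  · refine Filter.Eventually.of_forall fun t _ z _ => ?_
    have h1 : HasFDerivAt φ (fderiv ℝ φ (z, t)) (z, t) :=
      ((hφ.differentiable (by simp)) (z, t)).hasFDerivAt
    exact h1.comp z (hasFDerivAt_prodMk_left z t)

/-- A directional derivative of the integral is again an integral of the same form, with a new
smooth integrand, so the order of differentiability can be raised by induction. -/
lemma contDiff_intervalIntegral {φ : A × ℝ → ℝ} (hφ : ContDiff ℝ ∞ φ) :
    ContDiff ℝ ∞ (fun y => ∫ t in (0 : ℝ)..1, φ (y, t)) := by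
  rw [contDiff_infty]
  intro n
  induction n generalizing φ with
  | zero =>
    rw [Nat.cast_zero, contDiff_zero]
    exact continuous_iff_continuousAt.2 fun y =>
      (hasFDerivAt_intervalIntegral_of_contDiff hφ y).continuousAt
  | succ n ih =>
    rw [Nat.cast_succ, contDiff_succ_iff_fderiv_apply]
    refine ⟨fun y => (hasFDerivAt_intervalIntegral_of_contDiff hφ y).differentiableAt,
      fun h => by simp at h, fun v => ?_⟩
    have hd : ContDiff ℝ ∞ (fderiv ℝ φ) := hφ.fderiv_right (by simp)
    have : (fun y => fderiv ℝ (fun y => ∫ t in (0 : ℝ)..1, φ (y, t)) y v) =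
        fun y => ∫ t in (0 : ℝ)..1, fderiv ℝ φ (y, t) (v, 0) := by
      funext y
      rw [(hasFDerivAt_intervalIntegral_of_contDiff hφ y).fderiv,
        ContinuousLinearMap.intervalIntegral_apply]
      · rfl
      · exact Continuous.intervalIntegrable (by
          have := hd.continuous
          fun_prop) _ _
    rw [this]
    exact ih (φ := fun p => fderiv ℝ φ p (v, 0)) (hd.clm_apply contDiff_const)

/-- Hadamard's lemma. -/
lemma exists_eq_add_sum_coord_mul {ι : Type*} [Fintype ι] (b : Module.Basis ι ℝ A) {f : A → ℝ}
    (hf : ContDiff ℝ ∞ f) (a : A) :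
    ∃ q : ι → A → ℝ, (∀ i, ContDiff ℝ ∞ (q i)) ∧
      ∀ y, f y = f a + ∑ i, (b.coord i y - b.coord i a) * q i y := by
  have hd : ContDiff ℝ ∞ (fderiv ℝ f) := hf.fderiv_right (by simp)
  have hq : ∀ i, ContDiff ℝ ∞
      (fun p : A × ℝ => fderiv ℝ f (a + p.2 • (p.1 - a)) (b i)) := fun i =>
    (hd.comp (by fun_prop)).clm_apply contDiff_const
  -- The quotients are averages of the partial derivatives along the segment from `a` to `y`; the
  -- formula is the fundamental theorem of calculus on that segment.
  refine ⟨fun i y => ∫ t in (0 : ℝ)..1, fderiv ℝ f (a + t • (y - a)) (b i),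
    fun i => contDiff_intervalIntegral (hq i), fun y => ?_⟩
  have hc : ∀ i, Continuous (fun t : ℝ => fderiv ℝ f (a + t • (y - a)) (b i)) := fun i =>
    (hq i).continuous.comp (by fun_prop : Continuous fun t : ℝ => (y, t))
  have hcv : Continuous (fun t : ℝ => fderiv ℝ f (a + t • (y - a)) (y - a)) := by
    have := hd.continuous
    fun_prop
  have hder : ∀ t : ℝ, HasDerivAt (fun t : ℝ => f (a + t • (y - a)))
      (fderiv ℝ f (a + t • (y - a)) (y - a)) t := fun t => by
    have h1 : HasFDerivAt f (fderiv ℝ f (a + t • (y - a))) (a + t • (y - a)) :=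
      ((hf.differentiable (by simp)) _).hasFDerivAt
    have h2 : HasDerivAt (fun t : ℝ => a + t • (y - a)) (y - a) t := by
      simpa using ((hasDerivAt_id t).smul_const (y - a)).const_add a
    exact h1.comp_hasDerivAt t h2
  have hint := intervalIntegral.integral_eq_sub_of_hasDerivAt (a := 0) (b := 1)
    (fun t _ => hder t) (hcv.intervalIntegrable _ _)
  simp only [one_smul, zero_smul, add_zero, add_sub_cancel] at hint
  rw [← sub_eq_iff_eq_add', ← hint]
  have hv : y - a = ∑ i, (b.coord i y - b.coord i a) • b i := by
    rw [← b.sum_repr (y - a)]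
    simp
  have h3 : (fun t : ℝ => fderiv ℝ f (a + t • (y - a)) (y - a)) = fun t =>
      ∑ i, (b.coord i y - b.coord i a) * fderiv ℝ f (a + t • (y - a)) (b i) := by
    funext t
    conv_lhs => enter [2]; rw [hv]
    rw [map_sum]
    simp only [map_smul, smul_eq_mul]
  rw [h3, intervalIntegral.integral_finsetSum
    (fun i _ => ((hc i).const_mul _ |>.intervalIntegrable _ _))]
  simp only [intervalIntegral.integral_const_mul]

end Hadamard

/-! ### Partial derivatives in a chart -/

section PartialDerivatives

variable {A : Type*} [NormedAddCommGroup A] [NormedSpace ℝ A]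
  {M : Type*} [TopologicalSpace M] [ChartedSpace A M]

/-- The partial derivative in the direction `v` in the chart at `x₀`. -/
def pd (x₀ : M) (v : A) (g : M → ℝ) (x : M) : ℝ :=
  fderiv ℝ (g ∘ (chartAt A x₀).symm) (chartAt A x₀ x) v

variable {x₀ : M} {v : A} {g g' : M → ℝ} {W : Set M}

lemma pd_congr (hW : IsOpen W) (hWs : W ⊆ (chartAt A x₀).source) (h : EqOn g g' W) {x : M}
    (hx : x ∈ W) : pd x₀ v g x = pd x₀ v g' x := by
  have hO : IsOpen ((chartAt A x₀).target ∩ (chartAt A x₀).symm ⁻¹' W) :=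
    (chartAt A x₀).isOpen_inter_preimage_symm hW
  have : g ∘ (chartAt A x₀).symm =ᶠ[𝓝 (chartAt A x₀ x)] g' ∘ (chartAt A x₀).symm := by
    filter_upwards [hO.mem_nhds ⟨(chartAt A x₀).map_source (hWs hx), by
      simpa [(chartAt A x₀).left_inv (hWs hx)] using hx⟩] with y hy using h hy.2
  rw [pd, pd, this.fderiv_eq]

@[simp] lemma pd_const (c : ℝ) (x : M) : pd x₀ v (fun _ => c) x = 0 := by
  simp [pd, Function.comp_def]

variable [IsManifold 𝓘(ℝ, A) ∞ M]

lemma contDiffOn_comp_chart_symm (hg : ContMDiffOn 𝓘(ℝ, A) 𝓘(ℝ, ℝ) ∞ g W) :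
    ContDiffOn ℝ ∞ (g ∘ (chartAt A x₀).symm)
      ((chartAt A x₀).target ∩ (chartAt A x₀).symm ⁻¹' W) := by
  rw [← contMDiffOn_iff_contDiffOn]
  exact hg.comp' (contMDiffOn_chart_symm (I := 𝓘(ℝ, A)))

lemma differentiableAt_comp_chart_symm (hg : ContMDiffOn 𝓘(ℝ, A) 𝓘(ℝ, ℝ) ∞ g W)
    (hW : IsOpen W) (hWs : W ⊆ (chartAt A x₀).source) {x : M} (hx : x ∈ W) :
    DifferentiableAt ℝ (g ∘ (chartAt A x₀).symm) (chartAt A x₀ x) := by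
  refine ((contDiffOn_comp_chart_symm hg).contDiffAt
    (((chartAt A x₀).isOpen_inter_preimage_symm hW).mem_nhds ⟨(chartAt A x₀).map_source (hWs hx),
      by simpa [(chartAt A x₀).left_inv (hWs hx)] using hx⟩)).differentiableAt (by simp)

lemma pd_smooth (hg : ContMDiffOn 𝓘(ℝ, A) 𝓘(ℝ, ℝ) ∞ g W)
    (hW : IsOpen W) (hWs : W ⊆ (chartAt A x₀).source) :
    ContMDiffOn 𝓘(ℝ, A) 𝓘(ℝ, ℝ) ∞ (pd x₀ v g) W := by
  have h1 : ContDiffOn ℝ ∞ (fun y => fderiv ℝ (g ∘ (chartAt A x₀).symm) y v)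
      ((chartAt A x₀).target ∩ (chartAt A x₀).symm ⁻¹' W) :=
    ((contDiffOn_comp_chart_symm hg).fderiv_of_isOpen
      ((chartAt A x₀).isOpen_inter_preimage_symm hW) (by simp)).clm_apply contDiffOn_const
  exact h1.contMDiffOn.comp ((contMDiffOn_chart (I := 𝓘(ℝ, A)) (x := x₀)).mono hWs)
    fun x hx => ⟨(chartAt A x₀).map_source (hWs hx), by
      simpa [(chartAt A x₀).left_inv (hWs hx)] using hx⟩

lemma pd_add (hg : ContMDiffOn 𝓘(ℝ, A) 𝓘(ℝ, ℝ) ∞ g W) (hg' : ContMDiffOn 𝓘(ℝ, A) 𝓘(ℝ, ℝ) ∞ g' W)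
    (hW : IsOpen W) (hWs : W ⊆ (chartAt A x₀).source) {x : M} (hx : x ∈ W) :
    pd x₀ v (fun x => g x + g' x) x = pd x₀ v g x + pd x₀ v g' x := by
  have := fderiv_add (differentiableAt_comp_chart_symm hg hW hWs hx)
    (differentiableAt_comp_chart_symm hg' hW hWs hx)
  exact DFunLike.congr_fun this v

lemma pd_mul (hg : ContMDiffOn 𝓘(ℝ, A) 𝓘(ℝ, ℝ) ∞ g W) (hg' : ContMDiffOn 𝓘(ℝ, A) 𝓘(ℝ, ℝ) ∞ g' W)
    (hW : IsOpen W) (hWs : W ⊆ (chartAt A x₀).source) {x : M} (hx : x ∈ W) :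
    pd x₀ v (fun x => g x * g' x) x = pd x₀ v g x * g' x + g x * pd x₀ v g' x := by
  have := fderiv_mul (differentiableAt_comp_chart_symm hg hW hWs hx)
    (differentiableAt_comp_chart_symm hg' hW hWs hx)
  refine (DFunLike.congr_fun this v).trans ?_
  simp [pd, (chartAt A x₀).left_inv (hWs hx)]
  ring

lemma pd_mul_const (hg : ContMDiffOn 𝓘(ℝ, A) 𝓘(ℝ, ℝ) ∞ g W) (c : ℝ)
    (hW : IsOpen W) (hWs : W ⊆ (chartAt A x₀).source) {x : M} (hx : x ∈ W) :
    pd x₀ v (fun x => g x * c) x = pd x₀ v g x * c := by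
  rw [pd_mul hg contMDiffOn_const hW hWs hx, pd_const, mul_zero, add_zero]

lemma pd_sum {ι : Type*} (s : Finset ι) {G : ι → M → ℝ}
    (hg : ∀ i ∈ s, ContMDiffOn 𝓘(ℝ, A) 𝓘(ℝ, ℝ) ∞ (G i) W)
    (hW : IsOpen W) (hWs : W ⊆ (chartAt A x₀).source) {x : M} (hx : x ∈ W) :
    pd x₀ v (fun x => ∑ i ∈ s, G i x) x = ∑ i ∈ s, pd x₀ v (G i) x := by
  classical
  induction s using Finset.induction_on with
  | empty => simp
  | insert a s ha ih =>
    simp only [Finset.sum_insert ha]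
    rw [pd_add (hg a (by simp)) (contMDiffOn_finsetSum fun i hi => hg i (by simp [hi])) hW hWs hx,
      ih fun i hi => hg i (by simp [hi])]

omit [IsManifold 𝓘(ℝ, A) ∞ M] in
lemma pd_linear_chart (l : A →L[ℝ] ℝ) {x : M} (hx : x ∈ (chartAt A x₀).source) :
    pd x₀ v (fun x => l (chartAt A x₀ x)) x = l v := by
  have : (fun x => l (chartAt A x₀ x)) ∘ (chartAt A x₀).symm =ᶠ[𝓝 (chartAt A x₀ x)] l := by
    filter_upwards [(chartAt A x₀).open_target.mem_nhds ((chartAt A x₀).map_source hx)] with y hy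
    simp [(chartAt A x₀).right_inv hy]
  rw [pd, this.fderiv_eq, l.fderiv]

variable {V : Type*} [NormedAddCommGroup V] [NormedSpace ℝ V] [FiniteDimensional ℝ V]

/-- The coefficientwise partial derivative of a `Λ V*`-valued map. -/
def pdL (x₀ : M) (v : A) (w : M → LDual V) (x : M) : LDual V :=
  ∑ I, pd x₀ v (fun x => (lbasis V).coord I (w x)) x • lbasis V I

/-- Frees `pdL` from the basis used to define it. Identities between derivatives of Λ V*-valued maps
can then be tested on arbitrary functionals. -/
lemma apply_pdL {w : M → LDual V} (hw : LSmoothOn A w W) (hW : IsOpen W)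
    (hWs : W ⊆ (chartAt A x₀).source) {x : M} (hx : x ∈ W) (l : Module.Dual ℝ (LDual V)) :
    l (pdL x₀ v w x) = pd x₀ v (fun x => l (w x)) x := by
  have h : (fun x => l (w x)) = fun x => ∑ I, (lbasis V).coord I (w x) * l (lbasis V I) := by
    funext x
    conv_lhs => rw [← (lbasis V).sum_repr (w x), map_sum]
    simp
  have hs : ∀ I ∈ Finset.univ, ContMDiffOn 𝓘(ℝ, A) 𝓘(ℝ, ℝ) ∞
      (fun x => (lbasis V).coord I (w x) * l (lbasis V I)) W :=
    fun I _ => (hw _).mul contMDiffOn_const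
  rw [h, pd_sum _ hs hW hWs hx, pdL, map_sum]
  refine Finset.sum_congr rfl fun I _ => ?_
  rw [map_smul, smul_eq_mul, pd_mul_const (hw _) _ hW hWs hx]

lemma LDual.ext_dual {u u' : LDual V} (h : ∀ l : Module.Dual ℝ (LDual V), l u = l u') : u = u' :=
  (lbasis V).ext_elem fun I => h ((lbasis V).coord I)

lemma linear_pdL {V₂ : Type*} [NormedAddCommGroup V₂] [NormedSpace ℝ V₂] [FiniteDimensional ℝ V₂]
    {w : M → LDual V} (hw : LSmoothOn A w W) (hW : IsOpen W)
    (hWs : W ⊆ (chartAt A x₀).source) {x : M} (hx : x ∈ W) (T : LDual V →ₗ[ℝ] LDual V₂) :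
    T (pdL x₀ v w x) = pdL x₀ v (fun x => T (w x)) x := by
  refine LDual.ext_dual fun l => ?_
  rw [apply_pdL (hw.linear T) hW hWs hx]
  exact apply_pdL hw hW hWs hx (l ∘ₗ T)

lemma pdL_smooth {w : M → LDual V} (hw : LSmoothOn A w W) (hW : IsOpen W)
    (hWs : W ⊆ (chartAt A x₀).source) : LSmoothOn A (pdL x₀ v w) W :=
  LSmoothOn.sum _ fun _ _ => LSmoothOn.smul (pd_smooth (hw _) hW hWs) (LSmoothOn.const _ _)

omit [IsManifold 𝓘(ℝ, A) ∞ M] in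
lemma pdL_congr {w w' : M → LDual V} (hW : IsOpen W)
    (hWs : W ⊆ (chartAt A x₀).source) (h : EqOn w w' W) {x : M} (hx : x ∈ W) :
    pdL x₀ v w x = pdL x₀ v w' x := by
  refine Finset.sum_congr rfl fun I _ => ?_
  rw [pd_congr hW hWs (fun y hy => by rw [h hy]) hx]

omit [IsManifold 𝓘(ℝ, A) ∞ M] in
@[simp] lemma pdL_const (u : LDual V) (x : M) : pdL x₀ v (fun _ => u) x = 0 := by
  simp [pdL]

lemma pdL_add {w w' : M → LDual V} (hw : LSmoothOn A w W) (hw' : LSmoothOn A w' W)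
    (hW : IsOpen W) (hWs : W ⊆ (chartAt A x₀).source) {x : M} (hx : x ∈ W) :
    pdL x₀ v (fun x => w x + w' x) x = pdL x₀ v w x + pdL x₀ v w' x := by
  refine LDual.ext_dual fun l => ?_
  rw [apply_pdL (hw.add hw') hW hWs hx, map_add, apply_pdL hw hW hWs hx, apply_pdL hw' hW hWs hx]
  simp only [map_add]
  exact pd_add (hw l) (hw' l) hW hWs hx

lemma pdL_mul {w w' : M → LDual V} (hw : LSmoothOn A w W) (hw' : LSmoothOn A w' W)
    (hW : IsOpen W) (hWs : W ⊆ (chartAt A x₀).source) {x : M} (hx : x ∈ W) :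
    pdL x₀ v (fun x => w x * w' x) x = pdL x₀ v w x * w' x + w x * pdL x₀ v w' x := by
  refine LDual.ext_dual fun l => ?_
  rw [apply_pdL (hw.mul hw') hW hWs hx]
  -- Expanding both factors in the basis turns the product into scalar products weighted by the
  -- constants `l (e_I * e_J)`, so the scalar product rule applies.
  have h : (fun x => l (w x * w' x)) = fun x => ∑ I, ∑ J,
      ((lbasis V).coord I (w x) * (lbasis V).coord J (w' x)) * l (lbasis V I * lbasis V J) := by
    funext x
    conv_lhs => rw [← (lbasis V).sum_repr (w x), ← (lbasis V).sum_repr (w' x)]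
    simp only [Finset.sum_mul, Finset.mul_sum, map_sum, smul_mul_smul_comm, map_smul,
      smul_eq_mul, Module.Basis.coord_apply]
    rw [Finset.sum_comm]
  have hs : ∀ I J, ContMDiffOn 𝓘(ℝ, A) 𝓘(ℝ, ℝ) ∞ (fun x =>
      (lbasis V).coord I (w x) * (lbasis V).coord J (w' x)) W := fun I J => (hw _).mul (hw' _)
  have hs1 : ∀ I, ∀ J ∈ Finset.univ, ContMDiffOn 𝓘(ℝ, A) 𝓘(ℝ, ℝ) ∞
      (fun x => ((lbasis V).coord I (w x) * (lbasis V).coord J (w' x)) *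
        l (lbasis V I * lbasis V J)) W := fun I J _ => (hs I J).mul contMDiffOn_const
  have hs2 : ∀ I ∈ Finset.univ, ContMDiffOn 𝓘(ℝ, A) 𝓘(ℝ, ℝ) ∞
      (fun x => ∑ J, ((lbasis V).coord I (w x) * (lbasis V).coord J (w' x)) *
        l (lbasis V I * lbasis V J)) W := fun I _ => contMDiffOn_finsetSum (hs1 I)
  rw [h, pd_sum _ hs2 hW hWs hx]
  have h2 : ∀ I, pd x₀ v (fun x => ∑ J, ((lbasis V).coord I (w x) * (lbasis V).coord J (w' x)) *
      l (lbasis V I * lbasis V J)) x = ∑ J, (pd x₀ v (fun x => (lbasis V).coord I (w x)) x *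
        (lbasis V).coord J (w' x) + (lbasis V).coord I (w x) *
          pd x₀ v (fun x => (lbasis V).coord J (w' x)) x) * l (lbasis V I * lbasis V J) := by
    intro I
    rw [pd_sum _ (hs1 I) hW hWs hx]
    refine Finset.sum_congr rfl fun J _ => ?_
    rw [pd_mul_const (hs I J) _ hW hWs hx, pd_mul (hw _) (hw' _) hW hWs hx]
  simp only [h2]
  conv_rhs => rw [← (lbasis V).sum_repr (w x), ← (lbasis V).sum_repr (w' x)]
  simp only [pdL, Finset.sum_mul, Finset.mul_sum, map_add, map_sum, smul_mul_smul_comm, map_smul,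
    smul_eq_mul, Module.Basis.coord_apply, add_mul, Finset.sum_add_distrib]
  congr 1 <;> rw [Finset.sum_comm]

end PartialDerivatives

/-! ### Coordinate superfunctions and coordinate super vector fields -/

section Frames

variable {A : Type*} [NormedAddCommGroup A] [NormedSpace ℝ A] [FiniteDimensional ℝ A]
  {V : Type*} [NormedAddCommGroup V] [NormedSpace ℝ V] [FiniteDimensional ℝ V]
  {M : Type*} [TopologicalSpace M] [ChartedSpace A M] [IsManifold 𝓘(ℝ, A) ∞ M]
  {E : M → Type*} [∀ x, AddCommGroup (E x)] [∀ x, Module ℝ (E x)]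
  [∀ x, TopologicalSpace (E x)] [TopologicalSpace (TotalSpace V E)]
  [FiberBundle V E] [VectorBundle ℝ V E] [ContMDiffVectorBundle ∞ V E 𝓘(ℝ, A)]

variable (A V E) in
/-- The domain of the coordinates around `x₀`. -/
def dom (x₀ : M) : Opens M :=
  ⟨(chartAt A x₀).source ∩ (trivializationAt V E x₀).baseSet,
    (chartAt A x₀).open_source.inter (trivializationAt V E x₀).open_baseSet⟩

lemma mem_dom_self (x₀ : M) : x₀ ∈ dom A V E x₀ :=
  ⟨mem_chart_source A x₀, FiberBundle.mem_baseSet_trivializationAt' x₀⟩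

lemma subset_baseSet_of_le_dom {x₀ : M} {U : Opens M} (hU : U ≤ dom A V E x₀) :
    (U : Set M) ⊆ (trivializationAt V E x₀).baseSet := fun _ hx => (hU hx).2

lemma subset_source_of_le_dom {x₀ : M} {U : Opens M} (hU : U ≤ dom A V E x₀) :
    (U : Set M) ⊆ (chartAt A x₀).source := fun _ hx => (hU hx).1

lemma loc_smooth_of_le_dom {x₀ : M} {U : Opens M} (hU : U ≤ dom A V E x₀) (f : SuperFun A V E U) :
    LSmoothOn A (loc (trivializationAt V E x₀) f) U :=
  fun l => coord_smooth _ (subset_baseSet_of_le_dom hU) f l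

/-- The derivative of a superfunction in the direction `v`, in coordinates around `x₀`. -/
def dvFun (x₀ : M) {W : Opens M} (hW : W ≤ dom A V E x₀) (v : A) (f : SuperFun A V E W) :
    SuperFun A V E W :=
  mkIn (trivializationAt V E x₀) W (subset_baseSet_of_le_dom hW)
    (pdL x₀ v (loc (trivializationAt V E x₀) f))
    (pdL_smooth (loc_smooth_of_le_dom hW f) W.2 (subset_source_of_le_dom hW))

lemma loc_dvFun {x₀ : M} {W : Opens M} (hW : W ≤ dom A V E x₀) (v : A) (f : SuperFun A V E W)
    {x : M} (hx : x ∈ W) : loc (trivializationAt V E x₀) (dvFun x₀ hW v f) x =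
      pdL x₀ v (loc (trivializationAt V E x₀) f) x :=
  loc_mkIn _ _ _ hx

/-- The derivation of superfunctions in the direction `v`, in coordinates around `x₀`. -/
def dvPre (x₀ : M) {U : Opens M} (hU : U ≤ dom A V E x₀) (v : A) : PreEnd A V E U := fun W =>
  { toFun := dvFun x₀ (W.2.trans hU) v
    map_add' := fun f g => by
      refine ext_loc (trivializationAt V E x₀)
        (subset_baseSet_of_le_dom (W.2.trans hU)) fun x hx => ?_
      rw [loc_add, loc_dvFun _ _ _ hx, loc_dvFun _ _ _ hx, loc_dvFun _ _ _ hx,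
        ← pdL_add (loc_smooth_of_le_dom (W.2.trans hU) f) (loc_smooth_of_le_dom (W.2.trans hU) g)
        W.1.2 (subset_source_of_le_dom (W.2.trans hU)) hx]
      exact pdL_congr W.1.2 (subset_source_of_le_dom (W.2.trans hU))
        (fun y _ => loc_add _ f g y) hx
    map_smul' := fun c f => by
      refine ext_loc (trivializationAt V E x₀)
        (subset_baseSet_of_le_dom (W.2.trans hU)) fun x hx => ?_
      rw [RingHom.id_apply, loc_smul, loc_dvFun _ _ _ hx, loc_dvFun _ _ _ hx]
      have := linear_pdL (v := v) (loc_smooth_of_le_dom (W.2.trans hU) f) W.1.2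
        (subset_source_of_le_dom (W.2.trans hU)) hx (c • (LinearMap.id : LDual V →ₗ[ℝ] LDual V))
      refine Eq.trans ?_ this.symm
      exact pdL_congr W.1.2 (subset_source_of_le_dom (W.2.trans hU))
        (fun y _ => loc_smul _ c f y) hx }

lemma loc_dvPre {x₀ : M} {U : Opens M} (hU : U ≤ dom A V E x₀) (v : A)
    (W : {W : Opens M // W ≤ U}) (f : SuperFun A V E W.1) {x : M} (hx : x ∈ W.1) :
    loc (trivializationAt V E x₀) (dvPre x₀ hU v W f) x =
      pdL x₀ v (loc (trivializationAt V E x₀) f) x :=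
  loc_dvFun (W.2.trans hU) v f hx

/-- Compatibility with restriction is locality of the derivative, evenness holds because
coefficientwise differentiation commutes with the linear parity projections, and the Leibniz rule is
`pdL_mul`. -/
lemma dvPre_mem {x₀ : M} {U : Opens M} (hU : U ≤ dom A V E x₀) (v : A) :
    dvPre x₀ hU v ∈ SuperDer A V E U 0 := by
  refine ⟨fun W W' h f => ?_, fun W b f hf => ?_, fun W b f g hf => ?_⟩
  · refine ext_loc (trivializationAt V E x₀) (subset_baseSet_of_le_dom (W'.2.trans hU)) fun x hx => ?_
    rw [loc_res _ _ _ hx, loc_dvPre hU v W' _ hx, loc_dvPre hU v W _ (h hx)]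
    exact pdL_congr W'.1.2 (subset_source_of_le_dom (W'.2.trans hU)) (fun y hy => loc_res _ _ _ hy) hx
  · rw [zero_add]
    refine hasParity_of_loc (trivializationAt V E x₀) (subset_baseSet_of_le_dom (W.2.trans hU)) fun x hx => ?_
    rw [loc_dvPre hU v W _ hx, mem_parityPart_iff,
      linear_pdL (loc_smooth_of_le_dom (W.2.trans hU) f) W.1.2
        (subset_source_of_le_dom (W.2.trans hU)) hx]
    exact pdL_congr W.1.2 (subset_source_of_le_dom (W.2.trans hU))
      (fun y hy => mem_parityPart_iff.1 (loc_mem_parityPart _ hf hy)) hx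
  · refine ext_loc (trivializationAt V E x₀) (subset_baseSet_of_le_dom (W.2.trans hU)) fun x hx => ?_
    have : sgn 0 b = 1 := by simp [sgn]
    rw [this, one_smul, loc_add, loc_mul, loc_mul, loc_dvPre hU v W _ hx, loc_dvPre hU v W _ hx,
      loc_dvPre hU v W _ hx,
      ← pdL_mul (loc_smooth_of_le_dom (W.2.trans hU) f)
        (loc_smooth_of_le_dom (W.2.trans hU) g) W.1.2
        (subset_source_of_le_dom (W.2.trans hU)) hx]
    exact pdL_congr W.1.2 (subset_source_of_le_dom (W.2.trans hU)) (fun y hy => loc_mul _ _ _ _) hx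

lemma localRep_contr (e : Trivialization V (π V E)) [e.IsLinear ℝ] {x : M}
    (hx : x ∈ e.baseSet) (y : E x) (u : LDual (E x)) :
    localRep e x (contr y u) = contr (e.continuousLinearMapAt ℝ x y) (localRep e x u) := by
  refine map_contr _ _ _ (fun η => ?_) u
  change η (e.symmL ℝ x (e.continuousLinearMapAt ℝ x y)) = _
  rw [e.symmL_continuousLinearMapAt hx]

lemma section_smooth_triv {U : Opens M} {s : ∀ x, E x}
    (hs : ContMDiffOn 𝓘(ℝ, A) (𝓘(ℝ, A).prod 𝓘(ℝ, V)) ∞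
      (fun x => (⟨x, s x⟩ : TotalSpace V E)) U)
    (e : Trivialization V (π V E)) [MemTrivializationAtlas e] :
    ContMDiffOn 𝓘(ℝ, A) 𝓘(ℝ, V) ∞ (fun x => e.continuousLinearMapAt ℝ x (s x))
      (U ∩ e.baseSet) := by
  refine ((e.contMDiffOn_section_iff (U.2.inter e.open_baseSet) inter_subset_right).1
    (hs.mono inter_subset_left)).congr fun x hx => ?_
  rw [e.continuousLinearMapAt_apply_of_mem (R := ℝ) hx.2]

/-- Contraction of a superfunction with a smooth section. -/
def ctrFun {U W : Opens M} (s : ∀ x, E x)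
    (hs : ContMDiffOn 𝓘(ℝ, A) (𝓘(ℝ, A).prod 𝓘(ℝ, V)) ∞
      (fun x => (⟨x, s x⟩ : TotalSpace V E)) U) (h : W ≤ U) (f : SuperFun A V E W) :
    SuperFun A V E W :=
  mkSuper W (fun x => contr (s x) (f.ext0 x)) fun e _ =>
    (LSmoothOn.contr ((section_smooth_triv hs e).mono (inter_subset_inter_left _ h))
      (loc_smooth e f)).congr fun _ hx => localRep_contr e hx.2 _ _

lemma ext0_ctrFun {U W : Opens M} {s : ∀ x, E x}
    (hs : ContMDiffOn 𝓘(ℝ, A) (𝓘(ℝ, A).prod 𝓘(ℝ, V)) ∞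
      (fun x => (⟨x, s x⟩ : TotalSpace V E)) U) (h : W ≤ U)
    (f : SuperFun A V E W) {x : M} (hx : x ∈ W) :
    (ctrFun s hs h f).ext0 x = contr (s x) (f.ext0 x) := ext0_mkSuper hx

/-- Contraction of superfunctions with a smooth section. -/
def ctrPre {U : Opens M} (s : ∀ x, E x)
    (hs : ContMDiffOn 𝓘(ℝ, A) (𝓘(ℝ, A).prod 𝓘(ℝ, V)) ∞
      (fun x => (⟨x, s x⟩ : TotalSpace V E)) U) : PreEnd A V E U := fun W =>
  { toFun := ctrFun s hs W.2
    map_add' := fun f g => SuperFun.ext_ext0 fun x hx => by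
      rw [ext0_add, ext0_ctrFun _ _ _ hx, ext0_ctrFun _ _ _ hx, ext0_ctrFun _ _ _ hx, ext0_add,
        map_add]
    map_smul' := fun c f => SuperFun.ext_ext0 fun x hx => by
      rw [RingHom.id_apply, ext0_smul, ext0_ctrFun _ _ _ hx, ext0_ctrFun _ _ _ hx, ext0_smul,
        map_smul] }

lemma ext0_ctrPre {U : Opens M} {s : ∀ x, E x}
    (hs : ContMDiffOn 𝓘(ℝ, A) (𝓘(ℝ, A).prod 𝓘(ℝ, V)) ∞
      (fun x => (⟨x, s x⟩ : TotalSpace V E)) U) (W : {W : Opens M // W ≤ U})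
    (f : SuperFun A V E W.1) {x : M} (hx : x ∈ W.1) :
    (ctrPre s hs W f).ext0 x = contr (s x) (f.ext0 x) := ext0_ctrFun hs W.2 f hx

/-- The involution in `contr_mul` acts on an element of parity `b` by the scalar `sgn b 1`, which is
the Leibniz sign of an odd derivation. -/
lemma ctrPre_mem {U : Opens M} {s : ∀ x, E x}
    (hs : ContMDiffOn 𝓘(ℝ, A) (𝓘(ℝ, A).prod 𝓘(ℝ, V)) ∞
      (fun x => (⟨x, s x⟩ : TotalSpace V E)) U) :
    ctrPre s hs ∈ SuperDer A V E U 1 := by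
  refine ⟨fun W W' h f => ?_, fun W b f hf => ?_, fun W b f g hf => ?_⟩
  · refine SuperFun.ext_ext0 fun x hx => ?_
    rw [ext0_res _ _ hx, ext0_ctrPre hs _ _ hx, ext0_ctrPre hs _ _ (h hx), ext0_res _ _ hx]
  · refine hasParity_iff.2 fun x hx => ?_
    rw [ext0_ctrPre hs _ _ hx]
    exact contr_mem (hasParity_iff.1 hf x hx)
  · refine SuperFun.ext_ext0 fun x hx => ?_
    have : sgn 1 b = sgn b 1 := by simp [sgn, and_comm]
    rw [ext0_ctrPre hs _ _ hx, ext0_mul, contr_mul, ext0_add, ext0_mul, ext0_smul, ext0_mul,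
      ext0_ctrPre hs _ _ hx, ext0_ctrPre hs _ _ hx, involute_of_mem (hasParity_iff.1 hf x hx),
      smul_mul_assoc, this]

variable (A V) in
/-- The index type of the coordinates: even coordinates and odd coordinates. -/
abbrev Idx : Type := Fin (Module.finrank ℝ A) ⊕ Fin (Module.finrank ℝ V)

/-- The parity of a coordinate. -/
def par : Idx A V → ZMod 2 := Sum.elim (fun _ => 0) (fun _ => 1)

lemma evenCoord_smooth {x₀ : M} {U : Opens M} (hU : U ≤ dom A V E x₀)
    (i : Fin (Module.finrank ℝ A)) :
    ContMDiffOn 𝓘(ℝ, A) 𝓘(ℝ, ℝ) ∞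
      (fun x => (Module.finBasis ℝ A).coord i (chartAt A x₀ x)) U :=
  (LinearMap.toContinuousLinearMap ((Module.finBasis ℝ A).coord i)).contDiff.contMDiff
    |>.comp_contMDiffOn ((contMDiffOn_chart (I := 𝓘(ℝ, A)) (x := x₀)).mono fun _ hx => (hU hx).1)

/-- The coordinate superfunctions. -/
def zc (x₀ : M) {U : Opens M} (hU : U ≤ dom A V E x₀) : Idx A V → SuperFun A V E U
  | .inl i => fn U (fun x => (Module.finBasis ℝ A).coord i (chartAt A x₀ x))
      (evenCoord_smooth hU i)
  | .inr a => cst (trivializationAt V E x₀) U (subset_baseSet_of_le_dom hU)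
      (ExteriorAlgebra.ι ℝ ((Module.finBasis ℝ V).coord a))

lemma loc_zc_inl {x₀ : M} {U : Opens M} (hU : U ≤ dom A V E x₀) (i) {x : M} (hx : x ∈ U) :
    loc (trivializationAt V E x₀) (zc x₀ hU (.inl i)) x =
      algebraMap ℝ _ ((Module.finBasis ℝ A).coord i (chartAt A x₀ x)) :=
  loc_fn (hg := evenCoord_smooth hU i) _ hx

lemma loc_zc_inr {x₀ : M} {U : Opens M} (hU : U ≤ dom A V E x₀) (a) {x : M} (hx : x ∈ U) :
    loc (trivializationAt V E x₀) (zc x₀ hU (.inr a)) x =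
      ExteriorAlgebra.ι ℝ ((Module.finBasis ℝ V).coord a) := loc_cst _ (subset_baseSet_of_le_dom hU) hx

lemma res_zc {x₀ : M} {U U' : Opens M} (hU : U ≤ dom A V E x₀) (h : U' ≤ U) (γ : Idx A V) :
    res h (zc x₀ hU γ) = zc x₀ (h.trans hU) γ := by
  refine ext_loc (trivializationAt V E x₀) (subset_baseSet_of_le_dom (h.trans hU)) fun x hx => ?_
  rw [loc_res _ _ _ hx]
  rcases γ with i | a
  · rw [loc_zc_inl _ _ hx, loc_zc_inl _ _ (h hx)]
  · rw [loc_zc_inr _ _ hx, loc_zc_inr _ _ (h hx)]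

lemma zc_hasParity {x₀ : M} {U : Opens M} (hU : U ≤ dom A V E x₀) (γ : Idx A V) :
    HasParity (par γ) (zc x₀ hU γ) := by
  rcases γ with i | a
  · exact fn_hasParity (evenCoord_smooth hU i)
  · refine hasParity_of_loc (trivializationAt V E x₀) (subset_baseSet_of_le_dom hU) fun x hx => ?_
    rw [loc_zc_inr _ _ hx]
    exact ι_mem_parityPart _

/-- The local frame section of `E`. -/
def frameSec (x₀ : M) (a : Fin (Module.finrank ℝ V)) : ∀ x, E x :=
  (trivializationAt V E x₀).localFrame (Module.finBasis ℝ V) a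

lemma frameSec_smooth {x₀ : M} {U : Opens M} (hU : U ≤ dom A V E x₀)
    (a : Fin (Module.finrank ℝ V)) :
    ContMDiffOn 𝓘(ℝ, A) (𝓘(ℝ, A).prod 𝓘(ℝ, V)) ∞
      (fun x => (⟨x, frameSec x₀ a x⟩ : TotalSpace V E)) U :=
  ((trivializationAt V E x₀).contMDiffOn_localFrame_baseSet (I := 𝓘(ℝ, A)) ∞
    (Module.finBasis ℝ V) a).mono fun _ hx => (hU hx).2

lemma triv_frameSec {x₀ x : M} (hx : x ∈ (trivializationAt V E x₀).baseSet)
    (a : Fin (Module.finrank ℝ V)) :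
    (trivializationAt V E x₀).continuousLinearMapAt ℝ x (frameSec x₀ a x) =
      Module.finBasis ℝ V a := by
  rw [frameSec, Trivialization.localFrame_apply_of_mem_baseSet _ _ hx]
  have : (trivializationAt V E x₀).basisAt (Module.finBasis ℝ V) hx a =
      (trivializationAt V E x₀).symmL ℝ x (Module.finBasis ℝ V a) := by
    rw [(trivializationAt V E x₀).symmL_apply hx]; rfl
  rw [this, (trivializationAt V E x₀).continuousLinearMapAt_symmL hx]

/-- The coordinate super vector fields. -/
def fr (x₀ : M) {U : Opens M} (hU : U ≤ dom A V E x₀) : Idx A V → SuperVF A V E U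
  | .inl i => ⟨dvPre x₀ hU (Module.finBasis ℝ A i), superDer_le _ _ (dvPre_mem hU _)⟩
  | .inr a => ⟨ctrPre (frameSec x₀ a) (frameSec_smooth hU a),
      superDer_le _ _ (ctrPre_mem (frameSec_smooth hU a))⟩

lemma fr_parity {x₀ : M} {U : Opens M} (hU : U ≤ dom A V E x₀) (γ : Idx A V) :
    VFParity (par γ) (fr x₀ hU γ) := by
  rcases γ with i | a
  · exact dvPre_mem hU _
  · exact ctrPre_mem (frameSec_smooth hU a)

lemma loc_act_fr_inl {x₀ : M} {U W : Opens M} (hU : U ≤ dom A V E x₀) (h : W ≤ U) (i)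
    (f : SuperFun A V E W) {x : M} (hx : x ∈ W) :
    loc (trivializationAt V E x₀) (act (fr x₀ hU (.inl i)) h f) x =
      pdL x₀ (Module.finBasis ℝ A i) (loc (trivializationAt V E x₀) f) x :=
  loc_dvPre hU _ ⟨W, h⟩ f hx

lemma loc_act_fr_inr {x₀ : M} {U W : Opens M} (hU : U ≤ dom A V E x₀) (h : W ≤ U) (a)
    (f : SuperFun A V E W) {x : M} (hx : x ∈ W) :
    loc (trivializationAt V E x₀) (act (fr x₀ hU (.inr a)) h f) x =
      contr (Module.finBasis ℝ V a) (loc (trivializationAt V E x₀) f x) := by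
  have h2 := ext0_ctrPre (frameSec_smooth hU a) ⟨W, h⟩ f hx
  have h3 : (act (fr x₀ hU (.inr a)) h f).ext0 x = _ := h2
  rw [loc, h3, localRep_contr _ (hU (h hx)).2, triv_frameSec (hU (h hx)).2]
  rfl

lemma resVF_fr {x₀ : M} {U U' : Opens M} (hU : U ≤ dom A V E x₀) (h : U' ≤ U) (γ : Idx A V) :
    resVF h (fr x₀ hU γ) = fr x₀ (h.trans hU) γ := by
  rcases γ with i | a <;> rfl

/-- Duality of frame and coordinates; this is what allows coefficients of a super vector field to be
read off from its values on coordinates. -/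
lemma act_fr_zc {x₀ : M} {U : Opens M} (hU : U ≤ dom A V E x₀) (γ δ : Idx A V) :
    act (fr x₀ hU γ) le_rfl (zc x₀ hU δ) = if γ = δ then 1 else 0 := by
  have hs : (U : Set M) ⊆ (chartAt A x₀).source := fun _ hx => (hU hx).1
  have h1 : ∀ x ∈ U, loc (trivializationAt V E x₀) (1 : SuperFun A V E U) x = 1 := fun x hx => by
    rw [loc, SuperFun.ext0_of_mem _ hx]
    exact map_one _
  have h0 : ∀ x ∈ U, loc (trivializationAt V E x₀) (0 : SuperFun A V E U) x = 0 := fun x hx => by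
    rw [loc, SuperFun.ext0_of_mem _ hx]
    exact map_zero _
  refine ext_loc (trivializationAt V E x₀) (subset_baseSet_of_le_dom hU) fun x hx => ?_
  have hR : loc (trivializationAt V E x₀) (if γ = δ then (1 : SuperFun A V E U) else 0) x =
      if γ = δ then 1 else 0 := by
    split_ifs
    · exact h1 x hx
    · exact h0 x hx
  rw [hR]
  rcases γ with i | a
  · rw [loc_act_fr_inl hU le_rfl i _ hx]
    rcases δ with j | b
    · refine (pdL_congr U.2 hs (fun y hy => loc_zc_inl hU j hy) hx).trans ?_
      refine LDual.ext_dual fun l => ?_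
      have hsm : LSmoothOn A (fun x => algebraMap ℝ (LDual V)
          ((Module.finBasis ℝ A).coord j (chartAt A x₀ x))) U := by
        simp only [Algebra.algebraMap_eq_smul_one]
        exact LSmoothOn.smul (evenCoord_smooth hU j) (LSmoothOn.const _ _)
      rw [apply_pdL hsm U.2 hs hx]
      simp only [Algebra.algebraMap_eq_smul_one, map_smul, smul_eq_mul]
      rw [pd_mul_const (evenCoord_smooth hU j) _ U.2 hs hx]
      have := pd_linear_chart (v := Module.finBasis ℝ A i)
        (LinearMap.toContinuousLinearMap ((Module.finBasis ℝ A).coord j)) (hs hx)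
      simp only [LinearMap.coe_toContinuousLinearMap'] at this
      rw [this]
      simp only [Module.Basis.coord_apply, Module.Basis.repr_self, Finsupp.single_apply,
        Sum.inl.injEq]
      split_ifs <;> simp
    · refine (pdL_congr U.2 hs (fun y hy => loc_zc_inr hU b hy) hx).trans ?_
      simp
  · rw [loc_act_fr_inr hU le_rfl a _ hx]
    rcases δ with j | b
    · rw [loc_zc_inl hU j hx]; simp
    · rw [loc_zc_inr hU b hx, contr_ι]
      simp only [Module.Basis.coord_apply, Module.Basis.repr_self, Finsupp.single_apply,
        Sum.inr.injEq]
      split_ifs <;> simp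

end Frames

/-! ### Superderivations in coordinates -/

section Derivations

variable {A : Type*} [NormedAddCommGroup A] [NormedSpace ℝ A] [FiniteDimensional ℝ A]
  {V : Type*} [NormedAddCommGroup V] [NormedSpace ℝ V] [FiniteDimensional ℝ V]
  {M : Type*} [TopologicalSpace M] [ChartedSpace A M] [IsManifold 𝓘(ℝ, A) ∞ M]
  {E : M → Type*} [∀ x, AddCommGroup (E x)] [∀ x, Module ℝ (E x)]
  [∀ x, TopologicalSpace (E x)] [TopologicalSpace (TotalSpace V E)]
  [FiberBundle V E] [VectorBundle ℝ V E] [ContMDiffVectorBundle ∞ V E 𝓘(ℝ, A)]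

lemma der_one {U : Opens M} {c : ZMod 2} {X : PreEnd A V E U} (hX : X ∈ SuperDer A V E U c)
    (W : {W : Opens M // W ≤ U}) : X W 1 = 0 := by
  have h1 : HasParity 0 (1 : SuperFun A V E W.1) := fun x => by
    have := algebraMap_mem_parityPart (V := E x) 1
    rwa [map_one] at this
  have := hX.2.2 W 0 1 1 h1
  have hs : sgn c 0 = 1 := by simp [sgn]
  rw [hs, one_smul, mul_one, mul_one, one_mul] at this
  exact left_eq_add.1 this

/-- The sign in the Leibniz rule differs on the even and odd components of `f`, but it multiplies `X
g = 0`. No homogeneity of `f` is needed. -/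
lemma der_mul_of_apply_eq_zero {U : Opens M} {c : ZMod 2} {X : PreEnd A V E U}
    (hX : X ∈ SuperDer A V E U c) (W : {W : Opens M // W ≤ U}) (f : SuperFun A V E W.1)
    {g : SuperFun A V E W.1} (hg : X W g = 0) : X W (f * g) = X W f * g := by
  conv_lhs => rw [← comp_add_comp f]
  rw [add_mul, map_add, hX.2.2 W 0 _ g (comp_hasParity 0 f),
    hX.2.2 W 1 _ g (comp_hasParity 1 f), hg]
  simp only [mul_zero, smul_zero, add_zero]
  rw [← add_mul, ← map_add, comp_add_comp]

/-- The superfunctions with constant expression, as an algebra homomorphism. -/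
def cstHom (e : Trivialization V (π V E)) [MemTrivializationAtlas e] (U : Opens M)
    (hU : (U : Set M) ⊆ e.baseSet) : LDual V →ₐ[ℝ] SuperFun A V E U :=
  AlgHom.ofLinearMap
    { toFun := cst e U hU
      map_add' := fun u v => ext_loc e hU fun x hx => by
        rw [loc_add, loc_cst _ _ hx, loc_cst _ _ hx, loc_cst _ _ hx]
      map_smul' := fun c u => ext_loc e hU fun x hx => by
        rw [RingHom.id_apply, loc_smul, loc_cst _ _ hx, loc_cst _ _ hx] }
    (ext_loc e hU fun x hx => by
      rw [LinearMap.coe_mk, AddHom.coe_mk, loc_cst _ _ hx, loc, SuperFun.ext0_of_mem _ hx]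
      exact (map_one _).symm)
    (fun u v => ext_loc e hU fun x hx => by
      rw [LinearMap.coe_mk, AddHom.coe_mk, loc_mul, loc_cst _ _ hx, loc_cst _ _ hx,
        loc_cst _ _ hx])

/-! ### A superderivation killing the coordinates is zero -/

section Vanishing

variable {x₀ : M} {U : Opens M} (hU : U ≤ dom A V E x₀) {c : ZMod 2} {X : PreEnd A V E U}
  (hX : X ∈ SuperDer A V E U c) (hz : ∀ γ, X ⟨U, le_rfl⟩ (zc x₀ hU γ) = 0)
include hX hz

lemma der_zc_eq_zero (W : {W : Opens M // W ≤ U}) (γ : Idx A V) :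
    X W (zc x₀ (W.2.trans hU) γ) = 0 := by
  rw [← res_zc hU W.2, hX.1 ⟨U, le_rfl⟩ W W.2, hz, map_zero]

/-- The constant-coefficient superfunctions form an algebra generated by the odd coordinates, and
the kernel of a superderivation is closed under products. -/
lemma der_cst_eq_zero (W : {W : Opens M // W ≤ U}) (u : LDual V) :
    X W (cst (trivializationAt V E x₀) W.1 (subset_baseSet_of_le_dom (W.2.trans hU)) u) = 0 := by
  change X W (cstHom (trivializationAt V E x₀) W.1
    (subset_baseSet_of_le_dom (W.2.trans hU)) u) = 0
  induction u using ExteriorAlgebra.induction with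
  | algebraMap r =>
    rw [AlgHom.commutes, Algebra.algebraMap_eq_smul_one, map_smul, der_one hX, smul_zero]
  | ι η =>
    have : η = ∑ a, η (Module.finBasis ℝ V a) • (Module.finBasis ℝ V).coord a := by
      refine (Module.finBasis ℝ V).ext fun b => ?_
      simp
    rw [this]
    simp only [map_sum, map_smul]
    refine Finset.sum_eq_zero fun a _ => ?_
    rw [show X W (cstHom (trivializationAt V E x₀) W.1
      (subset_baseSet_of_le_dom (W.2.trans hU)) (ExteriorAlgebra.ι ℝ
        ((Module.finBasis ℝ V).coord a))) = 0 from der_zc_eq_zero hU hX hz W (.inr a), smul_zero]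
  | mul a b ha hb => rw [map_mul, der_mul_of_apply_eq_zero hX W _ hb, ha, zero_mul]
  | add a b ha hb => rw [map_add, map_add, ha, hb, add_zero]

/-- By Hadamard's lemma at the image of `x`, the function is a constant plus a sum of terms (zⁱ -
zⁱ(x)) qᵢ. The derivation kills the constant and the first factors, and what remains carries a
factor vanishing at `x`. -/
lemma ext0_der_comp_chart (W : {W : Opens M // W ≤ U}) {F : A → ℝ} (hF : ContDiff ℝ ∞ F)
    (hg : ContMDiffOn 𝓘(ℝ, A) 𝓘(ℝ, ℝ) ∞ (fun x => F (chartAt A x₀ x)) W.1) {x : M}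
    (hx : x ∈ W.1) : (X W (fn W.1 _ hg)).ext0 x = 0 := by
  obtain ⟨q, hq, hFq⟩ := exists_eq_add_sum_coord_mul (Module.finBasis ℝ A) hF (chartAt A x₀ x)
  have hchart := (contMDiffOn_chart (I := 𝓘(ℝ, A)) (n := ∞) (x := x₀)).mono
    (subset_source_of_le_dom (W.2.trans hU))
  have hqs : ∀ i, ContMDiffOn 𝓘(ℝ, A) 𝓘(ℝ, ℝ) ∞ (fun y => q i (chartAt A x₀ y)) W.1 :=
    fun i => (hq i).contMDiff.comp_contMDiffOn hchart
  have hzi : ∀ i, X W (zc x₀ (W.2.trans hU) (.inl i) -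
      ((Module.finBasis ℝ A).coord i (chartAt A x₀ x)) • 1) = 0 := fun i => by
    rw [map_sub, map_smul, der_one hX, der_zc_eq_zero hU hX hz, smul_zero, sub_zero]
  have hz0 : ∀ i, HasParity 0 (zc x₀ (W.2.trans hU) (.inl i) -
      ((Module.finBasis ℝ A).coord i (chartAt A x₀ x)) • 1) := fun i y =>
    sub_mem (zc_hasParity (W.2.trans hU) (.inl i) y) (Submodule.smul_mem _ _ (by
      have := algebraMap_mem_parityPart (V := E y) 1
      rwa [map_one] at this))
  have h1 : ∀ y ∈ W.1, loc (trivializationAt V E x₀) (1 : SuperFun A V E W.1) y = 1 :=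
    fun y hy => by
      rw [loc, SuperFun.ext0_of_mem _ hy]
      exact map_one _
  have hlz : ∀ i, ∀ y ∈ W.1, loc (trivializationAt V E x₀) (zc x₀ (W.2.trans hU) (.inl i) -
      ((Module.finBasis ℝ A).coord i (chartAt A x₀ x)) • 1) y =
      algebraMap ℝ _ ((Module.finBasis ℝ A).coord i (chartAt A x₀ y) -
        (Module.finBasis ℝ A).coord i (chartAt A x₀ x)) := fun i y hy => by
    rw [sub_eq_add_neg, ← neg_smul, loc_add, loc_smul, h1 y hy, loc_zc_inl _ _ hy, map_sub,
      neg_smul, ← sub_eq_add_neg]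
    simp only [Algebra.algebraMap_eq_smul_one]
  have key : fn W.1 _ hg = F (chartAt A x₀ x) • (1 : SuperFun A V E W.1) +
      ∑ i, (zc x₀ (W.2.trans hU) (.inl i) -
        ((Module.finBasis ℝ A).coord i (chartAt A x₀ x)) • 1) * fn W.1 _ (hqs i) := by
    refine ext_loc (trivializationAt V E x₀) (subset_baseSet_of_le_dom (W.2.trans hU))
      fun y hy => ?_
    rw [loc_fn _ hy, hFq, loc_add, loc_sum, loc_smul, h1 y hy, map_add, map_sum,
      Algebra.algebraMap_eq_smul_one]
    congr 1
    refine Finset.sum_congr rfl fun i _ => ?_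
    rw [loc_mul, loc_fn _ hy, hlz i y hy, map_mul]
  rw [key, map_add, map_smul, der_one hX, smul_zero, zero_add, map_sum, ext0_sum]
  refine Finset.sum_eq_zero fun i _ => ?_
  have hs : sgn c 0 = 1 := by simp [sgn]
  rw [hX.2.2 W 0 _ _ (hz0 i), hzi, zero_mul, zero_add, hs, one_smul, ext0_mul]
  have : (zc x₀ (W.2.trans hU) (.inl i) -
      ((Module.finBasis ℝ A).coord i (chartAt A x₀ x)) • 1 : SuperFun A V E W.1).ext0 x = 0 := by
    apply localRep_injective (trivializationAt V E x₀)
      (subset_baseSet_of_le_dom (W.2.trans hU) hx)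
    rw [map_zero]
    refine (hlz i x hx).trans ?_
    rw [sub_self, map_zero]
  rw [this, zero_mul]

/-- Hadamard's lemma needs a function smooth on all of `A`. With a cutoff χ equal to 1 at the image
of `x` and supported in the image of `W`, both χ and χg are of that kind, and the product rule for
χg at `x` leaves only the value of X(g). -/
lemma der_fn_eq_zero (W : {W : Opens M // W ≤ U}) {g : M → ℝ}
    (hg : ContMDiffOn 𝓘(ℝ, A) 𝓘(ℝ, ℝ) ∞ g W.1) : X W (fn W.1 g hg) = 0 := by
  refine SuperFun.ext_ext0 fun x hx => ?_
  have hsrc := subset_source_of_le_dom (W.2.trans hU)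
  have hchart := (contMDiffOn_chart (I := 𝓘(ℝ, A)) (n := ∞) (x := x₀)).mono hsrc
  set y₀ := chartAt A x₀ x with hy₀
  set O : Set A := (chartAt A x₀).target ∩ (chartAt A x₀).symm ⁻¹' W.1 with hO
  have hOo : IsOpen O := (chartAt A x₀).isOpen_inter_preimage_symm W.1.2
  have hyO : y₀ ∈ O := ⟨(chartAt A x₀).map_source (hsrc hx), by
    simpa [hy₀, (chartAt A x₀).left_inv (hsrc hx)] using hx⟩
  obtain ⟨χ, hχs, -, hχ, -, hχ1⟩ :=
    exists_contDiff_tsupport_subset (n := ⊤) (hOo.mem_nhds hyO)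
  have hχg : ContDiff ℝ ∞ (fun y => χ y * g ((chartAt A x₀).symm y)) := by
    rw [contDiff_iff_contDiffAt]
    intro y
    by_cases hy : y ∈ tsupport χ
    · exact hχ.contDiffAt.mul ((contDiffOn_comp_chart_symm hg).contDiffAt
        (hOo.mem_nhds (hχs hy)))
    · have h0 : χ =ᶠ[𝓝 y] 0 := notMem_tsupport_iff_eventuallyEq.1 hy
      refine (contDiffAt_const (c := (0 : ℝ))).congr_of_eventuallyEq ?_
      filter_upwards [h0] with z hz
      simp [hz]
  have hχ' : ContMDiffOn 𝓘(ℝ, A) 𝓘(ℝ, ℝ) ∞ (fun y => χ (chartAt A x₀ y)) W.1 :=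
    hχ.contMDiff.comp_contMDiffOn hchart
  have hχg' : ContMDiffOn 𝓘(ℝ, A) 𝓘(ℝ, ℝ) ∞
      (fun y => χ (chartAt A x₀ y) * g ((chartAt A x₀).symm (chartAt A x₀ y))) W.1 :=
    hχg.contMDiff.comp_contMDiffOn hchart
  have h1 := ext0_der_comp_chart hU hX hz W hχ hχ' hx
  have h2 := ext0_der_comp_chart hU hX hz W hχg hχg' hx
  have key : fn (V := V) (E := E) W.1 _ hχg' = fn W.1 _ hχ' * fn W.1 g hg := by
    refine SuperFun.ext_ext0 fun y hy => ?_
    rw [ext0_mul, ext0_fn hy, ext0_fn hy, ext0_fn hy, ← map_mul,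
      (chartAt A x₀).left_inv (hsrc hy)]
  have hs : sgn c 0 = 1 := by simp [sgn]
  rw [key, hX.2.2 W 0 _ _ (fn_hasParity hχ'), hs, one_smul, ext0_add, ext0_mul, h1, zero_mul,
    zero_add, ext0_mul, ext0_fn hx, ← hy₀, hχ1, map_one, one_mul] at h2
  rw [h2]
  simp [SuperFun.ext0_of_mem _ hx]
  rfl

lemma der_eq_zero : X = 0 := by
  funext W
  ext1 f
  rw [eq_sum_fn_mul_cst (trivializationAt V E x₀) (subset_baseSet_of_le_dom (W.2.trans hU)) f,
    map_sum]
  refine Finset.sum_eq_zero fun I _ => ?_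
  rw [der_mul_of_apply_eq_zero hX W _ (der_cst_eq_zero hU hX hz W _),
    der_fn_eq_zero hU hX hz W, zero_mul]

end Vanishing

lemma mulVF_mem {U : Opens M} {c a : ZMod 2} {f : SuperFun A V E U} {X : SuperVF A V E U}
    (hf : HasParity c f) (hX : VFParity a X) : VFParity (c + a) (mulVF f X) :=
  mul_mem_superDer hf hX

lemma VFParity.act_hasParity {U W : Opens M} {a b : ZMod 2} {X : SuperVF A V E U}
    (hX : VFParity a X) (h : W ≤ U) {f : SuperFun A V E W} (hf : HasParity b f) :
    HasParity (a + b) (act X h f) := hX.2.1 ⟨W, h⟩ b f hf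

/-- The expansion of a homogeneous super vector field in coordinates. -/
lemma eq_sum_mulVF_fr {x₀ : M} {U : Opens M} (hU : U ≤ dom A V E x₀) {c : ZMod 2}
    {X : SuperVF A V E U} (hX : VFParity c X) :
    X = ∑ γ, mulVF (act X le_rfl (zc x₀ hU γ)) (fr x₀ hU γ) := by
  rw [← sub_eq_zero]
  apply Subtype.ext
  -- The difference of the two sides is a superderivation of parity `c`, so it suffices that it
  -- vanishes on the coordinates, which follows from duality.
  refine der_eq_zero hU (c := c) (Submodule.sub_mem _ hX ?_) fun δ => ?_
  · rw [Submodule.coe_sum]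
    refine Submodule.sum_mem _ fun γ _ => ?_
    have h := mulVF_mem (hX.act_hasParity le_rfl (zc_hasParity hU γ)) (fr_parity hU γ)
    have h2 : c + par γ + par γ = c := by
      rcases zmod_two_cases c with rfl | rfl <;> rcases zmod_two_cases (par γ) with h | h <;>
        rw [h] <;> decide
    rw [h2] at h
    exact h
  · have h1 : ∀ γ, (mulVF (act X le_rfl (zc x₀ hU γ)) (fr x₀ hU γ)).1 ⟨U, le_rfl⟩ (zc x₀ hU δ) =
        if γ = δ then act X le_rfl (zc x₀ hU γ) else 0 := fun γ => by
      change act X le_rfl (zc x₀ hU γ) * act (fr x₀ hU γ) le_rfl (zc x₀ hU δ) = _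
      rw [act_fr_zc]
      split_ifs <;> simp
    rw [AddSubgroupClass.coe_sub, Submodule.coe_sum, Pi.sub_apply, LinearMap.sub_apply,
      Finset.sum_apply, LinearMap.sum_apply]
    simp only [h1]
    rw [Finset.sum_ite_eq']
    simp [act]

lemma act_sum {ι : Type*} {U W : Opens M} (h : W ≤ U) (s : Finset ι) (X : ι → SuperVF A V E U)
    (f : SuperFun A V E W) : act (∑ i ∈ s, X i) h f = ∑ i ∈ s, act (X i) h f := by
  rw [act, Submodule.coe_sum, Finset.sum_apply, LinearMap.sum_apply]
  rfl

lemma act_add {U W : Opens M} (h : W ≤ U) (X Y : SuperVF A V E U)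
    (f : SuperFun A V E W) : act (X + Y) h f = act X h f + act Y h f := rfl

lemma act_smul {U W : Opens M} (h : W ≤ U) (c : ℝ) (X : SuperVF A V E U)
    (f : SuperFun A V E W) : act (c • X) h f = c • act X h f := rfl

lemma act_mulVF {U W : Opens M} (h : W ≤ U) (g : SuperFun A V E U) (X : SuperVF A V E U)
    (f : SuperFun A V E W) : act (mulVF g X) h f = res h g * act X h f := rfl

lemma act_res {U W W' : Opens M} (h : W ≤ U) (h' : W' ≤ W) (X : SuperVF A V E U)
    (f : SuperFun A V E W) : act X (h'.trans h) (res h' f) = res h' (act X h f) := by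
  obtain ⟨Y, hY, Z, hZ, e⟩ := Submodule.mem_sup.1 X.2
  simp only [act]
  rw [← e, Pi.add_apply, Pi.add_apply, LinearMap.add_apply, LinearMap.add_apply, map_add,
    hY.1 ⟨W, h⟩ ⟨W', h'.trans h⟩ h' f, hZ.1 ⟨W, h⟩ ⟨W', h'.trans h⟩ h' f]

/-- The action of a homogeneous super vector field in coordinates. -/
lemma act_eq_sum {x₀ : M} {U W : Opens M} (hU : U ≤ dom A V E x₀) (h : W ≤ U) {c : ZMod 2}
    {X : SuperVF A V E U} (hX : VFParity c X) (f : SuperFun A V E W) :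
    act X h f = ∑ γ, res h (act X le_rfl (zc x₀ hU γ)) * act (fr x₀ hU γ) h f := by
  conv_lhs => rw [eq_sum_mulVF_fr hU hX]
  rw [act_sum]
  rfl

end Derivations

/-! ### Fibrewise affine functions and coordinates on the total space -/

section Psi

variable {A : Type*} [NormedAddCommGroup A] [NormedSpace ℝ A] [FiniteDimensional ℝ A]
  {V : Type*} [NormedAddCommGroup V] [NormedSpace ℝ V] [FiniteDimensional ℝ V]
  {M : Type*} [TopologicalSpace M] [ChartedSpace A M] [IsManifold 𝓘(ℝ, A) ∞ M]
  {E : M → Type*} [∀ x, AddCommGroup (E x)] [∀ x, Module ℝ (E x)]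
  [∀ x, TopologicalSpace (E x)] [TopologicalSpace (TotalSpace V E)]
  [FiberBundle V E] [VectorBundle ℝ V E] [ContMDiffVectorBundle ∞ V E 𝓘(ℝ, A)]

lemma psi_eq {U : Opens M} (f : SuperFun A V E U) (p : TotalSpace V E) :
    psi f p = body (f.ext0 p.proj) + linPart (f.ext0 p.proj) p.2 := by
  by_cases h : p.proj ∈ U
  · simp [psi, SuperFun.ext0, h]
  · simp [psi, SuperFun.ext0, h]

lemma psi_loc (e : Trivialization V (π V E)) [e.IsLinear ℝ] {U : Opens M}
    (f : SuperFun A V E U) {p : TotalSpace V E} (hp : p.proj ∈ e.baseSet) :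
    psi f p = body (loc e f p.proj) + linPart (loc e f p.proj) (e p).2 := by
  rw [psi_eq, body_loc, ← linPart_loc e f hp, e.continuousLinearMapAt_apply_of_mem (R := ℝ) hp]

lemma psi_mul {U : Opens M} (f g : SuperFun A V E U) (p : TotalSpace V E) :
    psi (f * g) p = body (f.ext0 p.proj) * body (g.ext0 p.proj) +
      (body (f.ext0 p.proj) * linPart (g.ext0 p.proj) p.2 +
        body (g.ext0 p.proj) * linPart (f.ext0 p.proj) p.2) := by
  rw [psi_eq, ext0_mul, map_mul, linPart_mul]
  rfl

lemma psi_add {U : Opens M} (f g : SuperFun A V E U) (p : TotalSpace V E) :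
    psi (f + g) p = psi f p + psi g p := by
  simp only [psi_eq, ext0_add, map_add, LinearMap.add_apply]
  ring

lemma psi_smul {U : Opens M} (c : ℝ) (f : SuperFun A V E U) (p : TotalSpace V E) :
    psi (c • f) p = c * psi f p := by
  simp only [psi_eq, ext0_smul, map_smul, LinearMap.smul_apply, smul_eq_mul]
  ring

lemma psi_sum {U : Opens M} {ι : Type*} (s : Finset ι) (f : ι → SuperFun A V E U)
    (p : TotalSpace V E) : psi (∑ i ∈ s, f i) p = ∑ i ∈ s, psi (f i) p := by
  simp only [psi_eq, ext0_sum, map_sum, LinearMap.sum_apply, Finset.sum_add_distrib]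

lemma psi_res {U U' : Opens M} (h : U' ≤ U) (f : SuperFun A V E U) {p : TotalSpace V E}
    (hp : p.proj ∈ U') : psi (res h f) p = psi f p := by
  rw [psi_eq, psi_eq, ext0_res h f hp]

lemma body_ext0_of_odd {U : Opens M} {f : SuperFun A V E U} (hf : HasParity 1 f) (x : M) :
    body (f.ext0 x) = 0 := by
  by_cases hx : x ∈ U
  · exact body_of_odd (hasParity_iff.1 hf x hx)
  · simp [SuperFun.ext0, hx]

lemma linPart_ext0_of_even {U : Opens M} {f : SuperFun A V E U} (hf : HasParity 0 f) (x : M) :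
    linPart (f.ext0 x) = 0 := by
  by_cases hx : x ∈ U
  · exact linPart_of_even (hasParity_iff.1 hf x hx)
  · simp [SuperFun.ext0, hx]

lemma psi_even {U : Opens M} {f : SuperFun A V E U} (hf : HasParity 0 f) (p : TotalSpace V E) :
    psi f p = body (f.ext0 p.proj) := by
  rw [psi_eq, linPart_ext0_of_even hf, LinearMap.zero_apply, add_zero]

lemma psi_odd {U : Opens M} {f : SuperFun A V E U} (hf : HasParity 1 f) (p : TotalSpace V E) :
    psi f p = linPart (f.ext0 p.proj) p.2 := by
  rw [psi_eq, body_ext0_of_odd hf, zero_add]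

/-- ψ is not multiplicative in general, since products of odd parts disappear in degree two; an even
factor has no degree-one part and so causes no loss. -/
lemma psi_mul_even {U : Opens M} {f : SuperFun A V E U} (hf : HasParity 0 f)
    (g : SuperFun A V E U) (p : TotalSpace V E) : psi (f * g) p = psi f p * psi g p := by
  rw [psi_mul, psi_even hf, psi_eq g, linPart_ext0_of_even hf]
  simp
  ring

/-- An odd factor has no body, so the degree-one part of the other factor contributes only in degree
two and is lost. Only its body survives. -/
lemma psi_mul_odd {U : Opens M} {f : SuperFun A V E U} (hf : HasParity 1 f)
    (g : SuperFun A V E U) (p : TotalSpace V E) :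
    psi (f * g) p = psi f p * body (g.ext0 p.proj) := by
  rw [psi_mul, psi_odd hf, body_ext0_of_odd hf]
  ring

lemma triv_snd_smooth (e : Trivialization V (π V E)) [MemTrivializationAtlas e] :
    ContMDiffOn (𝓘(ℝ, A).prod 𝓘(ℝ, V)) 𝓘(ℝ, V) ∞ (fun p : TotalSpace V E => (e p).2)
      {p | p.proj ∈ e.baseSet} := by
  refine (contMDiff_snd.comp_contMDiffOn (e.contMDiffOn (IB := 𝓘(ℝ, A)) (n := ∞))).mono ?_
  intro p hp
  rw [e.source_eq]
  exact hp

lemma LSmoothOn.total {S : Set M} {w : M → LDual V} (h : LSmoothOn A w S)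
    (l : Module.Dual ℝ (LDual V)) :
    ContMDiffOn (𝓘(ℝ, A).prod 𝓘(ℝ, V)) 𝓘(ℝ, ℝ) ∞ (fun p : TotalSpace V E => l (w p.proj))
      {p | p.proj ∈ S} :=
  (h l).comp (contMDiff_proj E).contMDiffOn fun _ hp => hp

lemma psi_smooth {U : Opens M} (f : SuperFun A V E U) :
    ContMDiffOn (𝓘(ℝ, A).prod 𝓘(ℝ, V)) 𝓘(ℝ, ℝ) ∞ (psi f) {p | p.proj ∈ U} := by
  intro p hp
  let e := trivializationAt V E p.proj
  have hpe : p.proj ∈ e.baseSet := FiberBundle.mem_baseSet_trivializationAt' p.proj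
  let b := Module.finBasis ℝ V
  have h1 : ContMDiffOn (𝓘(ℝ, A).prod 𝓘(ℝ, V)) 𝓘(ℝ, ℝ) ∞ (fun p : TotalSpace V E =>
      body (loc e f p.proj) + ∑ a, b.coord a (e p).2 * linPart (loc e f p.proj) (b a))
      {p | p.proj ∈ (U : Set M) ∩ e.baseSet} := by
    refine ((loc_smooth e f).total body.toLinearMap).add (contMDiffOn_finsetSum fun a _ => ?_)
    refine ContMDiffOn.mul ?_
      ((loc_smooth e f).total ((LinearMap.applyₗ (b a)).comp linPart))
    exact (LinearMap.toContinuousLinearMap (b.coord a)).contDiff.contMDiff.comp_contMDiffOn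
      ((triv_snd_smooth e).mono fun q hq => hq.2)
  have hopen : {p : TotalSpace V E | p.proj ∈ (U : Set M) ∩ e.baseSet} ∈ 𝓝 p :=
    ((U.2.inter e.open_baseSet).preimage (FiberBundle.continuous_proj V E)).mem_nhds ⟨hp, hpe⟩
  refine ((h1.congr fun q hq => ?_).contMDiffAt hopen).contMDiffWithinAt
  rw [psi_loc e f hq.2]
  congr 1
  conv_lhs => rw [← b.sum_repr (e q).2, map_sum]
  simp only [map_smul, smul_eq_mul]
  rfl

variable (A V) in
/-- The basis of `A × V` associated with the bases of `A` and `V`. -/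
def bT : Module.Basis (Idx A V) ℝ (A × V) := (Module.finBasis ℝ A).prod (Module.finBasis ℝ V)

variable (A V E) in
/-- The trivialization of the tangent bundle of the total space given by coordinates. -/
def eT (x₀ : M) : Trivialization (A × V)
    (π (A × V) (TangentSpace (𝓘(ℝ, A).prod 𝓘(ℝ, V)) : TotalSpace V E → Type _)) :=
  trivializationAt (A × V) (TangentSpace (𝓘(ℝ, A).prod 𝓘(ℝ, V)) : TotalSpace V E → Type _)
    (⟨x₀, 0⟩ : TotalSpace V E)

instance (x₀ : M) : MemTrivializationAtlas (eT A V E x₀) := by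
  unfold eT; infer_instance

lemma mem_chart_source_iff_dom {x₀ : M} {p : TotalSpace V E} :
    p ∈ (chartAt (ModelProd A V) (⟨x₀, 0⟩ : TotalSpace V E)).source ↔
      p.proj ∈ dom A V E x₀ := by
  rw [FiberBundle.chartedSpace_chartAt]
  simp only [mfld_simps, Trivialization.mem_source]
  constructor
  · rintro ⟨h1, h2⟩
    rw [Trivialization.coe_fst' _ h1] at h2
    exact ⟨h2, h1⟩
  · rintro ⟨h1, h2⟩
    refine ⟨h2, ?_⟩
    rwa [Trivialization.coe_fst' _ h2]

lemma mem_eT_baseSet {x₀ : M} {p : TotalSpace V E} :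
    p ∈ (eT A V E x₀).baseSet ↔ p.proj ∈ dom A V E x₀ := mem_chart_source_iff_dom

/-- The coordinate vector fields on the total space. -/
def tf (x₀ : M) (γ : Idx A V) : TotalVF A V E := (eT A V E x₀).localFrame (bT A V) γ

lemma tf_smooth {x₀ : M} (γ : Idx A V) :
    SmoothVFOn (A := A) (V := V) (E := E) (tf x₀ γ) {p | p.proj ∈ dom A V E x₀} :=
  ((eT A V E x₀).contMDiffOn_localFrame_baseSet (I := 𝓘(ℝ, A).prod 𝓘(ℝ, V)) ∞ (bT A V) γ).mono
    fun _ hp => mem_eT_baseSet.2 hp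

lemma psi_mdifferentiableAt {U : Opens M} (f : SuperFun A V E U) {p : TotalSpace V E}
    (hp : p.proj ∈ U) : MDifferentiableAt (𝓘(ℝ, A).prod 𝓘(ℝ, V)) 𝓘(ℝ, ℝ) (psi f) p :=
  ((psi_smooth f).contMDiffAt ((U.2.preimage (FiberBundle.continuous_proj V E)).mem_nhds hp)
    ).mdifferentiableAt (by simp)

/-- The inverse of the coordinate chart of the total space. -/
def cinv (x₀ : M) (z : A × V) : TotalSpace V E :=
  (extChartAt (𝓘(ℝ, A).prod 𝓘(ℝ, V)) (⟨x₀, 0⟩ : TotalSpace V E)).symm z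

lemma cinv_apply {x₀ : M} {p : TotalSpace V E} (hp : p.proj ∈ dom A V E x₀) :
    cinv x₀ (chartAt A x₀ p.proj, (trivializationAt V E x₀ p).2) = p := by
  have h := (extChartAt (𝓘(ℝ, A).prod 𝓘(ℝ, V)) (⟨x₀, 0⟩ : TotalSpace V E)).left_inv
    (x := p) (by rw [extChartAt_source]; exact mem_chart_source_iff_dom.2 hp)
  rw [FiberBundle.extChartAt] at h
  rw [cinv, FiberBundle.extChartAt]
  refine Eq.trans ?_ h
  congr 1
  simp only [mfld_simps]
  rw [Trivialization.coe_fst' _ hp.2]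

lemma tf_apply {x₀ : M} {p : TotalSpace V E} (hp : p.proj ∈ dom A V E x₀) (γ : Idx A V) :
    tf x₀ γ p = (eT A V E x₀).symmL ℝ p (bT A V γ) := by
  have hb : p ∈ (eT A V E x₀).baseSet := mem_eT_baseSet.2 hp
  rw [tf, Trivialization.localFrame_apply_of_mem_baseSet _ _ hb, (eT A V E x₀).symmL_apply hb]
  rfl

lemma extChartAt_total_apply {x₀ : M} {p : TotalSpace V E} (hp : p.proj ∈ dom A V E x₀) :
    extChartAt (𝓘(ℝ, A).prod 𝓘(ℝ, V)) (⟨x₀, 0⟩ : TotalSpace V E) p =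
      (chartAt A x₀ p.proj, (trivializationAt V E x₀ p).2) := by
  rw [FiberBundle.extChartAt]
  simp only [mfld_simps]
  rw [Trivialization.coe_fst' _ hp.2]

/-- The frame `tf` comes from the chart at the zero vector over `x₀`, so its members are the images
of basis vectors under the derivative of the inverse chart. Derivatives along them become ordinary
partial derivatives. -/
lemma mvfderiv_tf {x₀ : M} {g : TotalSpace V E → ℝ}
    {p : TotalSpace V E} (hp : p.proj ∈ dom A V E x₀)
    (hg : MDifferentiableAt (𝓘(ℝ, A).prod 𝓘(ℝ, V)) 𝓘(ℝ, ℝ) g p) (γ : Idx A V) :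
    DifferentiableAt ℝ (fun z => g (cinv x₀ z))
      (chartAt A x₀ p.proj, (trivializationAt V E x₀ p).2) ∧
    mvfderiv (𝓘(ℝ, A).prod 𝓘(ℝ, V)) g p (tf x₀ γ p) =
      fderiv ℝ (fun z => g (cinv x₀ z))
        (chartAt A x₀ p.proj, (trivializationAt V E x₀ p).2) (bT A V γ) := by
  have hps := mem_chart_source_iff_dom.2 hp
  have hc := extChartAt_total_apply hp
  have hmem : extChartAt (𝓘(ℝ, A).prod 𝓘(ℝ, V)) (⟨x₀, 0⟩ : TotalSpace V E) p ∈
      (extChartAt (𝓘(ℝ, A).prod 𝓘(ℝ, V)) (⟨x₀, 0⟩ : TotalSpace V E)).target :=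
    (extChartAt _ _).map_source (by rwa [extChartAt_source])
  have hd := mdifferentiableWithinAt_extChartAt_symm hmem
  have hr : range (𝓘(ℝ, A).prod 𝓘(ℝ, V)) = univ := by simp
  have hy : (extChartAt (𝓘(ℝ, A).prod 𝓘(ℝ, V)) (⟨x₀, 0⟩ : TotalSpace V E)).symm
      (extChartAt (𝓘(ℝ, A).prod 𝓘(ℝ, V)) (⟨x₀, 0⟩ : TotalSpace V E) p) = p :=
    (extChartAt _ _).left_inv (by rwa [extChartAt_source])
  have h1 := mvfderiv_comp_mfderivWithin_of_eq hg hd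
    (by rw [hr]; exact uniqueMDiffWithinAt_univ _) hy
  have h2 : tf x₀ γ p = mfderivWithin 𝓘(ℝ, A × V) (𝓘(ℝ, A).prod 𝓘(ℝ, V))
      (extChartAt (𝓘(ℝ, A).prod 𝓘(ℝ, V)) (⟨x₀, 0⟩ : TotalSpace V E)).symm
      (range (𝓘(ℝ, A).prod 𝓘(ℝ, V)))
      (extChartAt (𝓘(ℝ, A).prod 𝓘(ℝ, V)) (⟨x₀, 0⟩ : TotalSpace V E) p) (bT A V γ) := by
    rw [tf_apply hp]
    exact DFunLike.congr_fun (TangentBundle.symmL_trivializationAt hps) _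
  rw [hc] at h1 h2
  rw [hr] at h1 h2
  constructor
  · rw [hr] at hd
    have h3 := MDifferentiableAt.comp_of_eq _ hg (hd.mdifferentiableAt Filter.univ_mem) hy
    rw [hc] at h3
    exact h3.differentiableAt
  · rw [h2]
    have h4 := DFunLike.congr_fun h1 (bT A V γ)
    refine h4.symm.trans ?_
    rw [mvfderivWithin_univ]
    change mvfderiv 𝓘(ℝ, A × V) (fun z => g (cinv x₀ z)) _ _ = _
    rw [mvfderiv, mfderiv_eq_fderiv]
    rfl

end Psi

/-! ### Super vector fields against tangent vectors of the total space -/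

section Coordinates

variable {A : Type*} [NormedAddCommGroup A] [NormedSpace ℝ A] [FiniteDimensional ℝ A]
  {V : Type*} [NormedAddCommGroup V] [NormedSpace ℝ V] [FiniteDimensional ℝ V]
  {M : Type*} [TopologicalSpace M] [ChartedSpace A M] [IsManifold 𝓘(ℝ, A) ∞ M]
  {E : M → Type*} [∀ x, AddCommGroup (E x)] [∀ x, Module ℝ (E x)]
  [∀ x, TopologicalSpace (E x)] [TopologicalSpace (TotalSpace V E)]
  [FiberBundle V E] [VectorBundle ℝ V E] [ContMDiffVectorBundle ∞ V E 𝓘(ℝ, A)]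

lemma cinv_eq {x₀ : M} {z : A × V} (h1 : z.1 ∈ (chartAt A x₀).target)
    (h2 : (chartAt A x₀).symm z.1 ∈ (trivializationAt V E x₀).baseSet) :
    cinv (E := E) x₀ z =
      ⟨(chartAt A x₀).symm z.1, (trivializationAt V E x₀).symmL ℝ _ z.2⟩ := by
  have h := cinv_apply (A := A) (p := (⟨(chartAt A x₀).symm z.1,
    (trivializationAt V E x₀).symmL ℝ _ z.2⟩ : TotalSpace V E)) (x₀ := x₀)
    ⟨(chartAt A x₀).map_target h1, h2⟩
  rw [← h]
  congr 1
  refine Prod.ext ((chartAt A x₀).right_inv h1).symm ?_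
  change z.2 = (trivializationAt V E x₀ ⟨_, _⟩).2
  rw [← (trivializationAt V E x₀).continuousLinearMapAt_apply_of_mem (R := ℝ) h2,
    (trivializationAt V E x₀).continuousLinearMapAt_symmL h2]

lemma psi_cinv {x₀ : M} {U : Opens M} (f : SuperFun A V E U) {z : A × V}
    (h1 : z.1 ∈ (chartAt A x₀).target)
    (h2 : (chartAt A x₀).symm z.1 ∈ (trivializationAt V E x₀).baseSet) :
    psi f (cinv x₀ z) =
      body (loc (trivializationAt V E x₀) f ((chartAt A x₀).symm z.1)) +
        linPart (loc (trivializationAt V E x₀) f ((chartAt A x₀).symm z.1)) z.2 := by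
  rw [cinv_eq h1 h2, psi_loc (trivializationAt V E x₀) f h2]
  congr 2
  rw [← (trivializationAt V E x₀).continuousLinearMapAt_apply_of_mem (R := ℝ) h2,
    (trivializationAt V E x₀).continuousLinearMapAt_symmL h2]

/-- The linear functional on `Λ V*` given by evaluating the components of degree at most one
at `y`. -/
def evalAffine (y : V) : Module.Dual ℝ (LDual V) :=
  body.toLinearMap + (LinearMap.applyₗ y).comp linPart

lemma evalAffine_apply (y : V) (u : LDual V) : evalAffine y u = body u + linPart u y := rfl

/-- In coordinates ψ(f) is (x, y) ↦ f₀(x) + f₁(x)(y), so an even partial derivative with y fixed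
acts on the coefficients, exactly as the even coordinate field acts on f. -/
lemma mvfderiv_psi_tf_inl {x₀ : M} {U W : Opens M} (hU : U ≤ dom A V E x₀) (h : W ≤ U)
    (f : SuperFun A V E W) {p : TotalSpace V E} (hp : p.proj ∈ W) (i) :
    mvfderiv (𝓘(ℝ, A).prod 𝓘(ℝ, V)) (psi f) p (tf x₀ (.inl i) p) =
      psi (act (fr x₀ hU (.inl i)) h f) p := by
  have hW : W ≤ dom A V E x₀ := h.trans hU
  have hpe := (hW hp).2
  have hsm := loc_smooth_of_le_dom hW f
  obtain ⟨hd, he⟩ := mvfderiv_tf (hW hp) (psi_mdifferentiableAt f hp) (.inl i)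
  set y := (trivializationAt V E x₀ p).2 with hy
  rw [he, psi_loc _ _ hpe, loc_act_fr_inl hU h i f hp, ← hy, ← evalAffine_apply,
    apply_pdL hsm W.2 (subset_source_of_le_dom hW) hp, pd]
  have hc : HasFDerivAt (fun a : A => (a, y)) (ContinuousLinearMap.inl ℝ A V)
      (chartAt A x₀ p.proj) := hasFDerivAt_prodMk_left _ _
  have h1 := HasFDerivAt.comp (chartAt A x₀ p.proj) (f := fun a : A => (a, y)) hd.hasFDerivAt hc
  have h2 : (fun z => psi f (cinv x₀ z)) ∘ (fun a : A => (a, y)) =ᶠ[𝓝 (chartAt A x₀ p.proj)]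
      (fun x => evalAffine y (loc (trivializationAt V E x₀) f x)) ∘ (chartAt A x₀).symm := by
    have hO := (chartAt A x₀).isOpen_inter_preimage_symm (trivializationAt V E x₀).open_baseSet
    filter_upwards [hO.mem_nhds ⟨(chartAt A x₀).map_source (hW hp).1, by
      simpa [(chartAt A x₀).left_inv (hW hp).1] using hpe⟩] with a ha
    exact psi_cinv f ha.1 ha.2
  rw [← h2.fderiv_eq, h1.fderiv]
  simp [bT]

/-- Along the fibre ψ(f) is affine with linear part f₁, so its derivative is f₁ on the basis vector,
the degree-zero part of the odd derivative of f. Only the body appears because the coordinate field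
is odd. -/
lemma mvfderiv_psi_tf_inr {x₀ : M} {U W : Opens M} (hU : U ≤ dom A V E x₀) (h : W ≤ U)
    (f : SuperFun A V E W) {p : TotalSpace V E} (hp : p.proj ∈ W) (a) :
    mvfderiv (𝓘(ℝ, A).prod 𝓘(ℝ, V)) (psi f) p (tf x₀ (.inr a) p) =
      body ((act (fr x₀ hU (.inr a)) h f).ext0 p.proj) := by
  have hW : W ≤ dom A V E x₀ := h.trans hU
  have hpe := (hW hp).2
  obtain ⟨hd, he⟩ := mvfderiv_tf (hW hp) (psi_mdifferentiableAt f hp) (.inr a)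
  set y := (trivializationAt V E x₀ p).2 with hy
  rw [he, ← body_loc (trivializationAt V E x₀), loc_act_fr_inr hU h a f hp, body_contr]
  have hc : HasFDerivAt (fun v : V => (chartAt A x₀ p.proj, v)) (ContinuousLinearMap.inr ℝ A V)
      y := hasFDerivAt_prodMk_right _ _
  have h1 := HasFDerivAt.comp y (f := fun v : V => (chartAt A x₀ p.proj, v)) hd.hasFDerivAt hc
  have h2 : (fun z => psi f (cinv x₀ z)) ∘ (fun v : V => (chartAt A x₀ p.proj, v)) =
      fun v => body (loc (trivializationAt V E x₀) f p.proj) +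
        LinearMap.toContinuousLinearMap (linPart (loc (trivializationAt V E x₀) f p.proj)) v := by
    funext v
    have hl := (chartAt A x₀).left_inv (hW hp).1
    have := psi_cinv f (z := (chartAt A x₀ p.proj, v)) ((chartAt A x₀).map_source (hW hp).1)
      (by simpa [hl] using hpe)
    simpa [hl] using this
  rw [h2] at h1
  have h3 := h1.unique ((ContinuousLinearMap.hasFDerivAt _).const_add _)
  have h4 := DFunLike.congr_fun h3 (Module.finBasis ℝ V a)
  simpa [bT] using h4

lemma psi_one (U : Opens M) {p : TotalSpace V E} (hp : p.proj ∈ U) :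
    psi (1 : SuperFun A V E U) p = 1 := by
  have : (1 : SuperFun A V E U).ext0 p.proj = 1 := SuperFun.ext0_of_mem _ hp
  rw [psi_eq, this, map_one, linPart_one]
  simp

lemma psi_zero (U : Opens M) (p : TotalSpace V E) :
    psi (0 : SuperFun A V E U) p = 0 := by
  simpa using psi_smul (0 : ℝ) (0 : SuperFun A V E U) p

lemma mvfderiv_psi_zc_tf {x₀ : M} {U : Opens M} (hU : U ≤ dom A V E x₀)
    {p : TotalSpace V E} (hp : p.proj ∈ U) (γ δ : Idx A V) :
    mvfderiv (𝓘(ℝ, A).prod 𝓘(ℝ, V)) (psi (zc x₀ hU δ)) p (tf x₀ γ p) =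
      if γ = δ then 1 else 0 := by
  rcases γ with i | a
  · rw [mvfderiv_psi_tf_inl hU le_rfl _ hp, act_fr_zc]
    split_ifs
    · exact psi_one U hp
    · exact psi_zero U p
  · rw [mvfderiv_psi_tf_inr hU le_rfl _ hp, act_fr_zc]
    split_ifs
    · have : (1 : SuperFun A V E U).ext0 p.proj = 1 := SuperFun.ext0_of_mem _ hp
      rw [this, map_one]
    · have : (0 : SuperFun A V E U).ext0 p.proj = 0 := SuperFun.ext0_of_mem _ hp
      rw [this, map_zero]

/-- The differentials of the ψ(z^γ) are dual to the frame `tf`. Smoothness and differentiability of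
vector fields can hence be tested by pairing with these differentials. -/
lemma localFrameCoeff_eq {x₀ : M} {U : Opens M} (hU : U ≤ dom A V E x₀)
    {p : TotalSpace V E} (hp : p.proj ∈ U) (γ : Idx A V)
    (w : TangentSpace (𝓘(ℝ, A).prod 𝓘(ℝ, V)) p) :
    (eT A V E x₀).localFrameCoeff (𝓘(ℝ, A).prod 𝓘(ℝ, V)) (bT A V) γ p w =
      mvfderiv (𝓘(ℝ, A).prod 𝓘(ℝ, V)) (psi (zc x₀ hU γ)) p w := by
  have h := (eT A V E x₀).eq_sum_localFrameCoeff_smul (I := 𝓘(ℝ, A).prod 𝓘(ℝ, V))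
    (b := bT A V) (s := fun q => (eT A V E x₀).symmL ℝ q
      ((eT A V E x₀).continuousLinearMapAt ℝ p w)) (mem_eT_baseSet.2 (hU hp))
  simp only [(eT A V E x₀).symmL_continuousLinearMapAt (mem_eT_baseSet.2 (hU hp))] at h
  set c : Idx A V → ℝ := fun i => (eT A V E x₀).localFrameCoeff (𝓘(ℝ, A).prod 𝓘(ℝ, V))
    (bT A V) i p w with hc
  have h' : w = ∑ γ, c γ • tf x₀ γ p := h
  symm
  conv_lhs => rw [h', map_sum]
  simp only [map_smul, mvfderiv_psi_zc_tf hU hp, smul_eq_mul, mul_ite, mul_one, mul_zero]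
  simp [hc]

lemma tangent_eq_sum {x₀ : M} {U : Opens M} (hU : U ≤ dom A V E x₀)
    {p : TotalSpace V E} (hp : p.proj ∈ U)
    (w : TangentSpace (𝓘(ℝ, A).prod 𝓘(ℝ, V)) p) :
    w = ∑ γ, mvfderiv (𝓘(ℝ, A).prod 𝓘(ℝ, V)) (psi (zc x₀ hU γ)) p w • tf x₀ γ p := by
  simp only [← localFrameCoeff_eq hU hp]
  have h := (eT A V E x₀).eq_sum_localFrameCoeff_smul (I := 𝓘(ℝ, A).prod 𝓘(ℝ, V))
    (b := bT A V) (s := fun q => (eT A V E x₀).symmL ℝ q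
      ((eT A V E x₀).continuousLinearMapAt ℝ p w)) (mem_eT_baseSet.2 (hU hp))
  simp only [(eT A V E x₀).symmL_continuousLinearMapAt (mem_eT_baseSet.2 (hU hp))] at h
  exact h

lemma smoothVFOn_iff {x₀ : M} {U : Opens M} (hU : U ≤ dom A V E x₀)
    {S : Set (TotalSpace V E)} (hS : IsOpen S) (hSU : ∀ p ∈ S, p.proj ∈ U) (X : TotalVF A V E) :
    SmoothVFOn X S ↔ ∀ γ, ContMDiffOn (𝓘(ℝ, A).prod 𝓘(ℝ, V)) 𝓘(ℝ, ℝ) ∞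
      (fun p => mvfderiv (𝓘(ℝ, A).prod 𝓘(ℝ, V)) (psi (zc x₀ hU γ)) p (X p)) S := by
  rw [SmoothVFOn]
  refine (contMDiffOn_iff_localFrameCoeff (e := eT A V E x₀) (bT A V) hS
    (fun p hp => mem_eT_baseSet.2 (hU (hSU p hp)))).trans (forall_congr' fun γ => ?_)
  exact contMDiffOn_congr fun p hp => (localFrameCoeff_eq hU (hSU p hp) γ _)

lemma mdifferentiableAt_iff {x₀ : M} {U : Opens M} (hU : U ≤ dom A V E x₀)
    {p : TotalSpace V E} (hp : p.proj ∈ U) (X : TotalVF A V E) :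
    MDifferentiableAt (𝓘(ℝ, A).prod 𝓘(ℝ, V)) (𝓘(ℝ, A).prod 𝓘(ℝ, V)).tangent
      (fun p => (⟨p, X p⟩ : TangentBundle (𝓘(ℝ, A).prod 𝓘(ℝ, V)) (TotalSpace V E))) p ↔
    ∀ γ, MDifferentiableAt (𝓘(ℝ, A).prod 𝓘(ℝ, V)) 𝓘(ℝ, ℝ)
      (fun p => mvfderiv (𝓘(ℝ, A).prod 𝓘(ℝ, V)) (psi (zc x₀ hU γ)) p (X p)) p := by
  refine (mdifferentiableAt_iff_localFrameCoeff (e := eT A V E x₀) (bT A V)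
    (mem_eT_baseSet.2 (hU hp))).trans (forall_congr' fun γ => ?_)
  refine Filter.EventuallyEq.mdifferentiableAt_iff ?_
  filter_upwards [(U.2.preimage (FiberBundle.continuous_proj V E)).mem_nhds hp] with q hq
  exact localFrameCoeff_eq hU hq γ _

/-- A tangent vector which agrees with an even super vector field on the coordinates agrees
with it on all superfunctions. -/
lemma mvfderiv_psi_eq_of_coord {x₀ : M} {U W : Opens M} (hU : U ≤ dom A V E x₀) (h : W ≤ U)
    {Z : SuperVF A V E U} (hZ : VFParity 0 Z) {p : TotalSpace V E} (hp : p.proj ∈ W)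
    {w : TangentSpace (𝓘(ℝ, A).prod 𝓘(ℝ, V)) p}
    (hw : ∀ γ, mvfderiv (𝓘(ℝ, A).prod 𝓘(ℝ, V)) (psi (zc x₀ hU γ)) p w =
      psi (act Z le_rfl (zc x₀ hU γ)) p) (f : SuperFun A V E W) :
    mvfderiv (𝓘(ℝ, A).prod 𝓘(ℝ, V)) (psi f) p w = psi (act Z h f) p := by
  rw [act_eq_sum hU h hZ, psi_sum]
  conv_lhs => rw [tangent_eq_sum hU (h hp) w, map_sum]
  refine Finset.sum_congr rfl fun γ _ => ?_
  have hpar := hZ.act_hasParity le_rfl (zc_hasParity hU γ)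
  rw [zero_add] at hpar
  rw [map_smul, smul_eq_mul, hw γ, ← psi_res h _ hp]
  -- Evenness of `Z` gives the coefficient Z(z^γ) the parity of γ. An even coefficient keeps ψ of
  -- the derivative and an odd one only its body, which matches the two formulas for derivatives
  -- along the frame.
  rcases γ with i | a
  · rw [psi_mul_even (hpar.res h), mvfderiv_psi_tf_inl hU h f hp]
  · rw [psi_mul_odd (hpar.res h), mvfderiv_psi_tf_inr hU h f hp]

end Coordinates

/-! ### The induced connection in coordinates -/

section LocalConnection

variable {A : Type*} [NormedAddCommGroup A] [NormedSpace ℝ A] [FiniteDimensional ℝ A]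
  {V : Type*} [NormedAddCommGroup V] [NormedSpace ℝ V] [FiniteDimensional ℝ V]
  {M : Type*} [TopologicalSpace M] [ChartedSpace A M] [IsManifold 𝓘(ℝ, A) ∞ M]
  {E : M → Type*} [∀ x, AddCommGroup (E x)] [∀ x, Module ℝ (E x)]
  [∀ x, TopologicalSpace (E x)] [TopologicalSpace (TotalSpace V E)]
  [FiberBundle V E] [VectorBundle ℝ V E] [ContMDiffVectorBundle ∞ V E 𝓘(ℝ, A)]

lemma isOpen_proj_mem (U : Opens M) : IsOpen {p : TotalSpace V E | p.proj ∈ U} :=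
  U.2.preimage (FiberBundle.continuous_proj V E)

lemma SmoothVFOn.mvfderiv_smooth {S : Set (TotalSpace V E)} (hS : IsOpen S) {X : TotalVF A V E}
    (hX : SmoothVFOn X S) {g : TotalSpace V E → ℝ}
    (hg : ContMDiffOn (𝓘(ℝ, A).prod 𝓘(ℝ, V)) 𝓘(ℝ, ℝ) ∞ g S) :
    ContMDiffOn (𝓘(ℝ, A).prod 𝓘(ℝ, V)) 𝓘(ℝ, ℝ) ∞
      (fun p => mvfderiv (𝓘(ℝ, A).prod 𝓘(ℝ, V)) g p (X p)) S := by
  have h1 := (hg.contMDiffOn_tangentMapWithin (m := ∞) (by simp) hS.uniqueMDiffOn).comp hX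
    (fun p hp => hp)
  have h2 := (contMDiff_snd_tangentBundle_modelSpace (n := ∞) ℝ 𝓘(ℝ, ℝ)).comp_contMDiffOn h1
  refine h2.congr fun p hp => ?_
  have : mfderivWithin (𝓘(ℝ, A).prod 𝓘(ℝ, V)) 𝓘(ℝ, ℝ) g S p =
      mfderiv (𝓘(ℝ, A).prod 𝓘(ℝ, V)) 𝓘(ℝ, ℝ) g p := mfderivWithin_of_mem_nhds (hS.mem_nhds hp)
  change _ = mfderivWithin (𝓘(ℝ, A).prod 𝓘(ℝ, V)) 𝓘(ℝ, ℝ) g S p (X p)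
  rw [this]
  rfl

/-- Smoothness of a covariant derivative is formulated for sections of an endomorphism bundle; this
reduces it to smoothness of the values on the coordinate frame. -/
lemma contMDiffOn_hom_of_forall {x₀ : M} {S : Set (TotalSpace V E)} (hS : IsOpen S)
    (hSd : ∀ p ∈ S, p.proj ∈ dom A V E x₀)
    {L : ∀ p : TotalSpace V E, TangentSpace (𝓘(ℝ, A).prod 𝓘(ℝ, V)) p →L[ℝ]
      TangentSpace (𝓘(ℝ, A).prod 𝓘(ℝ, V)) p}
    (hL : ∀ α, SmoothVFOn (fun p => L p (tf x₀ α p)) S) :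
    ContMDiffOn (𝓘(ℝ, A).prod 𝓘(ℝ, V))
      ((𝓘(ℝ, A).prod 𝓘(ℝ, V)).prod 𝓘(ℝ, (A × V) →L[ℝ] (A × V))) ∞
      (fun p => (⟨p, L p⟩ : TotalSpace ((A × V) →L[ℝ] (A × V))
        fun p : TotalSpace V E => TangentSpace (𝓘(ℝ, A).prod 𝓘(ℝ, V)) p →L[ℝ]
          TangentSpace (𝓘(ℝ, A).prod 𝓘(ℝ, V)) p)) S := by
  have hb : S ⊆ (eT A V E x₀).baseSet := fun p hp => mem_eT_baseSet.2 (hSd p hp)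
  refine (((eT A V E x₀).continuousLinearMap (RingHom.id ℝ) (eT A V E x₀)).contMDiffOn_section_iff
    hS (fun p hp => ⟨hb hp, hb hp⟩)).2 ?_
  have h1 : ∀ α, ContMDiffOn (𝓘(ℝ, A).prod 𝓘(ℝ, V)) 𝓘(ℝ, A × V) ∞
      (fun p => (eT A V E x₀ ⟨p, L p (tf x₀ α p)⟩).2) S := fun α =>
    ((eT A V E x₀).contMDiffOn_section_iff hS hb).1 (hL α)
  have h2 : ContMDiffOn (𝓘(ℝ, A).prod 𝓘(ℝ, V)) 𝓘(ℝ, (A × V) →L[ℝ] (A × V)) ∞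
      (fun p => ∑ α, ContinuousLinearMap.smulRightL ℝ (A × V) (A × V)
        (LinearMap.toContinuousLinearMap ((bT A V).coord α))
          (eT A V E x₀ ⟨p, L p (tf x₀ α p)⟩).2) S := by
    refine contMDiffOn_finsetSum fun α _ => ?_
    exact (ContinuousLinearMap.contDiff _).contMDiff.comp_contMDiffOn (h1 α)
  refine h2.congr fun p hp => ?_
  rw [Trivialization.continuousLinearMap_apply]
  refine ContinuousLinearMap.ext fun y => ?_
  rw [sum_apply]
  conv_lhs => rw [← (bT A V).sum_repr y, map_sum]
  refine Finset.sum_congr rfl fun α _ => ?_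
  rw [map_smul]
  congr 1
  rw [tf_apply (hSd p hp), ← (eT A V E x₀).continuousLinearMapAt_apply_of_mem (R := ℝ) (hb hp)]
  rfl

/-- The Christoffel symbols of a connection on the supermanifold. -/
def superChristoffel (C : SuperConnection A V E) {x₀ : M} {U : Opens M} (hU : U ≤ dom A V E x₀)
    (α β γ : Idx A V) : SuperFun A V E U :=
  act (C.nabla U (fr x₀ hU α) (fr x₀ hU β)) le_rfl (zc x₀ hU γ)

lemma resVF_act {U U' W : Opens M} (h : U' ≤ U) (h' : W ≤ U') (X : SuperVF A V E U)
    (f : SuperFun A V E W) : act (resVF h X) h' f = act X (h'.trans h) f := rfl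

lemma superChristoffel_res (C : SuperConnection A V E) {x₀ : M} {U U' : Opens M}
    (hU : U ≤ dom A V E x₀) (h : U' ≤ U) (α β γ : Idx A V) :
    superChristoffel C (h.trans hU) α β γ = res h (superChristoffel C hU α β γ) := by
  rw [superChristoffel, superChristoffel, ← resVF_fr hU h, ← resVF_fr hU h, C.nabla_res,
    ← res_zc hU h, resVF_act]
  exact act_res le_rfl h _ _

/-- The Christoffel symbols of the connection induced on the total space. -/
def christoffel (C : SuperConnection A V E) {x₀ : M} {U : Opens M} (hU : U ≤ dom A V E x₀) :
    Idx A V → Idx A V → Idx A V → TotalSpace V E → ℝ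
  -- The cases record what ψ retains of a product of coefficients with Γ: all of ψ(Γ) if both
  -- coefficients are even, the body of Γ if exactly one is odd, and nothing if both are odd, since
  -- two odd factors already have degree two.
  | .inl i, .inl j, γ => psi (superChristoffel C hU (.inl i) (.inl j) γ)
  | .inl i, .inr b, γ => fun p => body ((superChristoffel C hU (.inl i) (.inr b) γ).ext0 p.proj)
  | .inr a, .inl j, γ => fun p => body ((superChristoffel C hU (.inr a) (.inl j) γ).ext0 p.proj)
  | .inr _, .inr _, _ => fun _ => 0

lemma christoffel_res (C : SuperConnection A V E) {x₀ : M} {U U' : Opens M}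
    (hU : U ≤ dom A V E x₀) (h : U' ≤ U) (α β γ : Idx A V) {p : TotalSpace V E}
    (hp : p.proj ∈ U') : christoffel C (h.trans hU) α β γ p = christoffel C hU α β γ p := by
  rcases α with i | a <;> rcases β with j | b
  · simp only [christoffel, superChristoffel_res C hU h, psi_res h _ hp]
  · simp only [christoffel, superChristoffel_res C hU h, ext0_res h _ hp]
  · simp only [christoffel, superChristoffel_res C hU h, ext0_res h _ hp]
  · rfl

lemma body_ext0_smooth {U : Opens M} (f : SuperFun A V E U) :
    ContMDiffOn (𝓘(ℝ, A).prod 𝓘(ℝ, V)) 𝓘(ℝ, ℝ) ∞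
      (fun p : TotalSpace V E => body (f.ext0 p.proj)) {p | p.proj ∈ U} :=
  (body_smooth f).comp (contMDiff_proj E).contMDiffOn fun _ hp => hp

lemma christoffel_smooth (C : SuperConnection A V E) {x₀ : M} {U : Opens M}
    (hU : U ≤ dom A V E x₀) (α β γ : Idx A V) :
    ContMDiffOn (𝓘(ℝ, A).prod 𝓘(ℝ, V)) 𝓘(ℝ, ℝ) ∞ (christoffel C hU α β γ) {p | p.proj ∈ U} := by
  rcases α with i | a <;> rcases β with j | b
  · exact psi_smooth _
  · exact body_ext0_smooth _
  · exact body_ext0_smooth _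
  · exact contMDiffOn_const

/-- The products of coefficients with the Christoffel symbols. -/
lemma psi_mul_superChristoffel (C : SuperConnection A V E) {x₀ : M} {U : Opens M}
    (hU : U ≤ dom A V E x₀) {α β : Idx A V} (γ : Idx A V) {f g : SuperFun A V E U}
    (hf : HasParity (par α) f) (hg : HasParity (par β) g) (p : TotalSpace V E) :
    psi (sgn (par α) (par β) • (f * (g * superChristoffel C hU α β γ))) p =
      psi f p * psi g p * christoffel C hU α β γ p := by
  rw [psi_smul]
  rcases α with i | a <;> rcases β with j | b
  · rw [psi_mul_even hf, psi_mul_even hg]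
    simp [par, sgn, christoffel, mul_assoc]
  · rw [psi_mul_even hf, psi_mul_odd hg]
    simp [par, sgn, christoffel, mul_assoc]
  · rw [psi_mul_odd hf, ext0_mul, map_mul, psi_even hg]
    simp [par, sgn, christoffel, mul_assoc]
  · rw [psi_mul_odd hf, ext0_mul, map_mul, body_ext0_of_odd hg]
    simp [christoffel]

lemma nabla_sum_right (C : SuperConnection A V E) {U : Opens M} {ι : Type*} (s : Finset ι)
    (X : SuperVF A V E U) (Y : ι → SuperVF A V E U) :
    C.nabla U X (∑ i ∈ s, Y i) = ∑ i ∈ s, C.nabla U X (Y i) := map_sum (C.nabla U X) Y s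

/-- The coordinate expression of a covariant derivative of an even super vector field by
another one. -/
lemma psi_act_nabla (C : SuperConnection A V E) {x₀ : M} {U : Opens M}
    (hU : U ≤ dom A V E x₀) {X Y : SuperVF A V E U} (hX : VFParity 0 X) (hY : VFParity 0 Y)
    (γ : Idx A V) (p : TotalSpace V E) :
    psi (act (C.nabla U X Y) le_rfl (zc x₀ hU γ)) p =
      psi (act X le_rfl (act Y le_rfl (zc x₀ hU γ))) p +
      ∑ α, ∑ β, psi (act X le_rfl (zc x₀ hU α)) p * psi (act Y le_rfl (zc x₀ hU β)) p *
        christoffel C hU α β γ p := by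
  have hXp : ∀ α, HasParity (par α) (act X le_rfl (zc x₀ hU α)) := fun α => by
    simpa using hX.act_hasParity le_rfl (zc_hasParity hU α)
  have hYp : ∀ α, HasParity (par α) (act Y le_rfl (zc x₀ hU α)) := fun α => by
    simpa using hY.act_hasParity le_rfl (zc_hasParity hU α)
  have hr : ∀ f : SuperFun A V E U, res le_rfl f = f := fun f => rfl
  have key : act (C.nabla U X Y) le_rfl (zc x₀ hU γ) =
      act X le_rfl (act Y le_rfl (zc x₀ hU γ)) +
      ∑ α, ∑ β, sgn (par α) (par β) • (act X le_rfl (zc x₀ hU α) *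
        (act Y le_rfl (zc x₀ hU β) * superChristoffel C hU α β γ)) := by
    -- X is expanded by linearity over superfunctions and Y by the graded Leibniz rule. The terms in
    -- which the coefficients of Y are differentiated recombine to X(Y(z^γ)).
    have h1 : C.nabla U X Y = ∑ α, mulVF (act X le_rfl (zc x₀ hU α))
        (C.nabla U (fr x₀ hU α) Y) := by
      conv_lhs => rw [eq_sum_mulVF_fr hU hX, map_sum, LinearMap.sum_apply]
      exact Finset.sum_congr rfl fun α _ => C.linear_left _ _ _ _
    have h2 : ∀ α, C.nabla U (fr x₀ hU α) Y = ∑ β,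
        (mulVF (act (fr x₀ hU α) le_rfl (act Y le_rfl (zc x₀ hU β))) (fr x₀ hU β) +
        sgn (par α) (par β) • mulVF (act Y le_rfl (zc x₀ hU β))
          (C.nabla U (fr x₀ hU α) (fr x₀ hU β))) := fun α => by
      conv_lhs => rw [eq_sum_mulVF_fr hU hY, nabla_sum_right]
      exact Finset.sum_congr rfl fun β _ =>
        C.leibniz U (par α) (par β) _ _ _ (fr_parity hU α) (hYp β)
    rw [h1, act_sum, act_eq_sum hU le_rfl hX (act Y le_rfl (zc x₀ hU γ)), ← Finset.sum_add_distrib]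
    refine Finset.sum_congr rfl fun α _ => ?_
    rw [act_mulVF, hr, h2, act_sum]
    simp only [act_add, act_smul, act_mulVF, hr, act_fr_zc, mul_ite, mul_one, mul_zero]
    rw [Finset.sum_add_distrib, mul_add]
    congr 1
    · simp
    · rw [Finset.mul_sum]
      refine Finset.sum_congr rfl fun β _ => ?_
      rw [mul_smul_comm]
      rfl
  rw [key, psi_add, psi_sum]
  simp only [psi_sum, psi_mul_superChristoffel C hU γ (hXp _) (hYp _)]

/-- The differentials of the coordinate functions on the total space. -/
def dz (x₀ : M) (γ : Idx A V) (p : TotalSpace V E) :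
    TangentSpace (𝓘(ℝ, A).prod 𝓘(ℝ, V)) p →L[ℝ] ℝ :=
  mvfderiv (𝓘(ℝ, A).prod 𝓘(ℝ, V)) (psi (zc (A := A) (E := E) x₀ le_rfl γ)) p

lemma mvfderiv_psi_res {U U' : Opens M} (h : U' ≤ U) (f : SuperFun A V E U) {p : TotalSpace V E}
    (hp : p.proj ∈ U') :
    mvfderiv (𝓘(ℝ, A).prod 𝓘(ℝ, V)) (psi (res h f)) p =
      mvfderiv (𝓘(ℝ, A).prod 𝓘(ℝ, V)) (psi f) p := by
  have h1 : psi (res h f) =ᶠ[𝓝 p] psi f := by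
    filter_upwards [(isOpen_proj_mem U').mem_nhds hp] with q hq using psi_res h f hq
  refine ContinuousLinearMap.ext fun v => ?_
  have h2 := h1.mfderiv_eq (I := 𝓘(ℝ, A).prod 𝓘(ℝ, V)) (I' := 𝓘(ℝ, ℝ))
  exact DFunLike.congr_fun h2 v

lemma mvfderiv_psi_zc {x₀ : M} {U : Opens M} (hU : U ≤ dom A V E x₀) (γ : Idx A V)
    {p : TotalSpace V E} (hp : p.proj ∈ U) :
    mvfderiv (𝓘(ℝ, A).prod 𝓘(ℝ, V)) (psi (zc x₀ hU γ)) p = dz x₀ γ p := by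
  rw [dz, ← res_zc le_rfl hU, mvfderiv_psi_res hU _ hp]

lemma dz_tf {x₀ : M} {p : TotalSpace V E} (hp : p.proj ∈ dom A V E x₀) (γ δ : Idx A V) :
    dz x₀ δ p (tf x₀ γ p) = if γ = δ then 1 else 0 :=
  mvfderiv_psi_zc_tf le_rfl hp γ δ

lemma eq_sum_dz {x₀ : M} {p : TotalSpace V E} (hp : p.proj ∈ dom A V E x₀)
    (w : TangentSpace (𝓘(ℝ, A).prod 𝓘(ℝ, V)) p) : w = ∑ γ, dz x₀ γ p w • tf x₀ γ p :=
  tangent_eq_sum le_rfl hp w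

lemma tangent_ext {x₀ : M} {p : TotalSpace V E} (hp : p.proj ∈ dom A V E x₀)
    {w w' : TangentSpace (𝓘(ℝ, A).prod 𝓘(ℝ, V)) p} (h : ∀ γ, dz x₀ γ p w = dz x₀ γ p w') :
    w = w' := by
  rw [eq_sum_dz hp w, eq_sum_dz hp w']
  simp only [h]

lemma mdifferentiableAt_dz {x₀ : M} {p : TotalSpace V E} (hp : p.proj ∈ dom A V E x₀)
    {X : TotalVF A V E}
    (hX : MDifferentiableAt (𝓘(ℝ, A).prod 𝓘(ℝ, V)) (𝓘(ℝ, A).prod 𝓘(ℝ, V)).tangent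
      (fun p => (⟨p, X p⟩ : TangentBundle (𝓘(ℝ, A).prod 𝓘(ℝ, V)) (TotalSpace V E))) p)
    (γ : Idx A V) :
    MDifferentiableAt (𝓘(ℝ, A).prod 𝓘(ℝ, V)) 𝓘(ℝ, ℝ) (fun p => dz x₀ γ p (X p)) p :=
  (mdifferentiableAt_iff le_rfl hp X).1 hX γ

lemma SmoothVFOn.dz_smooth {x₀ : M} {S : Set (TotalSpace V E)} (hS : IsOpen S)
    (hSd : ∀ p ∈ S, p.proj ∈ dom A V E x₀) {X : TotalVF A V E} (hX : SmoothVFOn X S)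
    (γ : Idx A V) :
    ContMDiffOn (𝓘(ℝ, A).prod 𝓘(ℝ, V)) 𝓘(ℝ, ℝ) ∞ (fun p => dz x₀ γ p (X p)) S :=
  (smoothVFOn_iff le_rfl hS hSd X).1 hX γ

/-- The induced connection on the total space, in coordinates around `x₀`. -/
def locConn (C : SuperConnection A V E) (x₀ : M) (Y : TotalVF A V E) (p : TotalSpace V E) :
    TangentSpace (𝓘(ℝ, A).prod 𝓘(ℝ, V)) p →L[ℝ] TangentSpace (𝓘(ℝ, A).prod 𝓘(ℝ, V)) p :=
  ∑ γ, (mvfderiv (𝓘(ℝ, A).prod 𝓘(ℝ, V)) (fun q => dz x₀ γ q (Y q)) p +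
    ∑ α, ∑ β, (dz x₀ β p (Y p) * christoffel C (le_refl (dom A V E x₀)) α β γ p) •
      dz x₀ α p).smulRight (tf x₀ γ p)

lemma locConn_apply (C : SuperConnection A V E) (x₀ : M) (Y : TotalVF A V E)
    (p : TotalSpace V E) (v : TangentSpace (𝓘(ℝ, A).prod 𝓘(ℝ, V)) p) :
    locConn C x₀ Y p v =
      ∑ γ, (mvfderiv (𝓘(ℝ, A).prod 𝓘(ℝ, V)) (fun q => dz x₀ γ q (Y q)) p v +
        ∑ α, ∑ β, (dz x₀ β p (Y p) * christoffel C (le_refl (dom A V E x₀)) α β γ p) *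
          dz x₀ α p v) • tf x₀ γ p := by
  rw [locConn, sum_apply]
  refine Finset.sum_congr rfl fun γ _ => ?_
  rw [ContinuousLinearMap.smulRight_apply, add_apply, sum_apply]
  simp only [sum_apply]
  rfl

lemma dz_locConn (C : SuperConnection A V E) {x₀ : M} (Y : TotalVF A V E)
    {p : TotalSpace V E} (hp : p.proj ∈ dom A V E x₀)
    (v : TangentSpace (𝓘(ℝ, A).prod 𝓘(ℝ, V)) p) (γ : Idx A V) :
    dz x₀ γ p (locConn C x₀ Y p v) =
      mvfderiv (𝓘(ℝ, A).prod 𝓘(ℝ, V)) (fun q => dz x₀ γ q (Y q)) p v +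
        ∑ α, ∑ β, dz x₀ α p v * dz x₀ β p (Y p) *
          christoffel C (le_refl (dom A V E x₀)) α β γ p := by
  rw [locConn_apply, map_sum]
  simp only [map_smul, dz_tf hp, smul_eq_mul, mul_ite, mul_one, mul_zero]
  rw [Finset.sum_ite_eq' Finset.univ γ, if_pos (Finset.mem_univ _)]
  congr 1
  refine Finset.sum_congr rfl fun α _ => Finset.sum_congr rfl fun β _ => ?_
  ring

lemma locConn_isCovariantDerivativeOn (C : SuperConnection A V E) (x₀ : M) :
    IsCovariantDerivativeOn (A × V) (locConn C x₀) {p | p.proj ∈ dom A V E x₀} where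
  add {σ σ' p} hσ hσ' hp := by
    refine ContinuousLinearMap.ext fun v => tangent_ext hp fun γ => ?_
    rw [add_apply, map_add, dz_locConn C _ hp, dz_locConn C _ hp,
      dz_locConn C _ hp]
    have h1 : (fun q => dz x₀ γ q ((σ + σ') q)) =
        (fun q => dz x₀ γ q (σ q)) + fun q => dz x₀ γ q (σ' q) := by
      funext q
      exact map_add _ _ _
    rw [h1, mvfderiv_add (mdifferentiableAt_dz hp hσ γ) (mdifferentiableAt_dz hp hσ' γ),
      add_apply]
    simp only [Pi.add_apply, map_add, mul_add, add_mul, Finset.sum_add_distrib]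
    ring
  leibniz {σ g p} hσ hg hp := by
    refine ContinuousLinearMap.ext fun v => tangent_ext hp fun γ => ?_
    rw [add_apply, map_add, smul_apply, map_smul,
      dz_locConn C _ hp, dz_locConn C _ hp, ContinuousLinearMap.smulRight_apply, map_smul]
    have h1 : (fun q => dz x₀ γ q ((g • σ) q)) = g * fun q => dz x₀ γ q (σ q) := by
      funext q
      exact map_smul (dz x₀ γ q) (g q) (σ q)
    rw [h1, mvfderiv_mul hg (mdifferentiableAt_dz hp hσ γ),
      add_apply, smul_apply,
      smul_apply]
    have h2 : ∀ β, dz x₀ β p ((g • σ) p) = g p * dz x₀ β p (σ p) := fun β =>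
      map_smul (dz x₀ β p) (g p) (σ p)
    simp only [h2, smul_eq_mul, mul_add, Finset.mul_sum]
    have h3 : ∀ α β, dz x₀ α p v * (g p * dz x₀ β p (σ p)) *
        christoffel C (le_refl (dom A V E x₀)) α β γ p =
        g p * (dz x₀ α p v * dz x₀ β p (σ p) *
        christoffel C (le_refl (dom A V E x₀)) α β γ p) := fun α β => by ring
    simp only [h3]
    ring

lemma locConn_smooth (C : SuperConnection A V E) (x₀ : M) {S : Set (TotalSpace V E)}
    (hS : IsOpen S) (hSd : ∀ p ∈ S, p.proj ∈ dom A V E x₀) {Y : TotalVF A V E}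
    (hY : SmoothVFOn Y S) {X : TotalVF A V E} (hX : SmoothVFOn X S) :
    SmoothVFOn (fun p => locConn C x₀ Y p (X p)) S := by
  refine (smoothVFOn_iff le_rfl hS hSd _).2 fun γ => ?_
  have h1 := hX.mvfderiv_smooth hS (hY.dz_smooth hS hSd γ)
  have h2 : ContMDiffOn (𝓘(ℝ, A).prod 𝓘(ℝ, V)) 𝓘(ℝ, ℝ) ∞
      (fun p => ∑ α, ∑ β, dz x₀ α p (X p) * dz x₀ β p (Y p) *
        christoffel C (le_refl (dom A V E x₀)) α β γ p) S :=
    contMDiffOn_finsetSum fun α _ => contMDiffOn_finsetSum fun β _ =>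
      ((hX.dz_smooth hS hSd α).mul (hY.dz_smooth hS hSd β)).mul
        ((christoffel_smooth C le_rfl α β γ).mono hSd)
  exact (h1.add h2).congr fun p hp => dz_locConn C Y (hSd p hp) (X p) γ

lemma isAffine_fn {U : Opens M} {g : M → ℝ} (hg : ContMDiffOn 𝓘(ℝ, A) 𝓘(ℝ, ℝ) ∞ g U) :
    IsAffine (V := V) (E := E) (fn U g hg) := fun x => by
  refine ⟨g x, 0, ?_⟩
  rw [map_zero, add_zero, ← SuperFun.ext0_of_mem _ x.2]
  exact ext0_fn x.2

/-- The projection of `Λ V*` to the components of degree at most one. -/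
def affProj {V : Type*} [AddCommGroup V] [Module ℝ V] : LDual V →ₗ[ℝ] LDual V :=
  (Algebra.linearMap ℝ (LDual V)).comp body.toLinearMap + (ExteriorAlgebra.ι ℝ).comp linPart

lemma affProj_apply {V : Type*} [AddCommGroup V] [Module ℝ V] (u : LDual V) :
    affProj u = algebraMap ℝ _ (body u) + ExteriorAlgebra.ι ℝ (linPart u) := rfl

lemma affProj_eq_self_iff {V : Type*} [AddCommGroup V] [Module ℝ V] {u : LDual V} :
    affProj u = u ↔ ∃ (c : ℝ) (η : Module.Dual ℝ V),
      u = algebraMap ℝ _ c + ExteriorAlgebra.ι ℝ η := by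
  constructor
  · intro h
    exact ⟨_, _, h.symm⟩
  · rintro ⟨c, η, rfl⟩
    simp [affProj_apply]

lemma isAffine_iff {e : Trivialization V (π V E)} [e.IsLinear ℝ] {U : Opens M}
    (hU : (U : Set M) ⊆ e.baseSet) {f : SuperFun A V E U} :
    IsAffine f ↔ ∀ x ∈ U, affProj (loc e f x) = loc e f x := by
  constructor
  · intro h x hx
    obtain ⟨c, η, hc⟩ := h ⟨x, hx⟩
    rw [loc, SuperFun.ext0_of_mem _ hx, hc, map_add, AlgHom.commutes, localRep,
      ExteriorAlgebra.map_apply_ι]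
    exact affProj_eq_self_iff.2 ⟨_, _, rfl⟩
  · intro h x
    obtain ⟨c, η, hc⟩ := affProj_eq_self_iff.1 (h x x.2)
    have h1 := localInv_localRep e (hU x.2) (f.val x)
    rw [loc, SuperFun.ext0_of_mem _ x.2] at hc
    rw [hc, map_add, AlgHom.commutes, localInv, ExteriorAlgebra.map_apply_ι] at h1
    exact ⟨_, _, h1.symm⟩

lemma zc_isAffine {x₀ : M} {U : Opens M} (hU : U ≤ dom A V E x₀) (γ : Idx A V) :
    IsAffine (zc x₀ hU γ) := by
  rcases γ with i | a
  · exact isAffine_fn (evenCoord_smooth hU i)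
  · refine (isAffine_iff (subset_baseSet_of_le_dom hU)).2 fun x hx => ?_
    rw [loc_zc_inr hU a hx]
    exact affProj_eq_self_iff.2 ⟨0, _, by rw [map_zero, zero_add]⟩

lemma VFParity.resVF {U U' : Opens M} (h : U' ≤ U) {a : ZMod 2} {X : SuperVF A V E U}
    (hX : VFParity a X) : VFParity a (resVF h X) :=
  ⟨fun W W' => hX.1 ⟨W.1, W.2.trans h⟩ ⟨W'.1, W'.2.trans h⟩,
    fun W => hX.2.1 ⟨W.1, W.2.trans h⟩, fun W => hX.2.2 ⟨W.1, W.2.trans h⟩⟩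

/-- `IsPsi` constrains only affine superfunctions, but the coordinates are affine and an even
superderivation is determined by them modulo degree two. The extension matters because neither Φ^*
nor a general even field preserves 𝓕. -/
lemma IsPsi.mvfderiv_psi {U W : Opens M} {X : SuperVF A V E U} {X' : TotalVF A V E}
    (hX : VFParity 0 X) (hXX' : IsPsi X X') (h : W ≤ U) (f : SuperFun A V E W)
    {p : TotalSpace V E} (hp : p.proj ∈ W) :
    mvfderiv (𝓘(ℝ, A).prod 𝓘(ℝ, V)) (psi f) p (X' p) = psi (act X h f) p := by
  have hd : W ⊓ dom A V E p.proj ≤ dom A V E p.proj := inf_le_right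
  have hW : W ⊓ dom A V E p.proj ≤ W := inf_le_left
  have hp' : p.proj ∈ W ⊓ dom A V E p.proj := ⟨hp, mem_dom_self _⟩
  have h1 := mvfderiv_psi_eq_of_coord hd le_rfl (hX.resVF (hW.trans h)) hp'
    (w := X' p) (fun γ => hXX'.2 _ (hW.trans h) _ (zc_isAffine hd γ) p hp') (res hW f)
  rw [mvfderiv_psi_res hW f hp', resVF_act, act_res h hW, psi_res hW _ hp'] at h1
  exact h1

/-- Since ∇_X Y is even, the identity need only be checked on coordinates, where it compares
`dz_locConn` with `psi_act_nabla`. Membership of X and Y in 𝓛₀ plays no role, so the identity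
remains available for pushed-forward fields. -/
lemma locConn_reduction (C : SuperConnection A V E) {x₀ : M} {U W : Opens M}
    {X Y : SuperVF A V E U} {X' Y' : TotalVF A V E} (hX : VFParity 0 X) (hY : VFParity 0 Y)
    (hXX' : IsPsi X X') (hYY' : IsPsi Y Y') (h : W ≤ U) (f : SuperFun A V E W)
    {p : TotalSpace V E} (hp : p.proj ∈ W) (hpd : p.proj ∈ dom A V E x₀) :
    mvfderiv (𝓘(ℝ, A).prod 𝓘(ℝ, V)) (psi f) p (locConn C x₀ Y' p (X' p)) =
      psi (act (C.nabla U X Y) h f) p := by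
  have hd : W ⊓ dom A V E x₀ ≤ dom A V E x₀ := inf_le_right
  have hW : W ⊓ dom A V E x₀ ≤ W := inf_le_left
  have hp' : p.proj ∈ W ⊓ dom A V E x₀ := ⟨hp, hpd⟩
  have hZ : VFParity 0 (resVF (hW.trans h) (C.nabla U X Y)) :=
    VFParity.resVF _ (by simpa using C.even U 0 0 X Y hX hY)
  have h1 := mvfderiv_psi_eq_of_coord hd le_rfl hZ hp' (w := locConn C x₀ Y' p (X' p))
    (fun γ => ?_) (res hW f)
  · rw [mvfderiv_psi_res hW f hp', resVF_act, act_res h hW, psi_res hW _ hp'] at h1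
    exact h1
  · have hdz : ∀ {X : SuperVF A V E U} {X' : TotalVF A V E}, VFParity 0 X → IsPsi X X' →
        ∀ γ {q : TotalSpace V E}, q.proj ∈ W ⊓ dom A V E x₀ → dz x₀ γ q (X' q) =
          psi (act (resVF (hW.trans h) X) le_rfl (zc x₀ hd γ)) q := fun hX hXX' γ q hq => by
      rw [resVF_act, ← mvfderiv_psi_zc hd γ hq]
      exact hXX'.mvfderiv_psi hX _ _ hq
    rw [mvfderiv_psi_zc hd γ hp', dz_locConn C _ hpd, ← C.nabla_res,
      psi_act_nabla C hd (hX.resVF _) (hY.resVF _)]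
    congr 1
    · have h2 : (fun q => dz x₀ γ q (Y' q)) =ᶠ[𝓝 p]
          psi (act (resVF (hW.trans h) Y) le_rfl (zc x₀ hd γ)) := by
        filter_upwards [(isOpen_proj_mem (W ⊓ dom A V E x₀)).mem_nhds hp'] with q hq using hdz hY hYY' γ hq
      have h3 := h2.mfderiv_eq (I := 𝓘(ℝ, A).prod 𝓘(ℝ, V)) (I' := 𝓘(ℝ, ℝ))
      refine Eq.trans (DFunLike.congr_fun h3 (X' p)) ?_
      rw [resVF_act]
      exact hXX'.mvfderiv_psi hX (hW.trans h) _ hp'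
    · refine Finset.sum_congr rfl fun α _ => Finset.sum_congr rfl fun β _ => ?_
      rw [hdz hX hXX' α hp', hdz hY hYY' β hp', ← christoffel_res C le_rfl hd α β γ hp']

end LocalConnection

/-! ### The reduction identity determines the connection -/

section Uniqueness

variable {A : Type*} [NormedAddCommGroup A] [NormedSpace ℝ A] [FiniteDimensional ℝ A]
  {V : Type*} [NormedAddCommGroup V] [NormedSpace ℝ V] [FiniteDimensional ℝ V]
  {M : Type*} [TopologicalSpace M] [ChartedSpace A M] [IsManifold 𝓘(ℝ, A) ∞ M]
  {E : M → Type*} [∀ x, AddCommGroup (E x)] [∀ x, Module ℝ (E x)]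
  [∀ x, TopologicalSpace (E x)] [TopologicalSpace (TotalSpace V E)]
  [FiberBundle V E] [VectorBundle ℝ V E] [ContMDiffVectorBundle ∞ V E 𝓘(ℝ, A)]

/-- The weights which turn the coordinate super vector fields into elements of `𝓛₀`. -/
def wt (x₀ : M) {U : Opens M} (hU : U ≤ dom A V E x₀) : Idx A V → SuperFun A V E U
  | .inl _ => 1
  | .inr a => zc x₀ hU (.inr a)

lemma hasParity_one (U : Opens M) : HasParity 0 (1 : SuperFun A V E U) := fun x => by
  have := algebraMap_mem_parityPart (V := E x) 1
  rwa [map_one] at this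

lemma wt_hasParity {x₀ : M} {U : Opens M} (hU : U ≤ dom A V E x₀) (γ : Idx A V) :
    HasParity (par γ) (wt x₀ hU γ) := by
  rcases γ with i | a
  · exact hasParity_one U
  · exact zc_hasParity hU (.inr a)

/-- The weighted coordinate super vector fields. -/
def wfr (x₀ : M) {U : Opens M} (hU : U ≤ dom A V E x₀) (γ : Idx A V) : SuperVF A V E U :=
  mulVF (wt x₀ hU γ) (fr x₀ hU γ)

lemma wfr_parity {x₀ : M} {U : Opens M} (hU : U ≤ dom A V E x₀) (γ : Idx A V) :
    VFParity 0 (wfr x₀ hU γ) := by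
  have h := mulVF_mem (wt_hasParity hU γ) (fr_parity hU γ)
  have h2 : par γ + par γ = 0 := by
    rcases γ with i | a
    · exact add_zero 0
    · rfl
  rwa [h2] at h

/-- The even coordinate field differentiates coefficients and respects degrees. The odd one lowers
degree by one, and the weight θᵃ raises it again, so degree zero goes to zero and degree one to
degree one. -/
lemma wfr_inL0 {x₀ : M} {U : Opens M} (hU : U ≤ dom A V E x₀) (γ : Idx A V) :
    InL0 (wfr x₀ hU γ) := by
  refine ⟨wfr_parity hU γ, fun W h f hf => ?_⟩
  have hW := h.trans hU
  have hf' := (isAffine_iff (subset_baseSet_of_le_dom hW)).1 hf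
  refine (isAffine_iff (subset_baseSet_of_le_dom hW)).2 fun x hx => ?_
  rw [wfr, act_mulVF, loc_mul]
  rcases γ with i | a
  · have h1 : loc (trivializationAt V E x₀) (res h (wt x₀ hU (.inl i))) x = 1 := by
      rw [loc, SuperFun.ext0_of_mem _ hx]
      exact map_one _
    rw [h1, one_mul, loc_act_fr_inl hU h i f hx,
      linear_pdL (loc_smooth_of_le_dom hW f) W.2 (subset_source_of_le_dom hW) hx]
    exact pdL_congr W.2 (subset_source_of_le_dom hW) (fun y hy => hf' y hy) hx
  · obtain ⟨c, η, hc⟩ := affProj_eq_self_iff.1 (hf' x hx)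
    have h1 : loc (trivializationAt V E x₀) (res h (wt x₀ hU (.inr a))) x =
        ExteriorAlgebra.ι ℝ ((Module.finBasis ℝ V).coord a) := by
      rw [loc_res _ _ _ hx]
      exact loc_zc_inr hU a (h hx)
    rw [h1, loc_act_fr_inr hU h a f hx, hc, map_add, contr_algebraMap, contr_ι, zero_add]
    refine affProj_eq_self_iff.2 ⟨0, η (Module.finBasis ℝ V a) • (Module.finBasis ℝ V).coord a, ?_⟩
    rw [map_zero, zero_add, map_smul, ← Algebra.commutes, ← Algebra.smul_def]

/-- The odd field ∂_{θᵃ} has no counterpart on the total space, but θᵃ∂_{θᵃ} is even and corresponds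
to yᵃ∂_{yᵃ}. -/
lemma wfr_isPsi {x₀ : M} {U : Opens M} (hU : U ≤ dom A V E x₀) (γ : Idx A V) :
    IsPsi (wfr x₀ hU γ) (psi (wt x₀ hU γ) • tf x₀ γ) := by
  constructor
  · refine (smoothVFOn_iff hU (isOpen_proj_mem U) (fun _ hp => hp) _).2 fun δ => ?_
    refine ((psi_smooth (wt x₀ hU γ)).mul (contMDiffOn_const (c := if γ = δ then (1 : ℝ) else 0))
      ).congr fun p hp => ?_
    refine (map_smul (mvfderiv (𝓘(ℝ, A).prod 𝓘(ℝ, V)) (psi (zc x₀ hU δ)) p)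
      (psi (wt x₀ hU γ) p) (tf x₀ γ p)).trans ?_
    rw [mvfderiv_psi_zc_tf hU hp]
    rfl
  · intro W h f _ p hp
    have h0 : (psi (wt x₀ hU γ) • tf x₀ γ) p = psi (wt x₀ hU γ) p • tf x₀ γ p := rfl
    rw [h0, map_smul, smul_eq_mul, wfr, act_mulVF, ← psi_res h _ hp]
    have hpar := (wt_hasParity hU γ).res h
    rcases γ with i | a
    · rw [psi_mul_even hpar, mvfderiv_psi_tf_inl hU h f hp]
    · rw [psi_mul_odd hpar, mvfderiv_psi_tf_inr hU h f hp]

/-- The fibre coordinate yᵃ has derivative 1 along its frame vector, so it cannot vanish on a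
neighbourhood of any point; the other weights are 1. -/
lemma frequently_psi_wt_ne_zero {x₀ : M} {U : Opens M} (hU : U ≤ dom A V E x₀) (γ : Idx A V)
    {p : TotalSpace V E} (hp : p.proj ∈ U) : ∃ᶠ q in 𝓝 p, psi (wt x₀ hU γ) q ≠ 0 := by
  rcases γ with i | a
  · refine (Filter.Eventually.frequently ?_)
    filter_upwards [(isOpen_proj_mem U).mem_nhds hp] with q hq
    rw [wt, psi_one U hq]
    exact one_ne_zero
  · intro h
    have h1 : psi (wt x₀ hU (.inr a)) =ᶠ[𝓝 p] fun _ => (0 : ℝ) := by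
      filter_upwards [h] with q hq using not_not.1 hq
    have h2 := h1.mfderiv_eq (I := 𝓘(ℝ, A).prod 𝓘(ℝ, V)) (I' := 𝓘(ℝ, ℝ))
    have h3 := mvfderiv_psi_zc_tf hU hp (.inr a) (.inr a)
    rw [if_pos rfl] at h3
    have h4 := DFunLike.congr_fun h2 (tf x₀ (.inr a) p)
    rw [mfderiv_const] at h4
    exact zero_ne_one (α := ℝ) (h4.symm.trans h3)

/-- A covariant derivative over an open set is determined by its values on vector fields coming
from `𝓛₀`. -/
lemma eqOn_of_reduction {x₀ : M} {U : Opens M} (hU : U ≤ dom A V E x₀)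
    {cov cov' : TotalVF A V E → ∀ p : TotalSpace V E, TangentSpace (𝓘(ℝ, A).prod 𝓘(ℝ, V)) p →L[ℝ]
      TangentSpace (𝓘(ℝ, A).prod 𝓘(ℝ, V)) p}
    (hc : IsCovariantDerivativeOn (A × V) cov {p | p.proj ∈ U})
    (hc' : IsCovariantDerivativeOn (A × V) cov' {p | p.proj ∈ U})
    (hs : ∀ X Y : TotalVF A V E, SmoothVFOn X {p | p.proj ∈ U} → SmoothVFOn Y {p | p.proj ∈ U} →
      SmoothVFOn (fun p => cov Y p (X p)) {p | p.proj ∈ U})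
    (hs' : ∀ X Y : TotalVF A V E, SmoothVFOn X {p | p.proj ∈ U} → SmoothVFOn Y {p | p.proj ∈ U} →
      SmoothVFOn (fun p => cov' Y p (X p)) {p | p.proj ∈ U})
    (hr : ∀ (X Y : SuperVF A V E U) (X' Y' : TotalVF A V E), InL0 X → InL0 Y → IsPsi X X' →
      IsPsi Y Y' → ∀ γ, ∀ p : TotalSpace V E, p.proj ∈ U →
        dz x₀ γ p (cov Y' p (X' p)) = dz x₀ γ p (cov' Y' p (X' p)))
    {Y : TotalVF A V E} {p : TotalSpace V E} (hp : p.proj ∈ U)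
    (hY : MDifferentiableAt (𝓘(ℝ, A).prod 𝓘(ℝ, V)) (𝓘(ℝ, A).prod 𝓘(ℝ, V)).tangent
      (fun p => (⟨p, Y p⟩ : TangentBundle (𝓘(ℝ, A).prod 𝓘(ℝ, V)) (TotalSpace V E))) p) :
    cov Y p = cov' Y p := by
  have hopen := isOpen_proj_mem (V := V) (E := E) U
  have htf : ∀ γ, SmoothVFOn (tf x₀ γ) {p : TotalSpace V E | p.proj ∈ U} := fun γ =>
    (tf_smooth γ).mono fun _ hp => hU hp
  have hd : ∀ γ, ∀ q : TotalSpace V E, q.proj ∈ U →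
      MDifferentiableAt (𝓘(ℝ, A).prod 𝓘(ℝ, V)) (𝓘(ℝ, A).prod 𝓘(ℝ, V)).tangent
      (fun p => (⟨p, tf x₀ γ p⟩ : TangentBundle (𝓘(ℝ, A).prod 𝓘(ℝ, V)) (TotalSpace V E))) q :=
    fun γ q hq => ((htf γ).contMDiffAt (hopen.mem_nhds hq)).mdifferentiableAt (by simp)
  have key : ∀ α β γ, ∀ q : TotalSpace V E, q.proj ∈ U →
      dz x₀ γ q (cov (tf x₀ β) q (tf x₀ α q)) = dz x₀ γ q (cov' (tf x₀ β) q (tf x₀ α q)) := by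
    intro α β γ q hq
    set F : TotalSpace V E → ℝ := fun q => dz x₀ γ q (cov (tf x₀ β) q (tf x₀ α q)) -
      dz x₀ γ q (cov' (tf x₀ β) q (tf x₀ α q)) with hF
    have hFc : ContinuousOn F {p | p.proj ∈ U} :=
      (((hs _ _ (htf α) (htf β)).dz_smooth hopen (fun _ hp => hU hp) γ).sub
      ((hs' _ _ (htf α) (htf β)).dz_smooth hopen (fun _ hp => hU hp) γ)).continuousOn
    -- In the reduction identity for the weighted fields, the Leibniz rule produces the same
    -- derivative term for both connections. The difference therefore scales with the product of the
    -- weights.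
    have hprod : ∀ r : TotalSpace V E, r.proj ∈ U →
        psi (wt x₀ hU α) r * psi (wt x₀ hU β) r * F r = 0 := by
      intro r hr'
      have h1 := hr _ _ _ _ (wfr_inL0 hU α) (wfr_inL0 hU β) (wfr_isPsi hU α) (wfr_isPsi hU β)
        γ r hr'
      have hw := psi_mdifferentiableAt (wt x₀ hU β) hr'
      rw [hc.leibniz (hd β r hr') hw hr', hc'.leibniz (hd β r hr') hw hr'] at h1
      have h0 : (psi (wt x₀ hU α) • tf x₀ α) r = psi (wt x₀ hU α) r • tf x₀ α r := rfl
      simp only [h0, add_apply, smul_apply, map_add, map_smul, smul_eq_mul] at h1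
      rw [hF]
      linear_combination h1
    by_contra hne
    have hFq : F q ≠ 0 := fun h => hne (sub_eq_zero.1 h)
    have hev : ∀ {G : TotalSpace V E → ℝ}, ContinuousOn G {p | p.proj ∈ U} →
        ∀ {r : TotalSpace V E}, r.proj ∈ U → G r ≠ 0 → ∀ᶠ r in 𝓝 r, G r ≠ 0 ∧ r.proj ∈ U :=
      fun hG r hr h => ((hG.continuousAt (hopen.mem_nhds hr)).eventually_ne h).and
        (hopen.mem_nhds hr)
    -- Continuity of F and of the weights keeps nonvanishing an open condition, so the two weights
    -- can be made nonzero one after the other: first the one for α at r, then the one for β at a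
    -- nearby t. This contradicts `hprod` at t.
    obtain ⟨r, hr1, hr2⟩ := ((frequently_psi_wt_ne_zero hU α hq).and_eventually
      (hev hFc hq hFq).eventually_nhds).exists
    have hrU := hr2.self_of_nhds.2
    obtain ⟨t, ht1, ht2, ht3⟩ := ((frequently_psi_wt_ne_zero hU β hrU).and_eventually
      (hr2.and (hev (psi_smooth (wt x₀ hU α)).continuousOn hrU hr1))).exists
    exact mul_ne_zero (mul_ne_zero ht3.1 ht1) ht2.1 (hprod t ht2.2)
  -- The difference of two covariant derivatives is tensorial in the differentiated field, so
  -- agreement on the frame implies agreement on every field differentiable at the point.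
  have hT : ∀ q : TotalSpace V E, q.proj ∈ U → ∀ Z, MDifferentiableAt (𝓘(ℝ, A).prod 𝓘(ℝ, V))
      (𝓘(ℝ, A).prod 𝓘(ℝ, V)).tangent
      (fun p => (⟨p, Z p⟩ : TangentBundle (𝓘(ℝ, A).prod 𝓘(ℝ, V)) (TotalSpace V E))) q →
      hc.difference hc' q (Z q) = cov Z q - cov' Z q := fun q hq Z hZ =>
    IsCovariantDerivativeOn.difference_apply hc hc' hq hZ
  rw [← sub_eq_zero, ← hT p hp Y hY]
  rw [eq_sum_dz (hU hp) (Y p), map_sum]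
  refine Finset.sum_eq_zero fun β _ => ?_
  rw [map_smul, hT p hp _ (hd β p hp)]
  refine smul_eq_zero_of_right _ ?_
  rw [sub_eq_zero]
  refine ContinuousLinearMap.ext fun v => tangent_ext (hU hp) fun γ => ?_
  rw [eq_sum_dz (hU hp) v]
  simp only [map_sum, map_smul, key _ β γ p hp]

end Uniqueness

/-! ### Gluing and global uniqueness of the induced connection -/

section GlobalConnection

variable {A : Type*} [NormedAddCommGroup A] [NormedSpace ℝ A] [FiniteDimensional ℝ A]
  {V : Type*} [NormedAddCommGroup V] [NormedSpace ℝ V] [FiniteDimensional ℝ V]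
  {M : Type*} [TopologicalSpace M] [ChartedSpace A M] [IsManifold 𝓘(ℝ, A) ∞ M]
  {E : M → Type*} [∀ x, AddCommGroup (E x)] [∀ x, Module ℝ (E x)]
  [∀ x, TopologicalSpace (E x)] [TopologicalSpace (TotalSpace V E)]
  [FiberBundle V E] [VectorBundle ℝ V E] [ContMDiffVectorBundle ∞ V E 𝓘(ℝ, A)]

/-- On the overlap of two coordinate domains both local connections satisfy the same reduction
identity, so uniqueness replaces a transformation law for Christoffel symbols. -/
lemma locConn_eq (C : SuperConnection A V E) {x₀ x₁ : M} {Y : TotalVF A V E} {p : TotalSpace V E}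
    (h₀ : p.proj ∈ dom A V E x₀) (h₁ : p.proj ∈ dom A V E x₁)
    (hY : MDifferentiableAt (𝓘(ℝ, A).prod 𝓘(ℝ, V)) (𝓘(ℝ, A).prod 𝓘(ℝ, V)).tangent
      (fun p => (⟨p, Y p⟩ : TangentBundle (𝓘(ℝ, A).prod 𝓘(ℝ, V)) (TotalSpace V E))) p) :
    locConn C x₀ Y p = locConn C x₁ Y p := by
  have hl : dom A V E x₀ ⊓ dom A V E x₁ ≤ dom A V E x₀ := inf_le_left
  refine eqOn_of_reduction hl
    ((locConn_isCovariantDerivativeOn C x₀).mono fun _ hp => hp.1)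
    ((locConn_isCovariantDerivativeOn C x₁).mono fun _ hp => hp.2)
    (fun X Y hX hY => locConn_smooth C x₀ (isOpen_proj_mem (dom A V E x₀ ⊓ dom A V E x₁)) (fun _ hp => hp.1) hY hX)
    (fun X Y hX hY => locConn_smooth C x₁ (isOpen_proj_mem (dom A V E x₀ ⊓ dom A V E x₁)) (fun _ hp => hp.2) hY hX)
    (fun X Y X' Y' hX hY hXX' hYY' γ q hq => ?_) ⟨h₀, h₁⟩ hY
  rw [← mvfderiv_psi_zc hl γ hq, locConn_reduction C hX.1 hY.1 hXX' hYY' le_rfl _ hq hq.1,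
    locConn_reduction C hX.1 hY.1 hXX' hYY' le_rfl _ hq hq.2]

/-- The connection induced on the total space by a connection on the supermanifold. -/
def inducedConn (C : SuperConnection A V E) : TotalConnection A V E where
  -- Each point uses the coordinates centred at its own base point. The axioms are pointwise, and
  -- smoothness follows because `locConn_eq` allows one coordinate system near a point.
  toFun Y p := locConn C p.proj Y p
  isCovariantDerivativeOnUniv :=
    { add := fun {_ _ p} hσ hσ' _ => (locConn_isCovariantDerivativeOn C p.proj).add hσ hσ'
        (mem_dom_self p.proj)
      leibniz := fun {_ _ p} hσ hg _ => (locConn_isCovariantDerivativeOn C p.proj).leibniz hσ hg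
        (mem_dom_self p.proj) }

lemma inducedConn_apply (C : SuperConnection A V E) {x₀ : M} {Y : TotalVF A V E}
    {p : TotalSpace V E} (hp : p.proj ∈ dom A V E x₀)
    (hY : MDifferentiableAt (𝓘(ℝ, A).prod 𝓘(ℝ, V)) (𝓘(ℝ, A).prod 𝓘(ℝ, V)).tangent
      (fun p => (⟨p, Y p⟩ : TangentBundle (𝓘(ℝ, A).prod 𝓘(ℝ, V)) (TotalSpace V E))) p) :
    inducedConn C Y p = locConn C x₀ Y p :=
  locConn_eq C (mem_dom_self p.proj) hp hY

lemma inducedConn_reduction (C : SuperConnection A V E) {U W : Opens M}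
    {X Y : SuperVF A V E U} {X' Y' : TotalVF A V E} (hX : VFParity 0 X) (hY : VFParity 0 Y)
    (hXX' : IsPsi X X') (hYY' : IsPsi Y Y') (h : W ≤ U) (f : SuperFun A V E W)
    {p : TotalSpace V E} (hp : p.proj ∈ W) :
    mvfderiv (𝓘(ℝ, A).prod 𝓘(ℝ, V)) (psi f) p (inducedConn C Y' p (X' p)) =
      psi (act (C.nabla U X Y) h f) p :=
  locConn_reduction C hX hY hXX' hYY' h f hp (mem_dom_self p.proj)

lemma SmoothVFOn.mdifferentiableAt {S : Set (TotalSpace V E)} (hS : IsOpen S)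
    {X : TotalVF A V E} (hX : SmoothVFOn X S) {p : TotalSpace V E} (hp : p ∈ S) :
    MDifferentiableAt (𝓘(ℝ, A).prod 𝓘(ℝ, V)) (𝓘(ℝ, A).prod 𝓘(ℝ, V)).tangent
      (fun p => (⟨p, X p⟩ : TangentBundle (𝓘(ℝ, A).prod 𝓘(ℝ, V)) (TotalSpace V E))) p :=
  (hX.contMDiffAt (hS.mem_nhds hp)).mdifferentiableAt (by simp)

lemma inducedConn_isReduction (C : SuperConnection A V E) : IsReduction C (inducedConn C) := by
  refine ⟨⟨⟨fun {σ} hσ p hp => ?_⟩⟩, fun U X Y X' Y' hX hY hXX' hYY' W h f _ p hp =>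
    inducedConn_reduction C hX.1 hY.1 hXX' hYY' h f hp⟩
  have hσ' : SmoothVFOn σ univ := hσ
  have hopen := isOpen_proj_mem (V := V) (E := E) (dom A V E p.proj)
  have hσ2 : SmoothVFOn σ {q : TotalSpace V E | q.proj ∈ dom A V E p.proj} :=
    ContMDiffOn.mono hσ' (subset_univ _)
  have h1 := contMDiffOn_hom_of_forall hopen (fun _ hq => hq)
    (L := fun q => locConn C p.proj σ q) fun α => locConn_smooth C p.proj hopen
      (fun _ hq => hq) hσ2 (tf_smooth α)
  have h2 := (h1.contMDiffAt (hopen.mem_nhds (mem_dom_self p.proj)))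
  refine ContMDiffAt.contMDiffWithinAt (h2.congr_of_eventuallyEq ?_)
  filter_upwards [hopen.mem_nhds (mem_dom_self p.proj)] with q hq
  have : inducedConn C σ q = locConn C p.proj σ q :=
    inducedConn_apply C hq (hσ2.mdifferentiableAt hopen hq)
  exact congrArg (TotalSpace.mk q) this

/-- Smoothness of a connection is a statement about globally smooth fields. Multiplication by a bump
function on the base turns a field over an open set into a global one with the same germ at `p`. -/
lemma exists_smoothVFOn_univ [T2Space M] {U : Opens M} {X : TotalVF A V E}
    (hX : SmoothVFOn X {p | p.proj ∈ U}) {p : TotalSpace V E} (hp : p.proj ∈ U) :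
    ∃ X' : TotalVF A V E, SmoothVFOn X' univ ∧ ∀ᶠ q in 𝓝 p, X' q = X q := by
  obtain ⟨χ, -, hχ⟩ := (SmoothBumpFunction.nhds_basis_tsupport (I := 𝓘(ℝ, A)) p.proj).mem_iff.1
    (U.2.mem_nhds hp)
  have hχs : ContMDiff (𝓘(ℝ, A).prod 𝓘(ℝ, V)) 𝓘(ℝ, ℝ) ∞
      (fun q : TotalSpace V E => χ q.proj) := χ.contMDiff.comp (contMDiff_proj E)
  refine ⟨(fun q : TotalSpace V E => χ q.proj) • X, fun q _ => ?_, ?_⟩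
  · refine ContMDiffAt.contMDiffWithinAt ?_
    by_cases hq : q.proj ∈ U
    · exact ContMDiffAt.smul_section hχs.contMDiffAt
        (ContMDiffOn.contMDiffAt hX ((isOpen_proj_mem U).mem_nhds hq))
    · have hq' : q.proj ∈ (tsupport χ)ᶜ := fun h => hq (hχ h)
      have ho : IsOpen {r : TotalSpace V E | r.proj ∈ (tsupport χ)ᶜ} :=
        (isClosed_tsupport χ).isOpen_compl.preimage (FiberBundle.continuous_proj V E)
      refine (Bundle.contMDiff_zeroSection ℝ
        (TangentSpace (𝓘(ℝ, A).prod 𝓘(ℝ, V)) : TotalSpace V E → Type _)).contMDiffAt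
        |>.congr_of_eventuallyEq ?_
      filter_upwards [ho.mem_nhds hq'] with r hr
      have h0 : χ r.proj = 0 := image_eq_zero_of_notMem_tsupport hr
      change (⟨r, χ r.proj • X r⟩ : TotalSpace _ _) = _
      rw [h0, zero_smul]
      rfl
  · have h1 := (FiberBundle.continuous_proj V E).continuousAt (x := p) |>.eventually
      χ.eventuallyEq_one
    filter_upwards [h1] with q hq
    change χ q.proj • X q = X q
    have : χ q.proj = 1 := hq
    rw [this, one_smul]

/-- A smooth connection maps smooth vector fields over an open set to smooth vector fields. -/
lemma smoothVFOn_cov [T2Space M] {D : TotalConnection A V E}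
    (hD : CovariantDerivative.ContMDiffCovariantDerivative D ∞) {U : Opens M}
    {X Y : TotalVF A V E} (hX : SmoothVFOn X {p | p.proj ∈ U})
    (hY : SmoothVFOn Y {p | p.proj ∈ U}) :
    SmoothVFOn (fun p => D Y p (X p)) {p | p.proj ∈ U} := by
  intro p hp
  obtain ⟨Y', hY', hYY'⟩ := exists_smoothVFOn_univ hY hp
  have h1 := hD.contMDiff.contMDiff (σ := Y') hY'
  have h2 := ContMDiffAt.clm_bundle_apply (h1.contMDiffAt Filter.univ_mem)
    (ContMDiffOn.contMDiffAt hX ((isOpen_proj_mem U).mem_nhds hp))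
  refine (h2.congr_of_eventuallyEq ?_).contMDiffWithinAt
  filter_upwards [hYY'.eventually_nhds, (isOpen_proj_mem U).mem_nhds hp] with q hq hqU
  have : D Y q = D Y' q := D.isCovariantDerivativeOnUniv.congr_of_eventuallyEq
    (hY.mdifferentiableAt (isOpen_proj_mem U) hqU)
    (hY'.mdifferentiableAt isOpen_univ (mem_univ q)) Filter.univ_mem
    (hq.mono fun _ h => h.symm)
  change (⟨q, D Y q (X q)⟩ : TotalSpace _ _) = _
  rw [this]

/-- The induced connection on the total space is unique. -/
lemma IsReduction.eq_inducedConn [T2Space M] {C : SuperConnection A V E}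
    {D : TotalConnection A V E} (hD : IsReduction C D) {Y : TotalVF A V E} {p : TotalSpace V E}
    (hY : MDifferentiableAt (𝓘(ℝ, A).prod 𝓘(ℝ, V)) (𝓘(ℝ, A).prod 𝓘(ℝ, V)).tangent
      (fun p => (⟨p, Y p⟩ : TangentBundle (𝓘(ℝ, A).prod 𝓘(ℝ, V)) (TotalSpace V E))) p) :
    D Y p = inducedConn C Y p := by
  refine eqOn_of_reduction (le_refl (dom A V E p.proj))
    (D.isCovariantDerivativeOnUniv.mono (subset_univ _))
    ((inducedConn C).isCovariantDerivativeOnUniv.mono (subset_univ _))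
    (fun X Y hX hY => smoothVFOn_cov hD.1 hX hY)
    (fun X Y hX hY => smoothVFOn_cov (inducedConn_isReduction C).1 hX hY)
    (fun X Y X' Y' hX hY hXX' hYY' γ q hq => ?_) (mem_dom_self p.proj) hY
  have h1 := hD.2 _ X Y X' Y' hX hY hXX' hYY' _ le_rfl _ (zc_isAffine le_rfl γ) q hq
  have h2 := inducedConn_reduction C hX.1 hY.1 hXX' hYY' le_rfl (zc _ le_rfl γ) hq
  exact h1.trans h2.symm

end GlobalConnection

/-! ### Pullbacks modulo degree two and the fibrewise linear map -/

section Diffeo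

variable {A : Type*} [NormedAddCommGroup A] [NormedSpace ℝ A] [FiniteDimensional ℝ A]
  {V : Type*} [NormedAddCommGroup V] [NormedSpace ℝ V] [FiniteDimensional ℝ V]
  {M : Type*} [TopologicalSpace M] [ChartedSpace A M] [IsManifold 𝓘(ℝ, A) ∞ M]
  {E : M → Type*} [∀ x, AddCommGroup (E x)] [∀ x, Module ℝ (E x)]
  [∀ x, TopologicalSpace (E x)] [TopologicalSpace (TotalSpace V E)]
  [FiberBundle V E] [VectorBundle ℝ V E] [ContMDiffVectorBundle ∞ V E 𝓘(ℝ, A)]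
  {B : Type*} [NormedAddCommGroup B] [NormedSpace ℝ B] [FiniteDimensional ℝ B]
  {V' : Type*} [NormedAddCommGroup V'] [NormedSpace ℝ V'] [FiniteDimensional ℝ V']
  {N : Type*} [TopologicalSpace N] [ChartedSpace B N] [IsManifold 𝓘(ℝ, B) ∞ N]
  {F : N → Type*} [∀ y, AddCommGroup (F y)] [∀ y, Module ℝ (F y)]
  [∀ y, TopologicalSpace (F y)] [TopologicalSpace (TotalSpace V' F)]
  [FiberBundle V' F] [VectorBundle ℝ V' F] [ContMDiffVectorBundle ∞ V' F 𝓘(ℝ, B)]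
  (Φ : SuperDiffeo A V E B V' F)

lemma ext0_pull_res {W W' : Opens N} (h : W' ≤ W) (f : SuperFun B V' F W) {x : M}
    (hx : Φ.base x ∈ W') : (Φ.pull W' (res h f)).ext0 x = (Φ.pull W f).ext0 x := by
  rw [Φ.pull_res]
  exact ext0_res _ _ hx

lemma ext0_one {U : Opens M} {x : M} (hx : x ∈ U) : (1 : SuperFun A V E U).ext0 x = 1 :=
  SuperFun.ext0_of_mem _ hx

/-- If d, the body at `x` of the pullback of g, differed from g(φ(x)), then g - d would be
invertible near φ(x), and so would its pullback be near `x`. But that pullback has zero body at `x`.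
-/
lemma body_pull_fn {W : Opens N} {g : N → ℝ} (hg : ContMDiffOn 𝓘(ℝ, B) 𝓘(ℝ, ℝ) ∞ g W)
    {x : M} (hx : Φ.base x ∈ W) : body ((Φ.pull W (fn W g hg)).ext0 x) = g (Φ.base x) := by
  by_contra hne
  set d := body ((Φ.pull W (fn W g hg)).ext0 x) with hd
  have hgc := hg.continuousOn.isOpen_inter_preimage W.2 (isOpen_ne (x := d))
  let W' : Opens N := ⟨W ∩ g ⁻¹' {y | y ≠ d}, hgc⟩
  have hW' : W' ≤ W := fun _ hy => hy.1
  have hx' : Φ.base x ∈ W' := ⟨hx, fun h => hne h.symm⟩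
  have hg1 : ContMDiffOn 𝓘(ℝ, B) 𝓘(ℝ, ℝ) ∞ (fun y => g y - d) W' :=
    (hg.mono hW').sub contMDiffOn_const
  have hg2 : ContMDiffOn 𝓘(ℝ, B) 𝓘(ℝ, ℝ) ∞ (fun y => (g y - d)⁻¹) W' :=
    ContMDiffOn.inv₀ hg1 fun y hy => sub_ne_zero.2 hy.2
  have h1 : fn (V := V') (E := F) W' _ hg1 * fn W' _ hg2 = 1 := by
    refine SuperFun.ext_ext0 fun y hy => ?_
    rw [ext0_mul, ext0_fn hy, ext0_fn hy, ext0_one hy, ← map_mul, mul_inv_cancel₀, map_one]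
    exact sub_ne_zero.2 hy.2
  have h2 : fn (V := V') (E := F) W' _ hg1 = res hW' (fn W g hg) - algebraMap ℝ _ d := by
    refine SuperFun.ext_ext0 fun y hy => ?_
    have : ((res hW' (fn (V := V') (E := F) W g hg)) + (-d) • 1).ext0 y =
      algebraMap ℝ _ (g y - d) := by
      rw [ext0_add, ext0_smul, ext0_one hy, ext0_res _ _ hy, ext0_fn (hW' hy),
        ← Algebra.algebraMap_eq_smul_one, ← map_add, sub_eq_add_neg]
    rw [ext0_fn hy, ← this, Algebra.algebraMap_eq_smul_one, neg_smul, sub_eq_add_neg]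
  have h3 := congrArg (fun f => body (f.ext0 x)) (congrArg (Φ.pull W') h1)
  simp only [map_mul, map_one, ext0_mul] at h3
  rw [ext0_one (U := preim Φ.base W') hx', map_one, h2, map_sub, AlgEquiv.commutes,
    sub_eq_add_neg, Algebra.algebraMap_eq_smul_one, ← neg_smul, ext0_add, ext0_smul,
    ext0_one (U := preim Φ.base W') hx', ext0_pull_res Φ hW' _ hx', map_add, map_smul, map_one,
    ← hd] at h3
  simp at h3

lemma pull_hasParity {W : Opens N} {a : ZMod 2} {f : SuperFun B V' F W} (hf : HasParity a f) :
    HasParity a (Φ.pull W f) := (Φ.pull_parity W a f).2 hf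

/-- The fibrewise linear map induced by a diffeomorphism of supermanifolds. -/
def bundleMap (x : M) : E x →ₗ[ℝ] F (Φ.base x) :=
  -- The a-th coordinate of the image is the degree-one part of Φ^* θᵃ at `x`, so the map is the
  -- transpose of the degree-one part of Φ^*.
  ((trivializationAt V' F (Φ.base x)).symmL ℝ (Φ.base x) : V' →ₗ[ℝ] F (Φ.base x)) ∘ₗ
    ∑ a, (linPart ((Φ.pull (dom B V' F (Φ.base x)) (zc (Φ.base x) le_rfl (.inr a))).ext0 x)
      ).smulRight (Module.finBasis ℝ V' a)

lemma bundleMap_apply (x : M) (v : E x) :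
    (trivializationAt V' F (Φ.base x)).continuousLinearMapAt ℝ (Φ.base x) (bundleMap Φ x v) =
    ∑ a, linPart ((Φ.pull (dom B V' F (Φ.base x)) (zc (Φ.base x) le_rfl (.inr a))).ext0 x) v •
      Module.finBasis ℝ V' a := by
  have := (trivializationAt V' F (Φ.base x)).continuousLinearMapAt_symmL
    (mem_dom_self (A := B) (V := V') (E := F) (Φ.base x)).2 (R := ℝ)
    (∑ a, linPart ((Φ.pull (dom B V' F (Φ.base x)) (zc (Φ.base x) le_rfl (.inr a))).ext0 x) v •
      Module.finBasis ℝ V' a)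
  rw [← this]
  congr 1
  simp [bundleMap]

lemma body_pull_cst {x : M} {W : Opens N} (hW : W ≤ dom B V' F (Φ.base x))
    (hx : Φ.base x ∈ W) (u : LDual V') :
    body ((Φ.pull W (cst (trivializationAt V' F (Φ.base x)) W (subset_baseSet_of_le_dom hW) u)
      ).ext0 x) = body u := by
  change body ((Φ.pull W (cstHom (trivializationAt V' F (Φ.base x)) W
    (subset_baseSet_of_le_dom hW) u)).ext0 x) = body u
  induction u using ExteriorAlgebra.induction with
  | algebraMap r =>
    rw [AlgHom.commutes, AlgEquiv.commutes, Algebra.algebraMap_eq_smul_one, ext0_smul,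
      ext0_one (U := preim Φ.base W) hx]
    simp
  | ι η =>
    rw [body_ι]
    refine body_ext0_of_odd (pull_hasParity Φ ?_) x
    refine hasParity_of_loc (trivializationAt V' F (Φ.base x)) (subset_baseSet_of_le_dom hW)
      fun y hy => ?_
    have : loc (trivializationAt V' F (Φ.base x)) (cstHom (A := B)
        (trivializationAt V' F (Φ.base x)) W (subset_baseSet_of_le_dom hW)
        (ExteriorAlgebra.ι ℝ η)) y = ExteriorAlgebra.ι ℝ η :=
      loc_cst _ (subset_baseSet_of_le_dom hW) hy
    rw [this]
    exact ι_mem_parityPart η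
  | mul u v hu hv => rw [map_mul, map_mul (Φ.pull W), ext0_mul, map_mul, hu, hv, map_mul]
  | add u v hu hv => rw [map_add, map_add (Φ.pull W), ext0_add, map_add, hu, hv, map_add]

/-- For odd coordinates this is the definition of `bundleMap`. It passes to products by the Leibniz
rule for `linPart`, because bodies are preserved by `body_pull_cst`. -/
lemma linPart_pull_cst {x : M} {W : Opens N} (hW : W ≤ dom B V' F (Φ.base x))
    (hx : Φ.base x ∈ W) (u : LDual V') (v : E x) :
    linPart ((Φ.pull W (cst (trivializationAt V' F (Φ.base x)) W (subset_baseSet_of_le_dom hW) u)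
      ).ext0 x) v = linPart u ((trivializationAt V' F (Φ.base x)).continuousLinearMapAt ℝ
        (Φ.base x) (bundleMap Φ x v)) := by
  have hb := body_pull_cst Φ hW hx
  change linPart ((Φ.pull W (cstHom (trivializationAt V' F (Φ.base x)) W
    (subset_baseSet_of_le_dom hW) u)).ext0 x) v = _
  change ∀ u, body ((Φ.pull W (cstHom (trivializationAt V' F (Φ.base x)) W
    (subset_baseSet_of_le_dom hW) u)).ext0 x) = body u at hb
  induction u using ExteriorAlgebra.induction with
  | algebraMap r =>
    rw [AlgHom.commutes, AlgEquiv.commutes, Algebra.algebraMap_eq_smul_one, ext0_smul,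
      ext0_one (U := preim Φ.base W) hx]
    simp
  | ι η =>
    have h1 : ExteriorAlgebra.ι ℝ η = ∑ a, η (Module.finBasis ℝ V' a) •
        ExteriorAlgebra.ι ℝ ((Module.finBasis ℝ V').coord a) := by
      simp only [← map_smul, ← map_sum]
      congr 1
      exact (Module.finBasis ℝ V').ext fun b => by simp
    have h2 : ∀ a, (Φ.pull W (cstHom (trivializationAt V' F (Φ.base x)) W
        (subset_baseSet_of_le_dom hW) (ExteriorAlgebra.ι ℝ ((Module.finBasis ℝ V').coord a)))
        ).ext0 x = (Φ.pull (dom B V' F (Φ.base x)) (zc (Φ.base x) le_rfl (.inr a))).ext0 x := by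
      intro a
      rw [← ext0_pull_res Φ hW _ hx, res_zc]
      rfl
    rw [bundleMap_apply, linPart_ι]
    conv_lhs => rw [h1]
    simp only [map_sum, map_smul, ext0_sum, ext0_smul, LinearMap.sum_apply, LinearMap.smul_apply,
      h2, smul_eq_mul]
    exact Finset.sum_congr rfl fun a _ => mul_comm _ _
  | mul u v hu hv =>
    rw [map_mul, map_mul (Φ.pull W), ext0_mul, linPart_mul, linPart_mul, hb, hb]
    simp only [LinearMap.add_apply, LinearMap.smul_apply, hu, hv]
  | add u v hu hv =>
    rw [map_add, map_add (Φ.pull W), ext0_add, map_add, map_add, LinearMap.add_apply,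
      LinearMap.add_apply, hu, hv]

/-- Describes Φ^* on 𝒪/J²: it is composition with φ and the fibrewise linear map. The proof splits f
into functions on the base times constant forms and treats each kind of factor separately. -/
lemma body_linPart_pull {W : Opens N} (f : SuperFun B V' F W) {x : M} (hx : Φ.base x ∈ W) :
    body ((Φ.pull W f).ext0 x) = body (f.ext0 (Φ.base x)) ∧
    ∀ v, linPart ((Φ.pull W f).ext0 x) v = linPart (f.ext0 (Φ.base x)) (bundleMap Φ x v) := by
  let e := trivializationAt V' F (Φ.base x)
  have hd : W ⊓ dom B V' F (Φ.base x) ≤ dom B V' F (Φ.base x) := inf_le_right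
  have hW : W ⊓ dom B V' F (Φ.base x) ≤ W := inf_le_left
  have hx' : Φ.base x ∈ W ⊓ dom B V' F (Φ.base x) := ⟨hx, mem_dom_self _⟩
  have hl : ∀ v, linPart (f.ext0 (Φ.base x)) (bundleMap Φ x v) =
      linPart (loc e (res hW f) (Φ.base x)) (e.continuousLinearMapAt ℝ _ (bundleMap Φ x v)) :=
    fun v => by rw [linPart_loc e _ (hd hx').2, ext0_res hW f hx']
  have hb : body (f.ext0 (Φ.base x)) = body (loc e (res hW f) (Φ.base x)) := by
    rw [body_loc, ext0_res hW f hx']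
  have hsum := eq_sum_fn_mul_cst e (subset_baseSet_of_le_dom hd) (res hW f)
  have hsm := coord_smooth e (subset_baseSet_of_le_dom hd) (res hW f)
  have hrepr := (lbasis V').sum_repr (loc e (res hW f) (Φ.base x))
  -- The pullback of a function on the base is even but may have components of degree two and
  -- higher; only its degree-one part is guaranteed to vanish.
  have hpe : ∀ I, linPart ((Φ.pull _ (fn (V := V') (E := F) _ _ (hsm ((lbasis V').coord I)))
      ).ext0 x) = 0 :=
    fun I => linPart_ext0_of_even (pull_hasParity Φ (fn_hasParity _)) x
  constructor
  · rw [hb, ← ext0_pull_res Φ hW f hx']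
    conv_lhs => rw [hsum]
    conv_rhs => rw [← hrepr]
    simp only [map_sum, ext0_sum, map_mul, ext0_mul, map_smul, smul_eq_mul]
    exact Finset.sum_congr rfl fun I _ => by
      rw [body_pull_fn Φ _ hx', body_pull_cst Φ hd hx']; rfl
  · intro v
    rw [hl, ← ext0_pull_res Φ hW f hx']
    conv_lhs => rw [hsum]
    conv_rhs => rw [← hrepr]
    simp only [map_sum, ext0_sum, map_mul, ext0_mul, map_smul, linPart_mul, hpe, smul_zero,
      add_zero, LinearMap.sum_apply, LinearMap.smul_apply, smul_eq_mul]
    exact Finset.sum_congr rfl fun I _ => by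
      rw [body_pull_fn Φ _ hx', linPart_pull_cst Φ hd hx']; rfl

end Diffeo

/-! ### Contractions with sections on arbitrary superfunctions -/

section Contraction

variable {A : Type*} [NormedAddCommGroup A] [NormedSpace ℝ A] [FiniteDimensional ℝ A]
  {V : Type*} [NormedAddCommGroup V] [NormedSpace ℝ V] [FiniteDimensional ℝ V]
  {M : Type*} [TopologicalSpace M] [ChartedSpace A M] [IsManifold 𝓘(ℝ, A) ∞ M]
  {E : M → Type*} [∀ x, AddCommGroup (E x)] [∀ x, Module ℝ (E x)]
  [∀ x, TopologicalSpace (E x)] [TopologicalSpace (TotalSpace V E)]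
  [FiberBundle V E] [VectorBundle ℝ V E] [ContMDiffVectorBundle ∞ V E 𝓘(ℝ, A)]

lemma contr_of_affProj {V : Type*} [AddCommGroup V] [Module ℝ V] (v : V) {u : LDual V}
    (hu : affProj u = u) : contr v u = algebraMap ℝ _ (linPart u v) := by
  obtain ⟨c, η, rfl⟩ := affProj_eq_self_iff.1 hu
  simp

lemma isContraction_iff {U : Opens M} {s : ∀ x, E x} {X : SuperVF A V E U} :
    IsContraction s X ↔ VFParity 1 X ∧ ∀ (W : Opens M) (h : W ≤ U) (f : SuperFun A V E W),
      IsAffine f → ∀ x ∈ W, (act X h f).ext0 x = algebraMap ℝ _ (linPart (f.ext0 x) (s x)) := by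
  refine and_congr_right fun _ => forall_congr' fun W => forall_congr' fun h =>
    forall_congr' fun f => imp_congr_right fun _ => ⟨fun H x hx => ?_, fun H x => ?_⟩
  · rw [SuperFun.ext0_of_mem _ hx, SuperFun.ext0_of_mem _ hx]
    exact H ⟨x, hx⟩
  · have := H x x.2
    rwa [SuperFun.ext0_of_mem _ x.2, SuperFun.ext0_of_mem _ x.2] at this

lemma IsAffine.affProj_ext0 {U : Opens M} {f : SuperFun A V E U} (hf : IsAffine f) {x : M}
    (hx : x ∈ U) : affProj (f.ext0 x) = f.ext0 x := by
  rw [SuperFun.ext0_of_mem _ hx]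
  exact affProj_eq_self_iff.2 (hf ⟨x, hx⟩)

lemma isContraction_ctr {U : Opens M} {s : ∀ x, E x}
    (hs : ContMDiffOn 𝓘(ℝ, A) (𝓘(ℝ, A).prod 𝓘(ℝ, V)) ∞
      (fun x => (⟨x, s x⟩ : TotalSpace V E)) U) :
    IsContraction s (⟨ctrPre s hs, superDer_le _ _ (ctrPre_mem hs)⟩ : SuperVF A V E U) := by
  refine isContraction_iff.2 ⟨ctrPre_mem hs, fun W h f hf x hx => ?_⟩
  exact (ext0_ctrPre hs ⟨W, h⟩ f hx).trans (contr_of_affProj _ (hf.affProj_ext0 hx))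

/-- The value of the contraction with a section on an arbitrary superfunction. -/
lemma IsContraction.body_act {U : Opens M} {s : ∀ x, E x}
    (hs : ContMDiffOn 𝓘(ℝ, A) (𝓘(ℝ, A).prod 𝓘(ℝ, V)) ∞
      (fun x => (⟨x, s x⟩ : TotalSpace V E)) U) {X : SuperVF A V E U} (hX : IsContraction s X)
    {W : Opens M} (h : W ≤ U) (f : SuperFun A V E W) {x : M} (hx : x ∈ W) :
    body ((act X h f).ext0 x) = linPart (f.ext0 x) (s x) := by
  have hd : W ⊓ dom A V E x ≤ dom A V E x := inf_le_right
  have hW : W ⊓ dom A V E x ≤ W := inf_le_left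
  have hx' : x ∈ W ⊓ dom A V E x := ⟨hx, mem_dom_self _⟩
  have hs' := hs.mono (hW.trans h)
  have hX' := isContraction_iff.1 hX
  -- `IsContraction` fixes X only on affine superfunctions. The coordinates are affine, so X agrees
  -- with the explicit contraction on them and hence on all superfunctions.
  have h0 := der_eq_zero hd (Submodule.sub_mem _ (VFParity.resVF (hW.trans h) hX.1)
    (ctrPre_mem hs')) fun γ => by
      rw [Pi.sub_apply, LinearMap.sub_apply, sub_eq_zero]
      refine SuperFun.ext_ext0 fun y hy => ?_
      rw [ext0_ctrPre hs' _ _ hy, contr_of_affProj _ ((zc_isAffine hd γ).affProj_ext0 hy)]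
      exact hX'.2 _ (hW.trans h) _ (zc_isAffine hd γ) y hy
  have h1 : act X (hW.trans h) (res hW f) = ctrPre s hs' ⟨_, le_rfl⟩ (res hW f) :=
    LinearMap.congr_fun (congrFun (sub_eq_zero.1 h0) ⟨_, le_rfl⟩) (res hW f)
  rw [act_res h hW] at h1
  rw [← ext0_res hW _ hx', h1, ext0_ctrPre hs' _ _ hx', body_contr, ext0_res hW _ hx']

end Contraction

/-! ### The induced bundle map and the diffeomorphism of total spaces -/

section Diffeo

variable {A : Type*} [NormedAddCommGroup A] [NormedSpace ℝ A] [FiniteDimensional ℝ A]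
  {V : Type*} [NormedAddCommGroup V] [NormedSpace ℝ V] [FiniteDimensional ℝ V]
  {M : Type*} [TopologicalSpace M] [ChartedSpace A M] [IsManifold 𝓘(ℝ, A) ∞ M]
  {E : M → Type*} [∀ x, AddCommGroup (E x)] [∀ x, Module ℝ (E x)]
  [∀ x, TopologicalSpace (E x)] [TopologicalSpace (TotalSpace V E)]
  [FiberBundle V E] [VectorBundle ℝ V E] [ContMDiffVectorBundle ∞ V E 𝓘(ℝ, A)]
  {B : Type*} [NormedAddCommGroup B] [NormedSpace ℝ B] [FiniteDimensional ℝ B]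
  {V' : Type*} [NormedAddCommGroup V'] [NormedSpace ℝ V'] [FiniteDimensional ℝ V']
  {N : Type*} [TopologicalSpace N] [ChartedSpace B N] [IsManifold 𝓘(ℝ, B) ∞ N]
  {F : N → Type*} [∀ y, AddCommGroup (F y)] [∀ y, Module ℝ (F y)]
  [∀ y, TopologicalSpace (F y)] [TopologicalSpace (TotalSpace V' F)]
  [FiberBundle V' F] [VectorBundle ℝ V' F] [ContMDiffVectorBundle ∞ V' F 𝓘(ℝ, B)]

variable (Φ : SuperDiffeo A V E B V' F)

lemma pull_act_push {W W' : Opens N} (h : W' ≤ W) (X : SuperVF A V E (preim Φ.base W))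
    (f : SuperFun B V' F W') :
    Φ.pull W' (act (Φ.push X) h f) = act X (preim_mono Φ.base h) (Φ.pull W' f) :=
  Φ.pull_conj X.1 ⟨W', h⟩ f

/-- The body of Φ_* ι_s f at φ(x) is the body of ι_s(Φ^* f) at `x`, that is, the degree-one part of
Φ^* f on s(x). Since Φ^* f need not be affine, the contraction must be known on all superfunctions.
-/
lemma bundleMap_isInduced : Φ.IsInduced (bundleMap Φ) := by
  intro W s X hs hX W' h f _ x hx
  have h1 := (body_linPart_pull Φ (act (Φ.push X) h f) hx).1
  rw [pull_act_push, hX.body_act hs (preim_mono Φ.base h) _ (x := x) hx,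
    (body_linPart_pull Φ f hx).2, SuperFun.ext0_of_mem _ hx, SuperFun.ext0_of_mem _ hx] at h1
  exact h1.symm

/-- The image of an open set under a diffeomorphism. -/
abbrev imag (φ : Diffeomorph 𝓘(ℝ, A) 𝓘(ℝ, B) M N ∞) (U : Opens M) : Opens N := preim φ.symm U

lemma preim_imag_le (φ : Diffeomorph 𝓘(ℝ, A) 𝓘(ℝ, B) M N ∞) (U : Opens M) :
    preim φ (imag φ U) ≤ U := fun x hx => by
  have : φ.symm (φ x) ∈ U := hx
  rwa [φ.symm_apply_apply] at this

lemma le_preim_imag (φ : Diffeomorph 𝓘(ℝ, A) 𝓘(ℝ, B) M N ∞) (U : Opens M) :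
    U ≤ preim φ (imag φ U) := fun x hx => by
  change φ.symm (φ x) ∈ U
  rwa [φ.symm_apply_apply]

lemma eq_of_linPart_zc {y : N} {w w' : F y}
    (h : ∀ a, linPart ((zc (A := B) (V := V') (E := F) y le_rfl (.inr a)).ext0 y) w =
      linPart ((zc (A := B) (V := V') (E := F) y le_rfl (.inr a)).ext0 y) w') : w = w' := by
  have hy := mem_dom_self (A := B) (V := V') (E := F) y
  have h1 : ∀ w : F y, ∀ a, linPart ((zc (A := B) (V := V') (E := F) y le_rfl (.inr a)).ext0 y) w =
      (Module.finBasis ℝ V').coord a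
        ((trivializationAt V' F y).continuousLinearMapAt ℝ y w) := fun w a => by
    rw [← linPart_loc _ _ hy.2, loc_zc_inr le_rfl a hy, linPart_ι]
  simp only [h1] at h
  rw [← (trivializationAt V' F y).symmL_continuousLinearMapAt (R := ℝ) hy.2 w,
    ← (trivializationAt V' F y).symmL_continuousLinearMapAt (R := ℝ) hy.2 w']
  congr 1
  exact (Module.finBasis ℝ V').ext_elem h

/-- A vector extends to a local section which is smooth near its base point. -/
def constSec (x : M) (v : E x) : ∀ y, E y := fun y =>
  (trivializationAt V E x).symmL ℝ y ((trivializationAt V E x).continuousLinearMapAt ℝ x v)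

lemma constSec_self (x : M) (v : E x) : constSec (V := V) x v x = v :=
  (trivializationAt V E x).symmL_continuousLinearMapAt
    (FiberBundle.mem_baseSet_trivializationAt' x) v

lemma constSec_smooth (x : M) (v : E x) :
    ContMDiffOn 𝓘(ℝ, A) (𝓘(ℝ, A).prod 𝓘(ℝ, V)) ∞
      (fun y => (⟨y, constSec (V := V) x v y⟩ : TotalSpace V E)) (dom A V E x) := by
  refine ((trivializationAt V E x).contMDiffOn_section_iff (dom A V E x).2
    fun y hy => hy.2).2 (contMDiffOn_const
      (c := (trivializationAt V E x).continuousLinearMapAt ℝ x v) |>.congr fun y hy => ?_)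
  rw [← (trivializationAt V E x).continuousLinearMapAt_apply_of_mem (R := ℝ) hy.2, constSec,
    (trivializationAt V E x).continuousLinearMapAt_symmL hy.2]

/-- Each vector is the value of a local section with constant expression in a trivialization.
Contraction with that section, tested on the odd coordinates of F, prescribes every coordinate of
the image vector. -/
lemma eq_bundleMap {L : ∀ x : M, E x →ₗ[ℝ] F (Φ.base x)} (hL : Φ.IsInduced L) :
    L = bundleMap Φ := by
  funext x
  ext v
  refine eq_of_linPart_zc (B := B) (V' := V') fun a => ?_
  have hs := (constSec_smooth (A := A) (V := V) x v).mono
    (preim_imag_le Φ.base (dom A V E x))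
  have hx : Φ.base x ∈ imag Φ.base (dom A V E x) := le_preim_imag Φ.base _ (mem_dom_self x)
  let W' := imag Φ.base (dom A V E x) ⊓ dom B V' F (Φ.base x)
  have hx' : Φ.base x ∈ W' := ⟨hx, mem_dom_self _⟩
  have hd : W' ≤ dom B V' F (Φ.base x) := inf_le_right
  have h1 := hL _ _ _ hs (isContraction_ctr hs) W' inf_le_left _
    (zc_isAffine hd (.inr a)) x hx'
  have h2 := bundleMap_isInduced Φ _ _ _ hs (isContraction_ctr hs) W' inf_le_left _
    (zc_isAffine hd (.inr a)) x hx'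
  have h3 := h1.symm.trans h2
  rw [constSec_self, ← SuperFun.ext0_of_mem _ hx', ← res_zc le_rfl hd, ext0_res _ _ hx'] at h3
  exact h3

/-- The map of total spaces induced by a diffeomorphism of supermanifolds. -/
def totalMap (p : TotalSpace V E) : TotalSpace V' F := ⟨Φ.base p.proj, bundleMap Φ p.proj p.2⟩

/-- The geometric form of `body_linPart_pull`. Smoothness, the inverse and the transport of vector
fields are all derived from this identity. -/
lemma psi_totalMap {W : Opens N} (f : SuperFun B V' F W) {p : TotalSpace V E}
    (hp : Φ.base p.proj ∈ W) : psi f (totalMap Φ p) = psi (Φ.pull W f) p := by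
  obtain ⟨h1, h2⟩ := body_linPart_pull Φ f hp
  rw [psi_eq, psi_eq, h1, h2]
  rfl

lemma triv_eq_sum_psi_zc {x₀ : N} {q : TotalSpace V' F} (hq : q.proj ∈ dom B V' F x₀) :
    (trivializationAt V' F x₀ q).2 = ∑ a, psi (zc (A := B) (E := F) x₀ le_rfl (.inr a)) q •
      Module.finBasis ℝ V' a := by
  have h1 : ∀ a, psi (zc (A := B) (E := F) x₀ le_rfl (.inr a)) q =
      (Module.finBasis ℝ V').coord a (trivializationAt V' F x₀ q).2 := fun a => by
    rw [psi_loc _ _ hq.2, loc_zc_inr le_rfl a hq, body_ι, linPart_ι, zero_add]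
  simp only [h1]
  exact ((Module.finBasis ℝ V').sum_repr _).symm

/-- The base component is φ, and the fibre coordinates of the image are ψ(Φ^* θᵃ), which are smooth
as ψ of superfunctions. -/
lemma totalMap_smooth : ContMDiff (𝓘(ℝ, A).prod 𝓘(ℝ, V)) (𝓘(ℝ, B).prod 𝓘(ℝ, V')) ∞
    (totalMap Φ) := by
  intro p
  refine contMDiffAt_totalSpace.2 ⟨(Φ.base.contMDiff.comp (contMDiff_proj E)).contMDiffAt, ?_⟩
  set W := dom B V' F (Φ.base p.proj) with hW
  have hp : p.proj ∈ preim Φ.base W := mem_dom_self _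
  have h1 : ContMDiffOn (𝓘(ℝ, A).prod 𝓘(ℝ, V)) 𝓘(ℝ, V') ∞ (fun q : TotalSpace V E =>
      ∑ a, psi (Φ.pull W (zc (Φ.base p.proj) le_rfl (.inr a))) q • Module.finBasis ℝ V' a)
      {q | q.proj ∈ preim Φ.base W} :=
    contMDiffOn_finsetSum fun a _ => (psi_smooth _).smul contMDiffOn_const
  refine (h1.contMDiffAt ((isOpen_proj_mem _).mem_nhds hp)).congr_of_eventuallyEq ?_
  filter_upwards [(isOpen_proj_mem (preim Φ.base W)).mem_nhds hp] with q hq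
  refine (triv_eq_sum_psi_zc (q := totalMap Φ q) hq).trans (Finset.sum_congr rfl fun a _ => ?_)
  rw [psi_totalMap Φ _ hq]

/-- The inverse of a diffeomorphism of supermanifolds. -/
def superSymm : SuperDiffeo B V' F A V E where
  base := Φ.base.symm
  -- The sets U and φ⁻¹(φ(U)) coincide, but not by definition, so the two directions are corrected
  -- by restriction maps.
  pull U :=
    { toFun := fun f => (Φ.pull (imag Φ.base U)).symm (res (preim_imag_le Φ.base U) f)
      invFun := fun g => res (le_preim_imag Φ.base U) (Φ.pull (imag Φ.base U) g)
      left_inv := fun f => by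
        change res _ (Φ.pull (imag Φ.base U) ((Φ.pull (imag Φ.base U)).symm _)) = f
        rw [AlgEquiv.apply_symm_apply]
        rfl
      right_inv := fun g => AlgEquiv.symm_apply_apply (Φ.pull (imag Φ.base U)) g
      map_mul' := fun f g => by
        rw [map_mul (res (preim_imag_le Φ.base U)), map_mul (Φ.pull (imag Φ.base U)).symm]
      map_add' := fun f g => by
        rw [map_add (res (preim_imag_le Φ.base U)), map_add (Φ.pull (imag Φ.base U)).symm]
      commutes' := fun r => by
        rw [AlgHom.commutes, AlgEquiv.commutes] }
  pull_res U U' h f := by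
    apply (Φ.pull (imag Φ.base U')).injective
    change Φ.pull (imag Φ.base U') ((Φ.pull (imag Φ.base U')).symm
      (res (preim_imag_le Φ.base U') (res h f))) =
      Φ.pull (imag Φ.base U') (res (preim_mono Φ.base.symm h)
        ((Φ.pull (imag Φ.base U)).symm (res (preim_imag_le Φ.base U) f)))
    rw [AlgEquiv.apply_symm_apply, Φ.pull_res, AlgEquiv.apply_symm_apply]
    rfl
  pull_parity U a f := by
    change HasParity a ((Φ.pull (imag Φ.base U)).symm (res (preim_imag_le Φ.base U) f)) ↔ _
    rw [← Φ.pull_parity, AlgEquiv.apply_symm_apply]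
    exact ⟨fun h => h.res (le_preim_imag Φ.base U), fun h => h.res _⟩

lemma pull_superSymm {U : Opens M} (f : SuperFun A V E U) :
    Φ.pull (imag Φ.base U) ((superSymm Φ).pull U f) = res (preim_imag_le Φ.base U) f :=
  AlgEquiv.apply_symm_apply _ _

/-- Separates points of a fibre by the functions ψ(f). It allows the two composites below to be
identified with the identity without transporting vectors along φ⁻¹(φ(x)) = x. -/
lemma psi_ext {p q : TotalSpace V E} (h : p.proj = q.proj)
    (hpsi : ∀ f : SuperFun A V E (dom A V E p.proj), psi f p = psi f q) : p = q := by
  obtain ⟨x, v⟩ := p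
  obtain ⟨y, w⟩ := q
  obtain rfl : x = y := h
  congr 1
  refine eq_of_linPart_zc (B := A) (V' := V) fun a => ?_
  have := hpsi (zc x le_rfl (.inr a))
  rwa [psi_eq, psi_eq, add_right_inj] at this

lemma totalMap_superSymm_totalMap (p : TotalSpace V E) :
    totalMap (superSymm Φ) (totalMap Φ p) = p := by
  symm
  have hb : (Φ.base.symm (Φ.base p.proj)) = p.proj := Φ.base.symm_apply_apply _
  refine psi_ext (A := A) hb.symm fun f => ?_
  have h1 : Φ.base p.proj ∈ imag Φ.base (dom A V E p.proj) :=
    le_preim_imag Φ.base _ (mem_dom_self _)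
  have h2 := psi_totalMap Φ (W := imag Φ.base (dom A V E p.proj)) ((superSymm Φ).pull _ f) h1
  rw [pull_superSymm, psi_res _ _ h1] at h2
  exact ((psi_totalMap (superSymm Φ) f (p := totalMap Φ p) h1).trans h2).symm

lemma totalMap_totalMap_superSymm (q : TotalSpace V' F) :
    totalMap Φ (totalMap (superSymm Φ) q) = q := by
  symm
  have hb : (Φ.base (Φ.base.symm q.proj)) = q.proj := Φ.base.apply_symm_apply _
  refine psi_ext (A := B) hb.symm fun f => ?_
  have h1 : Φ.base (Φ.base.symm q.proj) ∈ dom B V' F q.proj := by rw [hb]; exact mem_dom_self _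
  have h2 : imag Φ.base (preim Φ.base (dom B V' F q.proj)) ≤ dom B V' F q.proj := fun y hy => by
    have : Φ.base (Φ.base.symm y) ∈ dom B V' F q.proj := hy
    rwa [Φ.base.apply_symm_apply] at this
  have h3 : (superSymm Φ).pull (preim Φ.base (dom B V' F q.proj)) (Φ.pull _ f) = res h2 f := by
    apply (Φ.pull (imag Φ.base (preim Φ.base (dom B V' F q.proj)))).injective
    rw [pull_superSymm, Φ.pull_res]
  have h4 := psi_totalMap (superSymm Φ) (Φ.pull _ f) (p := q) h1
  rw [h3] at h4
  exact ((psi_totalMap Φ f (p := totalMap (superSymm Φ) q) h1).trans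
    (h4.trans (psi_res h2 f h1))).symm

/-- The diffeomorphism of total spaces induced by a diffeomorphism of supermanifolds. -/
def totalDiffeo : Diffeomorph (𝓘(ℝ, A).prod 𝓘(ℝ, V)) (𝓘(ℝ, B).prod 𝓘(ℝ, V'))
    (TotalSpace V E) (TotalSpace V' F) ∞ where
  toFun := totalMap Φ
  invFun := totalMap (superSymm Φ)
  left_inv := totalMap_superSymm_totalMap Φ
  right_inv := totalMap_totalMap_superSymm Φ
  contMDiff_toFun := totalMap_smooth Φ
  contMDiff_invFun := totalMap_smooth (superSymm Φ)

end Diffeo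

/-! ### Transport of connections along the induced diffeomorphism -/

section Transport

variable {A : Type*} [NormedAddCommGroup A] [NormedSpace ℝ A] [FiniteDimensional ℝ A]
  {V : Type*} [NormedAddCommGroup V] [NormedSpace ℝ V] [FiniteDimensional ℝ V]
  {M : Type*} [TopologicalSpace M] [ChartedSpace A M] [IsManifold 𝓘(ℝ, A) ∞ M]
  {E : M → Type*} [∀ x, AddCommGroup (E x)] [∀ x, Module ℝ (E x)]
  [∀ x, TopologicalSpace (E x)] [TopologicalSpace (TotalSpace V E)]
  [FiberBundle V E] [VectorBundle ℝ V E] [ContMDiffVectorBundle ∞ V E 𝓘(ℝ, A)]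
  {B : Type*} [NormedAddCommGroup B] [NormedSpace ℝ B] [FiniteDimensional ℝ B]
  {V' : Type*} [NormedAddCommGroup V'] [NormedSpace ℝ V'] [FiniteDimensional ℝ V']
  {N : Type*} [TopologicalSpace N] [ChartedSpace B N] [IsManifold 𝓘(ℝ, B) ∞ N]
  {F : N → Type*} [∀ y, AddCommGroup (F y)] [∀ y, Module ℝ (F y)]
  [∀ y, TopologicalSpace (F y)] [TopologicalSpace (TotalSpace V' F)]
  [FiberBundle V' F] [VectorBundle ℝ V' F] [ContMDiffVectorBundle ∞ V' F 𝓘(ℝ, B)]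

section Push

variable (Ψ : Diffeomorph (𝓘(ℝ, A).prod 𝓘(ℝ, V)) (𝓘(ℝ, B).prod 𝓘(ℝ, V'))
    (TotalSpace V E) (TotalSpace V' F) ∞)

/-- The pushforward of vector fields along a diffeomorphism of total spaces. -/
abbrev pushVF : TotalVF A V E → TotalVF B V' F :=
  VectorField.mpullback (𝓘(ℝ, B).prod 𝓘(ℝ, V')) (𝓘(ℝ, A).prod 𝓘(ℝ, V)) Ψ.symm

lemma mdifferentiableAt_diffeo (p : TotalSpace V E) :
    MDifferentiableAt (𝓘(ℝ, A).prod 𝓘(ℝ, V)) (𝓘(ℝ, B).prod 𝓘(ℝ, V')) Ψ p :=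
  Ψ.mdifferentiable (by simp) p

lemma mfderiv_diffeo_isInvertible (p : TotalSpace V E) :
    (mfderiv (𝓘(ℝ, A).prod 𝓘(ℝ, V)) (𝓘(ℝ, B).prod 𝓘(ℝ, V')) Ψ p).IsInvertible :=
  ⟨Ψ.mfderivToContinuousLinearEquiv (by simp) p, rfl⟩

lemma pushVF_apply (X : TotalVF A V E) (p : TotalSpace V E) :
    pushVF Ψ X (Ψ p) = mfderiv (𝓘(ℝ, A).prod 𝓘(ℝ, V)) (𝓘(ℝ, B).prod 𝓘(ℝ, V')) Ψ p (X p) := by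
  -- The points Ψ⁻¹(Ψ(p)) and p are equal only propositionally. Regarding all derivatives as maps of
  -- the model spaces lets one compose them without casts.
  let P : A × V →L[ℝ] B × V' := mfderiv (𝓘(ℝ, A).prod 𝓘(ℝ, V)) (𝓘(ℝ, B).prod 𝓘(ℝ, V')) Ψ p
  let Q : B × V' →L[ℝ] A × V :=
    mfderiv (𝓘(ℝ, B).prod 𝓘(ℝ, V')) (𝓘(ℝ, A).prod 𝓘(ℝ, V)) Ψ.symm (Ψ p)
  have hp : Ψ.symm (Ψ p) = p := Ψ.symm_apply_apply p
  have h1 : Q ∘L P = .id ℝ (A × V) := by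
    have h := mfderiv_comp p (mdifferentiableAt_diffeo Ψ.symm (Ψ p)) (mdifferentiableAt_diffeo Ψ p)
    have h2 : (Ψ.symm ∘ Ψ : TotalSpace V E → TotalSpace V E) = id :=
      funext fun r => Ψ.symm_apply_apply r
    rw [h2, mfderiv_id] at h
    exact h.symm
  have h2 : P ∘L Q = .id ℝ (B × V') := by
    have h := mfderiv_comp_of_eq (x := Ψ p) (mdifferentiableAt_diffeo Ψ p)
      (mdifferentiableAt_diffeo Ψ.symm (Ψ p)) hp
    have h2 : (Ψ ∘ Ψ.symm : TotalSpace V' F → TotalSpace V' F) = id :=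
      funext fun r => Ψ.apply_symm_apply r
    rw [h2, mfderiv_id] at h
    have h3 : ∀ r, r = p → (mfderiv (𝓘(ℝ, A).prod 𝓘(ℝ, V)) (𝓘(ℝ, B).prod 𝓘(ℝ, V')) Ψ r :
        A × V →L[ℝ] B × V') = P := by rintro _ rfl; rfl
    exact (congrArg (fun L : A × V →L[ℝ] B × V' => L ∘L Q) (h3 _ hp)).symm.trans h.symm
  have h3 : Q.inverse = P := ContinuousLinearMap.inverse_eq h1 h2
  have h4 : (X (Ψ.symm (Ψ p)) : A × V) = X p := by
    have : ∀ r, r = p → (X r : A × V) = X p := by rintro _ rfl; rfl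
    exact this _ hp
  change Q.inverse (X (Ψ.symm (Ψ p)) : A × V) = P (X p)
  rw [h3, h4]

lemma SmoothVFOn.pushVF {X : TotalVF A V E} {S : Set (TotalSpace V E)} (hX : SmoothVFOn X S) :
    SmoothVFOn (pushVF Ψ X) (Ψ.symm ⁻¹' S) :=
  ContMDiffOn.mpullback_vectorField_preimage hX Ψ.symm.contMDiff
    (fun q _ => mfderiv_diffeo_isInvertible Ψ.symm q) (by simp)

lemma mdifferentiableAt_pushVF {X : TotalVF A V E} {p : TotalSpace V E}
    (hX : MDifferentiableAt (𝓘(ℝ, A).prod 𝓘(ℝ, V)) (𝓘(ℝ, A).prod 𝓘(ℝ, V)).tangent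
      (fun p => (⟨p, X p⟩ : TangentBundle (𝓘(ℝ, A).prod 𝓘(ℝ, V)) (TotalSpace V E))) p) :
    MDifferentiableAt (𝓘(ℝ, B).prod 𝓘(ℝ, V')) (𝓘(ℝ, B).prod 𝓘(ℝ, V')).tangent
      (fun q => (⟨q, pushVF Ψ X q⟩ :
        TangentBundle (𝓘(ℝ, B).prod 𝓘(ℝ, V')) (TotalSpace V' F))) (Ψ p) := by
  have : Ψ.symm (Ψ p) = p := Ψ.symm_apply_apply p
  exact MDifferentiableAt.mpullback_vectorField (by rwa [this]) Ψ.symm.contMDiff.contMDiffAt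
    (mfderiv_diffeo_isInvertible Ψ.symm _) (n := ∞) (by norm_cast)

/-- The pullback of a covariant derivative along a diffeomorphism. -/
def pullCov (D : TotalConnection B V' F) (Y : TotalVF A V E) (p : TotalSpace V E) :
    TangentSpace (𝓘(ℝ, A).prod 𝓘(ℝ, V)) p →L[ℝ] TangentSpace (𝓘(ℝ, A).prod 𝓘(ℝ, V)) p :=
  (mfderiv (𝓘(ℝ, A).prod 𝓘(ℝ, V)) (𝓘(ℝ, B).prod 𝓘(ℝ, V')) Ψ p).inverse ∘L
    D (pushVF Ψ Y) (Ψ p) ∘L mfderiv (𝓘(ℝ, A).prod 𝓘(ℝ, V)) (𝓘(ℝ, B).prod 𝓘(ℝ, V')) Ψ p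

lemma mfderiv_pullCov (D : TotalConnection B V' F) (Y : TotalVF A V E) (p : TotalSpace V E)
    (v : TangentSpace (𝓘(ℝ, A).prod 𝓘(ℝ, V)) p) :
    mfderiv (𝓘(ℝ, A).prod 𝓘(ℝ, V)) (𝓘(ℝ, B).prod 𝓘(ℝ, V')) Ψ p (pullCov Ψ D Y p v) =
      D (pushVF Ψ Y) (Ψ p)
        (mfderiv (𝓘(ℝ, A).prod 𝓘(ℝ, V)) (𝓘(ℝ, B).prod 𝓘(ℝ, V')) Ψ p v) := by
  obtain ⟨e, he⟩ := mfderiv_diffeo_isInvertible Ψ p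
  rw [pullCov, ← he, ContinuousLinearMap.inverse_equiv]
  exact e.apply_symm_apply _

/-- The derivative of Ψ is injective, so both axioms can be checked after applying it. There they
are the axioms for `D` on the pushed-forward fields. -/
lemma pullCov_isCovariantDerivativeOn (D : TotalConnection B V' F) :
    IsCovariantDerivativeOn (A × V) (pullCov Ψ D) univ where
  add {σ σ' p} hσ hσ' _ := by
    have h := D.isCovariantDerivativeOnUniv.add (mdifferentiableAt_pushVF Ψ hσ)
      (mdifferentiableAt_pushVF Ψ hσ')
    have h2 : pushVF Ψ (σ + σ') = pushVF Ψ σ + pushVF Ψ σ' := VectorField.mpullback_add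
    refine ContinuousLinearMap.ext fun v => ?_
    refine (mfderiv_diffeo_isInvertible Ψ p).injective ?_
    rw [add_apply, map_add, mfderiv_pullCov, mfderiv_pullCov, mfderiv_pullCov, h2]
    exact DFunLike.congr_fun h _
  leibniz {σ g p} hσ hg _ := by
    have hg' : MDifferentiableAt (𝓘(ℝ, B).prod 𝓘(ℝ, V')) 𝓘(ℝ, ℝ) (g ∘ Ψ.symm) (Ψ p) :=
      MDifferentiableAt.comp_of_eq _ hg (mdifferentiableAt_diffeo Ψ.symm (Ψ p))
        (Ψ.symm_apply_apply p)
    have h := D.isCovariantDerivativeOnUniv.leibniz (mdifferentiableAt_pushVF Ψ hσ) hg'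
    have h2 : pushVF Ψ (g • σ) = (g ∘ Ψ.symm) • pushVF Ψ σ := VectorField.mpullback_smul
    have h3 : (g ∘ Ψ.symm) (Ψ p) = g p := congrArg g (Ψ.symm_apply_apply p)
    have h4 := mvfderiv_comp p hg' (mdifferentiableAt_diffeo Ψ p)
    have h5 : (g ∘ Ψ.symm) ∘ Ψ = g := funext fun r => congrArg g (Ψ.symm_apply_apply r)
    rw [h5] at h4
    refine ContinuousLinearMap.ext fun v => ?_
    refine (mfderiv_diffeo_isInvertible Ψ p).injective ?_
    rw [mfderiv_pullCov, h2]
    refine (DFunLike.congr_fun h _).trans ?_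
    rw [add_apply, smul_apply, add_apply, smul_apply, map_add, map_smul, mfderiv_pullCov, h3, h4]
    simp only [ContinuousLinearMap.smulRight_apply, map_smul]
    rw [pushVF_apply]
    rfl

/-- The field in question is the pushforward along Ψ⁻¹ of the derivative of Ψ_* Y in the direction
Ψ_* X, so its smoothness reduces to that of pushforwards and of `D`. -/
lemma smoothVFOn_pullCov [T2Space N] {D : TotalConnection B V' F}
    (hD : CovariantDerivative.ContMDiffCovariantDerivative D ∞)
    {U : Opens M} {W : Opens N} (hUW : ∀ q : TotalSpace V' F, (Ψ.symm q).proj ∈ U ↔ q.proj ∈ W)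
    {X Y : TotalVF A V E} (hX : SmoothVFOn X {p | p.proj ∈ U})
    (hY : SmoothVFOn Y {p | p.proj ∈ U}) :
    SmoothVFOn (fun p => pullCov Ψ D Y p (X p)) {p | p.proj ∈ U} := by
  have hs : Ψ.symm ⁻¹' {p : TotalSpace V E | p.proj ∈ U} = {q | q.proj ∈ W} := Set.ext hUW
  have hX' := hX.pushVF Ψ
  have hY' := hY.pushVF Ψ
  rw [hs] at hX' hY'
  have h1 := (smoothVFOn_cov hD hX' hY').pushVF Ψ.symm
  have h2 : Ψ.symm.symm ⁻¹' {q : TotalSpace V' F | q.proj ∈ W} = {p | p.proj ∈ U} := by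
    ext p
    refine (hUW (Ψ p)).symm.trans ?_
    rw [Ψ.symm_apply_apply]
    rfl
  rw [h2] at h1
  refine h1.congr fun p _ => ?_
  refine congrArg (TotalSpace.mk p) ?_
  exact congrArg (fun w => (mfderiv (𝓘(ℝ, A).prod 𝓘(ℝ, V)) (𝓘(ℝ, B).prod 𝓘(ℝ, V')) Ψ p).inverse
    (D (pushVF Ψ Y) (Ψ p) w)) (pushVF_apply Ψ X p).symm

end Push

variable (Φ : SuperDiffeo A V E B V' F)

lemma totalDiffeo_symm_proj_mem {U : Opens M} {q : TotalSpace V' F} :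
    ((totalDiffeo Φ).symm q).proj ∈ U ↔ q.proj ∈ imag Φ.base U := Iff.rfl

/-- Chain rule applied to ψ(f) ∘ Φ̂ = ψ(Φ^* f). -/
lemma mvfderiv_psi_pushVF {W : Opens N} (f : SuperFun B V' F W) (X : TotalVF A V E)
    {p : TotalSpace V E} (hp : Φ.base p.proj ∈ W) :
    mvfderiv (𝓘(ℝ, B).prod 𝓘(ℝ, V')) (psi f) (totalDiffeo Φ p)
        (pushVF (totalDiffeo Φ) X (totalDiffeo Φ p)) =
      mvfderiv (𝓘(ℝ, A).prod 𝓘(ℝ, V)) (psi (Φ.pull W f)) p (X p) := by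
  have h1 := mvfderiv_comp p (psi_mdifferentiableAt f (p := totalDiffeo Φ p) hp)
    (mdifferentiableAt_diffeo (totalDiffeo Φ) p)
  have h2 : psi f ∘ totalDiffeo Φ =ᶠ[𝓝 p] psi (Φ.pull W f) := by
    filter_upwards [(isOpen_proj_mem (preim Φ.base W)).mem_nhds hp] with r hr
    exact psi_totalMap Φ f hr
  have h3 := h2.mfderiv_eq (I := 𝓘(ℝ, A).prod 𝓘(ℝ, V)) (I' := 𝓘(ℝ, ℝ))
  rw [pushVF_apply]
  exact (DFunLike.congr_fun h1 (X p)).symm.trans (DFunLike.congr_fun h3 (X p))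

lemma VFParity.push {W : Opens N} {a : ZMod 2} {X : SuperVF A V E (preim Φ.base W)}
    (hX : VFParity a X) : VFParity a (Φ.push X) := Φ.conj_mem hX

/-- Expresses Φ̂_* Ψ(X) = Ψ(Φ_* X). Even for affine f the pullback Φ^* f may have higher components,
so the relation for X is used in the form valid on all superfunctions. -/
lemma IsPsi.push {W : Opens N} {X : SuperVF A V E (preim Φ.base W)} {X' : TotalVF A V E}
    (hX : VFParity 0 X) (hXX' : IsPsi X X') :
    IsPsi (Φ.push X) (pushVF (totalDiffeo Φ) X') := by
  constructor
  · refine ContMDiffOn.mono (hXX'.1.pushVF (totalDiffeo Φ)) fun q hq => ?_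
    change Φ.base (Φ.base.symm q.proj) ∈ W
    rwa [Φ.base.apply_symm_apply]
  · intro W' h f _ q hq
    obtain ⟨p, rfl⟩ : ∃ p, totalDiffeo Φ p = q := ⟨_, (totalDiffeo Φ).apply_symm_apply q⟩
    rw [mvfderiv_psi_pushVF Φ f X' hq, hXX'.mvfderiv_psi hX (preim_mono Φ.base h) _ hq,
      ← pull_act_push]
    exact (psi_totalMap Φ _ hq).symm

lemma IsPsi.resVF {U U' : Opens M} (h : U' ≤ U) {X : SuperVF A V E U} {X' : TotalVF A V E}
    (hXX' : IsPsi X X') : IsPsi (resVF h X) X' :=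
  ⟨ContMDiffOn.mono hXX'.1 fun _ hp => h hp, fun W hW => hXX'.2 W (hW.trans h)⟩

/-- Diffeomorphisms of supermanifolds with connection are compatible with the induced
connections on the total spaces. -/
lemma pullCov_reduction {C : SuperConnection A V E} {C' : SuperConnection B V' F}
    (hΦ : Φ.PreservesConnection C C') {U : Opens M} {X Y : SuperVF A V E U}
    {X' Y' : TotalVF A V E} (hX : VFParity 0 X) (hY : VFParity 0 Y) (hXX' : IsPsi X X')
    (hYY' : IsPsi Y Y') (f : SuperFun A V E U) {p : TotalSpace V E} (hp : p.proj ∈ U) :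
    mvfderiv (𝓘(ℝ, A).prod 𝓘(ℝ, V)) (psi f) p
        (pullCov (totalDiffeo Φ) (inducedConn C') Y' p (X' p)) =
      psi (act (C.nabla U X Y) le_rfl f) p := by
  let W := imag Φ.base U
  have hW : preim Φ.base W ≤ U := preim_imag_le Φ.base U
  have hp' : p.proj ∈ preim Φ.base W := le_preim_imag Φ.base U hp
  -- Since Φ^* is onto, the test function may be taken to be a pullback, and the identity can be
  -- evaluated on the side of F.
  obtain ⟨g, hg⟩ := (Φ.pull W).surjective (res hW f)
  have h1 := mvfderiv_psi_pushVF Φ g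
    (fun p => pullCov (totalDiffeo Φ) (inducedConn C') Y' p (X' p)) hp'
  -- The pushed-forward fields may lie outside 𝓛₀; evenness and the relation `IsPsi` suffice for the
  -- reduction identity of the constructed connection.
  have h2 := inducedConn_reduction C' ((hX.resVF hW).push Φ) ((hY.resVF hW).push Φ)
    ((hXX'.resVF hW).push Φ (hX.resVF hW)) ((hYY'.resVF hW).push Φ (hY.resVF hW)) le_rfl g
    (p := totalDiffeo Φ p) hp'
  rw [pushVF_apply, mfderiv_pullCov, ← pushVF_apply, hg, mvfderiv_psi_res hW f hp'] at h1
  rw [← h1, h2, ← hΦ, C.nabla_res]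
  refine (psi_totalMap Φ _ hp').trans ?_
  rw [pull_act_push, hg, resVF_act, ← psi_res hW (act (C.nabla U X Y) le_rfl f) hp']
  exact congrArg (fun k => psi k p) (act_res le_rfl hW (C.nabla U X Y) f)

/-- Both connections satisfy the reduction identity of `C`, the pulled-back one because Φ preserves
the connections, so uniqueness identifies them. -/
lemma pullCov_eq_inducedConn [T2Space M] [T2Space N] {C : SuperConnection A V E}
    {C' : SuperConnection B V' F} (hΦ : Φ.PreservesConnection C C') {Y : TotalVF A V E}
    {p : TotalSpace V E}
    (hY : MDifferentiableAt (𝓘(ℝ, A).prod 𝓘(ℝ, V)) (𝓘(ℝ, A).prod 𝓘(ℝ, V)).tangent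
      (fun p => (⟨p, Y p⟩ : TangentBundle (𝓘(ℝ, A).prod 𝓘(ℝ, V)) (TotalSpace V E))) p) :
    pullCov (totalDiffeo Φ) (inducedConn C') Y p = inducedConn C Y p := by
  refine eqOn_of_reduction (le_refl (dom A V E p.proj))
    ((pullCov_isCovariantDerivativeOn _ _).mono (subset_univ _))
    ((inducedConn C).isCovariantDerivativeOnUniv.mono (subset_univ _))
    (fun X Y hX hY => smoothVFOn_pullCov _ (inducedConn_isReduction C').1
      (fun q => totalDiffeo_symm_proj_mem Φ) hX hY)
    (fun X Y hX hY => smoothVFOn_cov (inducedConn_isReduction C).1 hX hY)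
    (fun X Y X' Y' hX hY hXX' hYY' γ q hq => ?_) (mem_dom_self p.proj) hY
  rw [← mvfderiv_psi_zc le_rfl γ hq]
  exact (pullCov_reduction Φ hΦ hX.1 hY.1 hXX' hYY' _ hq).trans
    (inducedConn_reduction C hX.1 hY.1 hXX' hYY' le_rfl _ hq).symm

/-- By uniqueness `D` and `D'` agree with the constructed connections on differentiable fields, so
the claim is that the connection on F pulls back to the one on E. -/
lemma totalDiffeo_isConnectionDiffeo [T2Space M] [T2Space N] {C : SuperConnection A V E}
    {C' : SuperConnection B V' F} (hΦ : Φ.PreservesConnection C C')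
    {D : TotalConnection A V E} {D' : TotalConnection B V' F} (hD : IsReduction C D)
    (hD' : IsReduction C' D') : IsConnectionDiffeo (totalDiffeo Φ) D D' := by
  intro O X Y _ hY q hq
  obtain ⟨p, rfl⟩ : ∃ p, totalDiffeo Φ p = q := ⟨_, (totalDiffeo Φ).apply_symm_apply q⟩
  rw [(totalDiffeo Φ).symm_apply_apply] at hq
  have hYp := hY.mdifferentiableAt O.2 hq
  have h1 : D Y p = pullCov (totalDiffeo Φ) (inducedConn C') Y p :=
    (hD.eq_inducedConn hYp).trans (pullCov_eq_inducedConn Φ hΦ hYp).symm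
  have h2 := hD'.eq_inducedConn (mdifferentiableAt_pushVF (totalDiffeo Φ) hYp)
  change pushVF (totalDiffeo Φ) (fun p => D Y p (X p)) (totalDiffeo Φ p) =
    D' (pushVF (totalDiffeo Φ) Y) (totalDiffeo Φ p) (pushVF (totalDiffeo Φ) X (totalDiffeo Φ p))
  rw [h2, pushVF_apply, h1, mfderiv_pullCov, pushVF_apply]

end Transport

end SuperGeom

end

/-! ### The theorem -/

open SuperGeom in
theorem lemma3p12
    {A : Type*} [NormedAddCommGroup A] [NormedSpace ℝ A] [FiniteDimensional ℝ A]
    {V : Type*} [NormedAddCommGroup V] [NormedSpace ℝ V] [FiniteDimensional ℝ V]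
    {M : Type*} [TopologicalSpace M] [T2Space M] [SecondCountableTopology M]
    [ChartedSpace A M] [IsManifold 𝓘(ℝ, A) ∞ M]
    {E : M → Type*} [∀ x, AddCommGroup (E x)] [∀ x, Module ℝ (E x)]
    [∀ x, TopologicalSpace (E x)] [TopologicalSpace (Bundle.TotalSpace V E)]
    [FiberBundle V E] [VectorBundle ℝ V E] [ContMDiffVectorBundle ∞ V E 𝓘(ℝ, A)]
    {B : Type*} [NormedAddCommGroup B] [NormedSpace ℝ B] [FiniteDimensional ℝ B]
    {V' : Type*} [NormedAddCommGroup V'] [NormedSpace ℝ V'] [FiniteDimensional ℝ V']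
    {N : Type*} [TopologicalSpace N] [T2Space N] [SecondCountableTopology N]
    [ChartedSpace B N] [IsManifold 𝓘(ℝ, B) ∞ N]
    {F : N → Type*} [∀ y, AddCommGroup (F y)] [∀ y, Module ℝ (F y)]
    [∀ y, TopologicalSpace (F y)] [TopologicalSpace (Bundle.TotalSpace V' F)]
    [FiberBundle V' F] [VectorBundle ℝ V' F] [ContMDiffVectorBundle ∞ V' F 𝓘(ℝ, B)]
    (C : SuperConnection A V E) (C' : SuperConnection B V' F)
    (Φ : SuperDiffeo A V E B V' F) (hΦ : Φ.PreservesConnection C C') :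
    (∃ D : TotalConnection A V E, IsReduction C D) ∧
    (∃ D' : TotalConnection B V' F, IsReduction C' D') ∧
    (∃! L : ∀ x : M, E x →ₗ[ℝ] F (Φ.base x), Φ.IsInduced L) ∧
    (∀ L : ∀ x : M, E x →ₗ[ℝ] F (Φ.base x), Φ.IsInduced L →
      ∃ Φh : Diffeomorph (𝓘(ℝ, A).prod 𝓘(ℝ, V)) (𝓘(ℝ, B).prod 𝓘(ℝ, V'))
          (Bundle.TotalSpace V E) (Bundle.TotalSpace V' F) ∞,
        (∀ (x : M) (v : E x), Φh ⟨x, v⟩ = ⟨Φ.base x, L x v⟩) ∧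
        ∀ (D : TotalConnection A V E) (D' : TotalConnection B V' F),
          IsReduction C D → IsReduction C' D' → IsConnectionDiffeo Φh D D') := by
  refine ⟨⟨_, inducedConn_isReduction C⟩, ⟨_, inducedConn_isReduction C'⟩,
    ⟨bundleMap Φ, bundleMap_isInduced Φ, fun L hL => eq_bundleMap Φ hL⟩, fun L hL => ?_⟩
  obtain rfl := eq_bundleMap Φ hL
  exact ⟨totalDiffeo Φ, fun _ _ => rfl,
    fun D D' hD hD' => totalDiffeo_isConnectionDiffeo Φ hΦ hD hD'⟩
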